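/- **Setting.** Let $(\Omega,\mathscr F,(\mathscr F(t))_{t\ge 0},\mathbb P)$ be a filtered probability space, $\nu$ a $\sigma$-finite measure on a measurable space $Z$, $W$ an $\mathbb R^m$-valued $(\mathscr F(t))$-Wiener process and $N$ an $(\mathscr F(t))$-Poisson random measure on $[0,\infty)\times Z$ with intensity $dt\otimes\nu$, independent of $W$; for every $s\ge0$ the increments of $(W,N)$ after time $s$ are independent of $\mathscr F(s)$. Write $\widetilde N(dt,dz)=N(dt,dz)-dt\,\nu(dz)$. Let $b:\mathbb R^d\to\mathbb R^d$, $\sigma:\mathbb R^d\to\mathbb R^{d\times m}$, $\gamma:\mathbb R^d\times Z\to\mathbb R^d$ be measurable with $\int_Z|\gamma(x,z)|^2\,\nu(dz)<\infty$ for every $x$. For a step size $\tau$ put $t_n=n\tau$. The stochastic theta method (STM) for the equation $dX(t)=b(X(t-))\,dt+\sigma(X(t-))\,dW(t)+\int_Z\gamma(X(t-),z)\,\widetilde N(dt,dz)$, started at $x\in\mathbb R^d$, is the $(\mathscr F(t_n))$-adapted sequence with $Z_0^x=x$ and, almost surely for all $n\in\mathbb N$ (including $0$), $$Z^x_{n+1}=Z^x_n+(1-\theta)\,b(Z^x_n)\,\tau+\theta\,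 b(Z^x_{n+1})\,\tau+\sigma(Z^x_n)\,(W(t_{n+1})-W(t_n))+\int_{t_n}^{t_{n+1}}\!\!\int_Z\gamma(Z^x_n,z)\,\widetilde N(ds,dz).$$ **Theorem 2.1.** Assume that $b$ is continuous and that there is a constant $L_1^*>0$ such that for all $x,y\in\mathbb R^d$ $$2\langle x-y,b(x)-b(y)\rangle+\|\sigma(x)-\sigma(y)\|^2+\int_Z|\gamma(x,z)-\gamma(y,z)|^2\,\nu(dz)\le-L_1^*|x-y|^2,$$ where $\|\cdot\|$ is the Hilbert--Schmidt norm. Let $\theta\in(1/2,1]$ and $\tau\in(0,1)$ satisfy $L_1^*\theta^2\tau\le 3-2\theta$. Then for every $x\in\mathbb R^d$ the STM has an almost surely unique solution $(Z^x_n)_{n\in\mathbb N}$, these solutions are homogeneous $(\mathscr F(t_n))$-Markov chains with a common transition kernel on $\mathbb R^d$, and this kernel has a unique invariant probability measure $\pi_\tau$. Moreover $\pi_\tau$ is exponentially mixing: there is a function $c:\mathbb R^d\to\mathbb R$ such that for every Lipschitz function $\phi:\mathbb R^d\to\mathbb R$ with Lipschitz constant $|\phi|_{\mathrm{Lip}}$,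 every $x\in\mathbb R^d$ and every $n\in\mathbb N$, the function $\phi$ is $\pi_\tau$-integrable, $\phi(Z_n^x)$ is integrable, and $$\Big|\mathbb E\,\phi(Z_n^x)-\int_{\mathbb R^d}\phi\,d\pi_\tau\Big|\le c(x)\,|\phi|_{\mathrm{Lip}}\;e^{-\frac12(\theta-\frac12)L_1^*t_n}.$$ -/

import Mathlib

open MeasureTheory ProbabilityTheory Filter Topology
open scoped NNReal ENNReal

noncomputable section

namespace JumpSTM

/-- `N` is a Poisson random measure on `X` with intensity measure `Λ`: a random measure such that
`N(A)` is Poisson distributed with parameter `Λ(A)` whenever `Λ(A) < ∞`, and the values of `N` on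
finitely many pairwise disjoint sets are independent. -/
structure IsPoissonRandomMeasure {Ω X : Type*} [MeasurableSpace Ω] [MeasurableSpace X]
    (P : Measure Ω) (N : Ω → Measure X) (Λ : Measure X) : Prop where
  measurable : Measurable N
  hasLaw : ∀ A : Set X, MeasurableSet A → Λ A ≠ ∞ →
    HasLaw (fun ω ↦ N ω A)
      ((poissonMeasure (Λ A).toNNReal).map (fun k : ℕ ↦ (k : ℝ≥0∞))) P
  indep : ∀ (n : ℕ) (A : Fin n → Set X), (∀ i, MeasurableSet (A i)) →
    Pairwise (fun i j ↦ Disjoint (A i) (A j)) →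
    iIndepFun (fun i ω ↦ N ω (A i)) P

/-- Lebesgue measure on the time axis `[0, ∞)`. -/
def timeMeasure : Measure ℝ≥0 := Measure.comap ((↑) : ℝ≥0 → ℝ) volume

/-- The driving noise on the filtered probability space `(Ω, ℱ, P)`: an `ℝᵐ`-valued `ℱ`-Wiener
process `W` and an independent `ℱ`-Poisson random measure `N` on `[0, ∞) × S` with intensity
`dt ⊗ ν`. -/
structure IsJumpDiffusionNoise {Ω S : Type*} [mΩ : MeasurableSpace Ω] [MeasurableSpace S] {m : ℕ}
    (P : Measure Ω) (ℱ : Filtration ℝ≥0 mΩ) (ν : Measure S)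
    (W : ℝ≥0 → Ω → EuclideanSpace ℝ (Fin m)) (N : Ω → Measure (ℝ≥0 × S)) : Prop where
  /-- The components of `W` are independent standard real Brownian motions. -/
  brownian : ∀ i, IsBrownianReal (fun t ω ↦ W t ω i) P
  brownian_indep : iIndepFun (fun (i : Fin m) (ω : Ω) (t : ℝ≥0) ↦ W t ω i) P
  poisson : IsPoissonRandomMeasure P N (timeMeasure.prod ν)
  /-- `W` and `N` are independent. -/
  indep : IndepFun (fun ω t ↦ W t ω) N P
  /-- `W` and `N` are adapted to the filtration. -/
  adapted_W : ∀ t, Measurable[ℱ t] (W t)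
  adapted_N : ∀ t, Measurable[ℱ t] (fun ω ↦ (N ω).restrict (Set.Iic t ×ˢ Set.univ))
  /-- The increments of the noise after time `s` are independent of the past `ℱ s`. -/
  indep_past : ∀ s, Indep (ℱ s)
    (MeasurableSpace.comap
      (fun ω ↦ ((fun t ↦ W (s + t) ω - W s ω), (N ω).restrict (Set.Ioi s ×ˢ Set.univ)))
      inferInstance) P

/-- The pathwise integral over `(s, t] × A` of `h` against the compensated measure
`Ñ(dr, dz) = N(dr, dz) - dr ν(dz)`, meaningful when `ν(A) < ∞`. -/
def truncatedIntegral {S : Type*} [MeasurableSpace S] {d : ℕ} (ν : Measure S)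
    (s t : ℝ≥0) (A : Set S) (h : S → EuclideanSpace ℝ (Fin d)) (n : Measure (ℝ≥0 × S)) :
    EuclideanSpace ℝ (Fin d) :=
  (∫ p in Set.Ioc s t ×ˢ A, h p.2 ∂n) - ((t : ℝ) - s) • ∫ z in A, h z ∂ν

/-- `J = ∫_s^t ∫_S H(z) Ñ(dr, dz)`, for a random integrand `H` which is known at time `s`
(constant in `r`) and square integrable with respect to `ν`: along every increasing
sequence of sets of finite `ν`-measure exhausting `S`, the integrals over `(s, t] × A k` converge
to `J` in probability. -/
def IsCompensatedIntegral {Ω S : Type*} [MeasurableSpace Ω] [MeasurableSpace S] {d : ℕ}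
    (P : Measure Ω) (ν : Measure S) (N : Ω → Measure (ℝ≥0 × S)) (s t : ℝ≥0)
    (H : Ω → S → EuclideanSpace ℝ (Fin d)) (J : Ω → EuclideanSpace ℝ (Fin d)) : Prop :=
  ∀ A : ℕ → Set S, Monotone A → (∀ k, MeasurableSet (A k)) → (∀ k, ν (A k) < ∞) →
    (⋃ k, A k) = Set.univ →
    TendstoInMeasure P (fun k ω ↦ truncatedIntegral ν s t (A k) (H ω) (N ω)) atTop J

/-- The coefficients of `dX = b(X) dt + σ(X) dW + ∫ γ(X, z) Ñ(dt, dz)`. -/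
structure Coefficients (d m : ℕ) (S : Type*) where
  /-- drift -/
  b : EuclideanSpace ℝ (Fin d) → EuclideanSpace ℝ (Fin d)
  /-- diffusion -/
  σ : EuclideanSpace ℝ (Fin d) → Matrix (Fin d) (Fin m) ℝ
  /-- jump coefficient -/
  γ : EuclideanSpace ℝ (Fin d) → S → EuclideanSpace ℝ (Fin d)

/-- The squared Hilbert-Schmidt norm. -/
def hsNormSq {d m : ℕ} (A : Matrix (Fin d) (Fin m) ℝ) : ℝ := ∑ i, ∑ j, A i j ^ 2

/-- The coefficients are measurable and `∫ |γ(x, z)|² ν(dz) < ∞` for every `x`, so that the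
stochastic integrals make sense. -/
structure Coefficients.Admissible {d m : ℕ} {S : Type*} [MeasurableSpace S]
    (c : Coefficients d m S) (ν : Measure S) : Prop where
  measurable_b : Measurable c.b
  measurable_σ : ∀ i j, Measurable (fun x ↦ c.σ x i j)
  measurable_γ : Measurable (Function.uncurry c.γ)
  memLp_γ : ∀ x, MemLp (c.γ x) 2 ν

/-- The strict dissipativity condition with constant `L`. -/
def Coefficients.StrictlyDissipative {d m : ℕ} {S : Type*} [MeasurableSpace S]
    (c : Coefficients d m S) (ν : Measure S) (L : ℝ) : Prop :=
  ∀ x y, 2 * inner ℝ (x - y) (c.b x - c.b y) + hsNormSq (c.σ x - c.σ y)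
      + ∫ z, ‖c.γ x z - c.γ y z‖ ^ 2 ∂ν ≤ -L * ‖x - y‖ ^ 2

/-- `Z` is a solution of the stochastic theta method with step size `τ` started at `x`, i.e.
an adapted sequence with `Z 0 = x` and, with `t_j = j τ`,
`Z_{j+1} = Z_j + (1 - θ) τ b(Z_j) + θ τ b(Z_{j+1}) + σ(Z_j) (W(t_{j+1}) - W(t_j))`
`+ ∫_{t_j}^{t_{j+1}} ∫ γ(Z_j, z) Ñ(ds, dz)` almost surely. -/
structure IsSTM {Ω S : Type*} [mΩ : MeasurableSpace Ω] [MeasurableSpace S] {d m : ℕ}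
    (P : Measure Ω) (ℱ : Filtration ℝ≥0 mΩ) (ν : Measure S)
    (W : ℝ≥0 → Ω → EuclideanSpace ℝ (Fin m)) (N : Ω → Measure (ℝ≥0 × S))
    (c : Coefficients d m S) (θ : ℝ) (τ : ℝ≥0)
    (x : EuclideanSpace ℝ (Fin d)) (Z : ℕ → Ω → EuclideanSpace ℝ (Fin d)) : Prop where
  adapted : ∀ j : ℕ, Measurable[ℱ (j * τ)] (Z j)
  initial : ∀ᵐ ω ∂P, Z 0 ω = x
  step : ∀ j : ℕ, ∃ J : Ω → EuclideanSpace ℝ (Fin d),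
    IsCompensatedIntegral P ν N (j * τ) ((j + 1 : ℕ) * τ) (fun ω ↦ c.γ (Z j ω)) J ∧
    ∀ᵐ ω ∂P, Z (j + 1) ω = Z j ω + ((1 - θ) * τ) • c.b (Z j ω) + (θ * τ) • c.b (Z (j + 1) ω)
      + WithLp.toLp 2 ((c.σ (Z j ω)).mulVec
          (W ((j + 1 : ℕ) * τ) ω - W (j * τ) ω).ofLp)
      + J ω

/-- `κ` is the one-step transition kernel of the stochastic theta method: every solution is a
homogeneous Markov chain with respect to `(ℱ (t_n))` whose transition probabilities are `κ`. -/
def IsTransitionKernel {Ω S : Type*} [mΩ : MeasurableSpace Ω] [MeasurableSpace S] {d m : ℕ}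
    (P : Measure Ω) (ℱ : Filtration ℝ≥0 mΩ) (ν : Measure S)
    (W : ℝ≥0 → Ω → EuclideanSpace ℝ (Fin m)) (N : Ω → Measure (ℝ≥0 × S))
    (c : Coefficients d m S) (θ : ℝ) (τ : ℝ≥0)
    (κ : Kernel (EuclideanSpace ℝ (Fin d)) (EuclideanSpace ℝ (Fin d))) : Prop :=
  ∀ x Z, IsSTM P ℱ ν W N c θ τ x Z → ∀ (n : ℕ) (B : Set (EuclideanSpace ℝ (Fin d))),
    MeasurableSet B →
    P[(Z (n + 1) ⁻¹' B).indicator (fun _ ↦ (1 : ℝ)) | ℱ (n * τ)] =ᵐ[P]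
      fun ω ↦ (κ (Z n ω)).real B

end JumpSTM

end

/-! Put `G x = x - θ τ b(x)`. A step of the method reads `G (Z_{n+1}) = Y(Z_n, noise)` with `Y`
explicit. Dissipativity makes `G` strongly monotone with constant `1`, and a continuous strongly
monotone map in finite dimension is onto (`surjective_of_strongly_monotone`). Hence `G` has a
1-Lipschitz inverse `g`, and the method is the random recursion `Z_{n+1} = g (Y(Z_n, noise))`.

For ergodicity, distances are measured by `‖G x - G y‖`. Let `D = x - y` and `B = b(x) - b(y)`. When
two steps are driven by the same noise, orthogonality of the Gaussian and jump parts bounds the mean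
square of `Y(x) - Y(y)` by `‖D + (1 - θ) τ B‖²` plus `τ` times the squared differences of `σ` and
`γ`. By `theta_contraction` this is at most `exp(-(θ - 1/2) L τ) ‖G x - G y‖²`. As `G` undoes `g`,
the kernel contracts the Wasserstein distance of this metric by the square root of that factor. A
contractive kernel has a unique invariant measure, reached at a geometric rate
(`IsContractiveVia.exists_invariant`, `IsContractiveVia.abs_iterate_sub_integral_le`). Since `G`
expands distances, ordinary Lipschitz functions are admissible test functions.

Most of the work lies in the jump integral, since `γ(y, ·)` is only square integrable and `y` is to
be replaced by the random state `Z_n`. `jumpIntegral` is a version that is jointly measurable in `y`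
and the random measure and reads the measure only over `(s, t]`. `tendstoInMeasure_of_indepFun` then
justifies inserting `Z_n`, which is independent of the later noise; the same freezing argument,
`measure_inter_preimage_of_indep`, gives the Markov property. Homogeneity holds because the law of
the integral depends only on `t - s` (`map_jumpIntegral_congr`). -/

namespace JumpSTM

/-! ### Strongly monotone maps in finite dimension -/

section StronglyMonotone

variable {E : Type*} [NormedAddCommGroup E] [InnerProductSpace ℝ E]

lemma mul_norm_sub_le_of_strongly_monotone {F : E → E} {c : ℝ}
    (hF : ∀ x y, c * ‖x - y‖ ^ 2 ≤ inner ℝ (x - y) (F x - F y)) (x y : E) :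
    c * ‖x - y‖ ≤ ‖F x - F y‖ := by
  rcases eq_or_ne x y with rfl | hxy
  · simp
  have h0 : 0 < ‖x - y‖ := norm_pos_iff.2 (sub_ne_zero.2 hxy)
  have h1 := (hF x y).trans (real_inner_le_norm _ _)
  refine le_of_mul_le_mul_left ?_ h0
  calc ‖x - y‖ * (c * ‖x - y‖) = c * ‖x - y‖ ^ 2 := by ring
    _ ≤ _ := h1

/-- Apply monotonicity to `x + t • v` and `x`, divide by `t ^ 2` and let `t` decrease to zero. -/
lemma inner_fderiv_ge_of_strongly_monotone {F : E → E} {c : ℝ}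
    (hF : ∀ x y, c * ‖x - y‖ ^ 2 ≤ inner ℝ (x - y) (F x - F y)) {x : E} {F' : E →L[ℝ] E}
    (hx : HasFDerivAt F F' x) (v : E) : c * ‖v‖ ^ 2 ≤ inner ℝ v (F' v) := by
  have h1 : HasDerivAt (fun t : ℝ ↦ x + t • v) v 0 := by
    simpa using ((hasDerivAt_id (0 : ℝ)).smul_const v).const_add x
  have h2 : HasDerivAt (fun t : ℝ ↦ F (x + t • v)) (F' v) 0 := by
    have hx' : HasFDerivAt F F' (x + (0 : ℝ) • v) := by simpa using hx
    exact hx'.comp_hasDerivAt 0 h1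
  have h4 := h2.tendsto_slope_zero_right
  have h5 : Tendsto (fun t : ℝ ↦ inner ℝ v (t⁻¹ • (F (x + (0 + t) • v) - F (x + (0 : ℝ) • v))))
      (𝓝[>] 0) (𝓝 (inner ℝ v (F' v))) := tendsto_const_nhds.inner h4
  refine ge_of_tendsto h5 ?_
  filter_upwards [self_mem_nhdsWithin] with t (ht : 0 < t)
  have h6 := hF (x + t • v) x
  rw [add_sub_cancel_left, norm_smul, inner_smul_left, Real.norm_of_nonneg ht.le] at h6
  simp only [zero_add, zero_smul, add_zero, inner_smul_right]
  simp only [conj_trivial] at h6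
  rw [← div_eq_inv_mul, le_div_iff₀ ht]
  refine le_of_mul_le_mul_left ?_ ht
  calc t * (c * ‖v‖ ^ 2 * t) = c * (t * ‖v‖) ^ 2 := by ring
    _ ≤ _ := h6

variable [FiniteDimensional ℝ E]

/-- The range is clopen in a connected space. It is open by the inverse function theorem, since
monotonicity makes each derivative injective, hence onto; it is closed because `c * ‖x - y‖ ≤ ‖F x -
F y‖` makes `F` proper. -/
lemma surjective_of_strongly_monotone_of_contDiff {F : E → E} {c : ℝ} (hc : 0 < c)
    (hF : ∀ x y, c * ‖x - y‖ ^ 2 ≤ inner ℝ (x - y) (F x - F y)) (hs : ContDiff ℝ 1 F) :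
    Function.Surjective F := by
  have := FiniteDimensional.complete ℝ E
  have hopen : IsOpenMap F := by
    refine isOpenMap_iff_nhds_le.2 fun x ↦ ?_
    have hd : HasStrictFDerivAt F (fderiv ℝ F x) x :=
      (hs.contDiffAt (x := x)).hasStrictFDerivAt one_ne_zero
    refine (hd.map_nhds_eq_of_surj ?_).ge
    have hinj : Function.Injective (fderiv ℝ F x : E →ₗ[ℝ] E) := by
      refine (injective_iff_map_eq_zero _).2 fun v hv ↦ ?_
      have h1 := inner_fderiv_ge_of_strongly_monotone hF hd.hasFDerivAt v
      have hv' : fderiv ℝ F x v = 0 := hv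
      rw [hv', inner_zero_right] at h1
      have : ‖v‖ ^ 2 ≤ 0 := nonpos_of_mul_nonpos_right h1 hc
      simpa using le_antisymm this (by positivity)
    exact LinearMap.range_eq_top.2 (LinearMap.injective_iff_surjective.1 hinj)
  have hanti : AntilipschitzWith (Real.toNNReal c⁻¹) F := by
    refine AntilipschitzWith.of_le_mul_dist fun x y ↦ ?_
    rw [dist_eq_norm, dist_eq_norm, Real.coe_toNNReal _ (by positivity), ← div_eq_inv_mul,
      le_div_iff₀ hc, mul_comm]
    exact mul_norm_sub_le_of_strongly_monotone hF x y
  have hclosed : IsClosed (Set.range F) := by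
    have hp : IsProperMap F := isProperMap_iff_tendsto_cocompact.2 ⟨hs.continuous, by
      simpa only [Metric.cobounded_eq_cocompact] using hanti.tendsto_cobounded⟩
    exact hp.isClosedMap.isClosed_range
  have hclopen : IsClopen (Set.range F) := ⟨hclosed, hopen.isOpen_range⟩
  exact Set.range_eq_univ.1 (hclopen.eq_univ (Set.range_nonempty F))

open scoped Convolution in
/-- The Browder-Minty theorem for strongly monotone continuous maps in finite dimension. -/
theorem surjective_of_strongly_monotone {F : E → E} {c : ℝ} (hc : 0 < c)
    (hF : ∀ x y, c * ‖x - y‖ ^ 2 ≤ inner ℝ (x - y) (F x - F y)) (hcont : Continuous F) :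
    Function.Surjective F := by
  intro y
  borelize E
  let μ : Measure E := Measure.addHaar
  have hr (n : ℕ) : (0 : ℝ) < 1 / (n + 1) := by positivity
  let φ : ℕ → ContDiffBump (0 : E) := fun n ↦
    ⟨1 / (n + 1) / 2, 1 / (n + 1), half_pos (hr n), half_lt_self (hr n)⟩
  -- Mollification averages translates of `F` against a nonnegative kernel of mass one, so it keeps
  -- strong monotonicity with the same `c`.
  let g : ℕ → E → E := fun n ↦ (φ n).normed μ ⋆[ContinuousLinearMap.lsmul ℝ ℝ, μ] F
  have hφ : Tendsto (fun n ↦ (φ n).rOut) atTop (𝓝 0) := tendsto_one_div_add_atTop_nhds_zero_nat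
  have hgs (n : ℕ) : ContDiff ℝ 1 (g n) :=
    (φ n).hasCompactSupport_normed.contDiff_convolution_left _ (φ n).contDiff_normed
      hcont.locallyIntegrable
  have hgi (n : ℕ) (x : E) : Integrable (fun t ↦ (φ n).normed μ t • F (x - t)) μ :=
    ((φ n).hasCompactSupport_normed.convolutionExists_left (ContinuousLinearMap.lsmul ℝ ℝ)
      (φ n).continuous_normed hcont.locallyIntegrable x)
  have hgm (n : ℕ) (x z : E) : c * ‖x - z‖ ^ 2 ≤ inner ℝ (x - z) (g n x - g n z) := by
    have h1 : g n x - g n z = ∫ t, (φ n).normed μ t • (F (x - t) - F (z - t)) ∂μ := by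
      simp only [smul_sub]
      rw [integral_sub (hgi n x) (hgi n z)]
      rfl
    have hint : Integrable (fun t ↦ (φ n).normed μ t • (F (x - t) - F (z - t))) μ := by
      simpa only [smul_sub] using! (hgi n x).sub (hgi n z)
    rw [h1, ← integral_inner hint]
    have h2 : c * ‖x - z‖ ^ 2 = ∫ t, (φ n).normed μ t * (c * ‖x - z‖ ^ 2) ∂μ := by
      rw [integral_mul_const, (φ n).integral_normed, one_mul]
    rw [h2]
    refine integral_mono ((φ n).integrable_normed.mul_const _) (hint.const_inner _) fun t ↦ ?_
    simp only [inner_smul_right]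
    refine mul_le_mul_of_nonneg_left ?_ ((φ n).nonneg_normed t)
    simpa using hF (x - t) (z - t)
  choose x hx using fun n ↦ surjective_of_strongly_monotone_of_contDiff hc (hgm n) (hgs n) y
  have hg0 : Tendsto (fun n ↦ g n 0) atTop (𝓝 (F 0)) :=
    ContDiffBump.convolution_tendsto_right_of_continuous hφ hcont 0
  obtain ⟨R, hR⟩ := (hg0.norm.bddAbove_range)
  -- The solutions of the mollified equations stay in one ball, because `c * ‖x n‖ ≤ ‖y - g n 0‖`
  -- and `g n 0` converges.
  have hbound (n : ℕ) : x n ∈ Metric.closedBall (0 : E) ((‖y‖ + R) / c) := by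
    have h1 := mul_norm_sub_le_of_strongly_monotone (hgm n) (x n) 0
    rw [hx n, sub_zero] at h1
    rw [mem_closedBall_zero_iff, le_div_iff₀ hc, mul_comm]
    refine h1.trans ((norm_sub_le _ _).trans (add_le_add le_rfl (hR ⟨n, rfl⟩)))
  obtain ⟨a, -, ψ, hψ, ha⟩ := (isCompact_closedBall (0 : E) _).tendsto_subseq hbound
  refine ⟨a, ?_⟩
  have hlim : Tendsto (fun n ↦ g (ψ n) (x (ψ n))) atTop (𝓝 (F a)) :=
    ContDiffBump.convolution_tendsto_right (g := fun _ ↦ F) (hφ.comp hψ.tendsto_atTop)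
      (Eventually.of_forall fun _ ↦ hcont.aestronglyMeasurable)
      ((hcont.tendsto a).comp tendsto_snd) ha
  simp only [hx] at hlim
  exact tendsto_nhds_unique hlim tendsto_const_nhds

end StronglyMonotone

/-! ### Contractive Markov kernels and their invariant measures -/

lemma measure_ext_of_forall_lipschitz {X : Type*} [MeasurableSpace X] [MetricSpace X]
    [BorelSpace X] {μ ν : Measure X} [IsProbabilityMeasure μ] [IsProbabilityMeasure ν]
    (h : ∀ f : X → ℝ, (∃ C : ℝ, ∀ x y, dist (f x) (f y) ≤ C) → (∃ L, LipschitzWith L f) →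
      ∫ x, f x ∂μ = ∫ x, f x ∂ν) : μ = ν := by
  let toProb (μ : Measure X) (hμ : IsProbabilityMeasure μ) : ProbabilityMeasure X := ⟨μ, hμ⟩
  -- Bounded Lipschitz functions decide weak convergence, so the constant sequence `μ` converges
  -- weakly to `ν` as well as to `μ`.
  have h1 : Tendsto (fun _ : ℕ ↦ toProb μ ‹_›) atTop (𝓝 (toProb ν ‹_›)) := by
    rw [tendsto_iff_forall_lipschitz_integral_tendsto]
    intro f hf hf'
    have : ∫ x, f x ∂(toProb μ ‹_› : Measure X) = ∫ x, f x ∂(toProb ν ‹_› : Measure X) :=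
      h f hf hf'
    rw [this]
    exact tendsto_const_nhds
  have h2 : toProb μ ‹_› = toProb ν ‹_› := tendsto_nhds_unique tendsto_const_nhds h1
  exact congrArg Subtype.val h2

/-- The Markov operator of `κ`. -/
noncomputable def markovOp {E : Type*} [MeasurableSpace E] (κ : Kernel E E) (f : E → ℝ) :
    E → ℝ := fun x ↦ ∫ y, f y ∂κ x

lemma integral_bind_eq {E : Type*} [MeasurableSpace E] {κ : Kernel E E} {μ : Measure E}
    {f : E → ℝ} (hf : Integrable f (μ.bind κ)) :
    ∫ y, f y ∂(μ.bind κ) = ∫ x, markovOp κ f x ∂μ := by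
  have h := Measure.comp_eq_comp_const_apply (μ := μ) (κ := κ)
  rw [h] at hf ⊢
  rw [Kernel.integral_comp hf]
  simp [markovOp]

section Contraction

variable {E : Type*} [NormedAddCommGroup E]

/-- `f` is Lipschitz with constant `K` for the metric `‖G x - G y‖`. -/
def LipVia (G : E → E) (K : ℝ) (f : E → ℝ) : Prop := ∀ x y, |f x - f y| ≤ K * ‖G x - G y‖

lemma LipVia.continuous {G : E → E} {K : ℝ} {f : E → ℝ} (hf : LipVia G K f)
    (hG : Continuous G) : Continuous f := by
  refine continuous_iff_continuousAt.2 fun x ↦ ?_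
  rw [ContinuousAt, tendsto_iff_dist_tendsto_zero]
  have h1 : Tendsto (fun y ↦ K * ‖G y - G x‖) (𝓝 x) (𝓝 0) := by
    have h2 : Continuous fun y ↦ K * ‖G y - G x‖ := by fun_prop
    simpa using h2.tendsto x
  exact squeeze_zero (fun _ ↦ dist_nonneg) (fun y ↦ hf y x) h1

lemma lipVia_norm_sub (G : E → E) (x : E) : LipVia G 1 (fun y ↦ ‖G y - G x‖) := fun y z ↦ by
  simpa using abs_norm_sub_norm_le (G y - G x) (G z - G x)

lemma lipVia_of_lipschitzWith {G : E → E} (hG : ∀ x y, ‖x - y‖ ≤ ‖G x - G y‖) {f : E → ℝ}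
    {K : ℝ≥0} (hf : LipschitzWith K f) : LipVia G K f := fun x y ↦ by
  have := hf.dist_le_mul x y
  rw [Real.dist_eq, dist_eq_norm] at this
  exact this.trans (mul_le_mul_of_nonneg_left (hG x y) K.2)

variable [MeasurableSpace E]

/-- The Markov kernel `κ` contracts the Wasserstein distance for the metric `‖G x - G y‖` with
factor `r`, in dual form. -/
def IsContractiveVia (G : E → E) (r : ℝ) (κ : Kernel E E) : Prop :=
  ∀ (f : E → ℝ) (K : ℝ), 0 ≤ K → LipVia G K f →
    (∀ x, Integrable f (κ x)) ∧ LipVia G (K * r) (fun x ↦ ∫ y, f y ∂κ x)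

variable {G : E → E} {r : ℝ} {κ : Kernel E E}

lemma IsContractiveVia.iterate (hκ : IsContractiveVia G r κ) (hr : 0 ≤ r) {f : E → ℝ} {K : ℝ}
    (hK : 0 ≤ K) (hf : LipVia G K f) (n : ℕ) : LipVia G (K * r ^ n) ((markovOp κ)^[n] f) := by
  induction n with
  | zero => simpa using hf
  | succ n ih =>
    rw [Function.iterate_succ_apply', pow_succ, ← mul_assoc]
    exact (hκ _ _ (by positivity) ih).2

/-- One more application of `κ` averages the `n`-th iterate over `κ x`. This moves its value by at
most its Lipschitz constant times the mean displacement in one step, so the iterates at `x` are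
geometrically Cauchy. -/
lemma IsContractiveVia.dist_iterate_le [IsMarkovKernel κ] (hκ : IsContractiveVia G r κ)
    (hr : 0 ≤ r) {f : E → ℝ} {K : ℝ} (hK : 0 ≤ K) (hf : LipVia G K f) (x : E) (n : ℕ) :
    dist ((markovOp κ)^[n] f x) ((markovOp κ)^[n + 1] f x) ≤
      K * (∫ y, ‖G y - G x‖ ∂κ x) * r ^ n := by
  have h1 := hκ.iterate hr hK hf n
  have h2 : Integrable ((markovOp κ)^[n] f) (κ x) := (hκ _ _ (by positivity) h1).1 x
  have h3 : Integrable (fun y ↦ ‖G y - G x‖) (κ x) :=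
    (hκ _ 1 zero_le_one (lipVia_norm_sub G x)).1 x
  rw [dist_comm, Real.dist_eq, Function.iterate_succ_apply']
  have h4 : markovOp κ ((markovOp κ)^[n] f) x - (markovOp κ)^[n] f x =
      ∫ y, ((markovOp κ)^[n] f y - (markovOp κ)^[n] f x) ∂κ x := by
    rw [integral_sub h2 (integrable_const _)]
    simp [markovOp]
  rw [h4]
  calc |∫ y, ((markovOp κ)^[n] f y - (markovOp κ)^[n] f x) ∂κ x|
      ≤ ∫ y, |(markovOp κ)^[n] f y - (markovOp κ)^[n] f x| ∂κ x := abs_integral_le_integral_abs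
    _ ≤ ∫ y, K * r ^ n * ‖G y - G x‖ ∂κ x :=
        integral_mono (h2.sub (integrable_const _)).abs (h3.const_mul _) fun y ↦ h1 y x
    _ = K * (∫ y, ‖G y - G x‖ ∂κ x) * r ^ n := by
        rw [integral_const_mul]; ring


variable [BorelSpace E]

lemma LipVia.integrable {G : E → E} {K : ℝ} {f : E → ℝ} (hf : LipVia G K f)
    (hG : Continuous G) {μ : Measure E} [IsFiniteMeasure μ] (x : E)
    (hμ : Integrable (fun y ↦ ‖G y - G x‖) μ) : Integrable f μ := by
  refine ((hμ.const_mul K).add (integrable_const |f x|)).mono'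
    (hf.continuous hG).aestronglyMeasurable (Eventually.of_forall fun y ↦ ?_)
  have h1 := hf y x
  have h2 := abs_sub_abs_le_abs_sub (f y) (f x)
  simp only [Pi.add_apply, Real.norm_eq_abs]
  linarith

lemma IsContractiveVia.integrable_bind (hκ : IsContractiveVia G r κ) (hG : Continuous G)
    {μ : Measure E} [IsProbabilityMeasure μ]
    (hμ : ∀ x, Integrable (fun y ↦ ‖G y - G x‖) μ) {f : E → ℝ} {K : ℝ}
    (hK : 0 ≤ K) (hf : LipVia G K f) : Integrable f (μ.bind κ) := by
  refine (Measure.integrable_comp_iff (hf.continuous hG).aestronglyMeasurable).2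
    ⟨Eventually.of_forall (hκ f K hK hf).1, ?_⟩
  have h1 : LipVia G K (fun y ↦ ‖f y‖) := fun x y ↦ (abs_norm_sub_norm_le _ _).trans (hf x y)
  exact LipVia.integrable (hκ _ _ hK h1).2 hG 0 (hμ 0)

variable [IsMarkovKernel κ]

/-- Each factor `κ` is moved from the law onto the test function. The induction closes because the
Markov operator preserves the class of functions that are Lipschitz through `G`. -/
lemma IsContractiveVia.integral_chain (hκ : IsContractiveVia G r κ) (hG : Continuous G)
    {μ : ℕ → Measure E} (h0 : ∀ x, Integrable (fun y ↦ ‖G y - G x‖) (μ 0))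
    [h0' : IsProbabilityMeasure (μ 0)] (hs : ∀ n, μ (n + 1) = (μ n).bind κ) (n : ℕ) :
    IsProbabilityMeasure (μ n) ∧ ∀ (f : E → ℝ) (K : ℝ), 0 ≤ K → LipVia G K f →
      Integrable f (μ n) ∧ ∫ y, f y ∂μ n = ∫ x, (markovOp κ)^[n] f x ∂(μ 0) := by
  induction n with
  | zero => exact ⟨h0', fun f K hK hf ↦ ⟨hf.integrable hG 0 (h0 0), rfl⟩⟩
  | succ n ih =>
    obtain ⟨ih1, ih2⟩ := ih
    rw [hs n]
    refine ⟨inferInstance, fun f K hK hf ↦ ?_⟩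
    have h1 : Integrable f ((μ n).bind κ) := hκ.integrable_bind hG
      (fun x ↦ (ih2 _ 1 zero_le_one (lipVia_norm_sub G x)).1) hK hf
    refine ⟨h1, ?_⟩
    rw [integral_bind_eq h1, Function.iterate_succ_apply]
    have h2 := (hκ f K hK hf).2
    have h3 : LipVia G (K * |r|) (markovOp κ f) := fun x y ↦ (h2 x y).trans
      (mul_le_mul_of_nonneg_right (mul_le_mul_of_nonneg_left (le_abs_self r) hK) (norm_nonneg _))
    exact (ih2 _ _ (by positivity) h3).2

/-- A contractive Markov kernel has a unique invariant probability measure, and this measure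
has a first moment. -/
theorem IsContractiveVia.exists_invariant [NormedSpace ℝ E] [FiniteDimensional ℝ E]
    (hκ : IsContractiveVia G r κ) (hG : Continuous G)
    (hG1 : ∀ x y, ‖x - y‖ ≤ ‖G x - G y‖) (hr : 0 ≤ r) (hr1 : r < 1) :
    ∃ π : Measure E, IsProbabilityMeasure π ∧ κ.Invariant π ∧
      (∀ π' : Measure E, IsProbabilityMeasure π' → κ.Invariant π' → π' = π) ∧
      ∀ x, Integrable (fun y ↦ ‖G y - G x‖) π := by
  have := FiniteDimensional.complete ℝ E
  have := FiniteDimensional.proper ℝ E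
  -- The laws of the chain started at `0`; integrals against them are iterates of the Markov
  -- operator evaluated at `0`.
  let μ : ℕ → Measure E := fun n ↦ (fun ν ↦ ν.bind κ)^[n] (Measure.dirac 0)
  have hμs (n : ℕ) : μ (n + 1) = (μ n).bind κ := Function.iterate_succ_apply' _ _ _
  have : IsProbabilityMeasure (μ 0) := by
    change IsProbabilityMeasure (Measure.dirac 0)
    infer_instance
  have hchain := hκ.integral_chain hG (μ := μ) (fun x ↦ by
    change Integrable _ (Measure.dirac 0)
    exact integrable_dirac (by finiteness)) hμs
  have hμp (n : ℕ) : IsProbabilityMeasure (μ n) := (hchain n).1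
  have hμi (f : E → ℝ) (K : ℝ) (hK : 0 ≤ K) (hf : LipVia G K f) (n : ℕ) :
      ∫ y, f y ∂μ n = (markovOp κ)^[n] f 0 := by
    rw [((hchain n).2 f K hK hf).2]
    exact integral_dirac _ _
  have hconv (f : E → ℝ) (K : ℝ) (hK : 0 ≤ K) (hf : LipVia G K f) :
      ∃ l, Tendsto (fun n ↦ ∫ y, f y ∂μ n) atTop (𝓝 l) := by
    simp only [hμi f K hK hf]
    exact cauchySeq_tendsto_of_complete
      (cauchySeq_of_le_geometric r _ hr1 (hκ.dist_iterate_le hr hK hf 0))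
  -- The convergence also applies to the unbounded function `‖G y - G 0‖`. Its integrals are
  -- therefore bounded by some `R`, and as this function dominates `‖y‖`, Markov's inequality yields
  -- tightness.
  obtain ⟨l0, hl0⟩ := hconv _ 1 zero_le_one (lipVia_norm_sub G 0)
  obtain ⟨R, hR⟩ := hl0.bddAbove_range
  have hR' (n : ℕ) : ∫ y, ‖G y - G 0‖ ∂μ n ≤ R := hR ⟨n, rfl⟩
  have hint (n : ℕ) : Integrable (fun y ↦ ‖G y - G 0‖) (μ n) :=
    ((hchain n).2 _ 1 zero_le_one (lipVia_norm_sub G 0)).1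
  have htight : IsTightMeasureSet (Set.range μ) := by
    refine isTightMeasureSet_of_tendsto_measure_norm_gt ?_
    have hlim : Tendsto (fun x : ℝ ↦ ENNReal.ofReal (R / x)) atTop (𝓝 0) := by
      simpa using ENNReal.tendsto_ofReal (tendsto_const_nhds.div_atTop tendsto_id (a := R))
    refine tendsto_of_tendsto_of_tendsto_of_le_of_le' tendsto_const_nhds hlim
      (Eventually.of_forall fun _ ↦ zero_le) ?_
    filter_upwards [eventually_gt_atTop 0] with x hx
    simp only [iSup_range]
    refine iSup_le fun n ↦ ?_
    have h1 : (μ n).real {y | x ≤ ‖G y - G 0‖} ≤ R / x := by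
      rw [le_div_iff₀ hx, mul_comm]
      exact (mul_meas_ge_le_integral_of_nonneg (Eventually.of_forall fun _ ↦ norm_nonneg _)
        (hint n) x).trans (hR' n)
    have h2 : μ n {y | x < ‖y‖} ≤ μ n {y | x ≤ ‖G y - G 0‖} := by
      refine measure_mono fun y (hy : x < ‖y‖) ↦ ?_
      have := hG1 y 0
      rw [sub_zero] at this
      exact hy.le.trans this
    refine h2.trans ?_
    rw [← ofReal_measureReal]
    exact ENNReal.ofReal_le_ofReal h1
  let μ' : ℕ → ProbabilityMeasure E := fun n ↦ ⟨μ n, hμp n⟩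
  have hcomp : IsCompact (closure (Set.range μ')) := by
    refine isCompact_closure_of_isTightMeasureSet (htight.subset ?_)
    rintro _ ⟨_, ⟨n, rfl⟩, rfl⟩
    exact ⟨n, rfl⟩
  -- Prokhorov gives only a cluster point. It is enough: the integrals of functions Lipschitz
  -- through `G` already converge along the whole sequence, so for bounded ones the limit is the
  -- integral against `p`.
  obtain ⟨p, -, hp⟩ := hcomp.exists_mapClusterPt (u := μ') (f := atTop)
    (tendsto_principal.2 (Eventually.of_forall fun n ↦ subset_closure (Set.mem_range_self n)))
  obtain ⟨U, hU, hUp⟩ := mapClusterPt_iff_ultrafilter.1 hp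
  rw [ProbabilityMeasure.tendsto_iff_forall_integral_tendsto] at hUp
  let π : Measure E := p
  have hπp : IsProbabilityMeasure π := p.2
  have hlim (f : E → ℝ) (K : ℝ) (hK : 0 ≤ K) (hf : LipVia G K f) (C : ℝ) (hC : ∀ x, ‖f x‖ ≤ C) :
      Tendsto (fun n ↦ ∫ y, f y ∂μ n) atTop (𝓝 (∫ y, f y ∂π)) := by
    obtain ⟨l, hl⟩ := hconv f K hK hf
    have h1 := hUp (BoundedContinuousFunction.ofNormedAddCommGroup f (hf.continuous hG) C hC)
    have h2 : l = ∫ y, f y ∂π := tendsto_nhds_unique (hl.mono_left hU) h1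
    rwa [h2] at hl
  have hTb (f : E → ℝ) (C : ℝ) (hC : ∀ x, ‖f x‖ ≤ C) (x : E) : ‖markovOp κ f x‖ ≤ C := by
    have := norm_integral_le_of_norm_le_const (μ := κ x) (Eventually.of_forall hC)
    rwa [probReal_univ, mul_one] at this
  have hTb' (f : E → ℝ) (C : ℝ) (hC : ∀ x, ‖f x‖ ≤ C) (n : ℕ) :
      ∀ x, ‖(markovOp κ)^[n] f x‖ ≤ C := by
    induction n with
    | zero => exact hC
    | succ n ih => rw [Function.iterate_succ_apply']; exact hTb _ _ ih
  have hinv : κ.Invariant π := by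
    refine measure_ext_of_forall_lipschitz fun f ⟨C, hC⟩ ⟨K, hK⟩ ↦ ?_
    have hf := lipVia_of_lipschitzWith hG1 hK
    have hfb (x : E) : ‖f x‖ ≤ |f 0| + C := by
      have h1 := hC x 0
      rw [Real.dist_eq] at h1
      have h2 := abs_sub_abs_le_abs_sub (f x) (f 0)
      rw [Real.norm_eq_abs]; linarith
    have hfi : Integrable f (π.bind κ) := Integrable.of_bound
      (hf.continuous hG).aestronglyMeasurable _ (Eventually.of_forall hfb)
    rw [integral_bind_eq hfi]
    have h1 := hlim _ (K * r) (by positivity) (hκ _ _ K.2 hf).2 _ (hTb f _ hfb)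
    -- The integral of `f` against `μ (n + 1)` is that of `markovOp κ f` against `μ n`; the shifted
    -- sequence has the same limit.
    have h2 := (hlim f K K.2 hf _ hfb).comp (tendsto_add_atTop_nat 1)
    refine tendsto_nhds_unique h1 (h2.congr fun n ↦ ?_)
    change ∫ y, f y ∂μ (n + 1) = _
    rw [hμi f K K.2 hf, hμi _ (K * r) (by positivity) (hκ _ _ K.2 hf).2]
    rfl
  have hunique (π' : Measure E) (hπ' : IsProbabilityMeasure π') (hinv' : κ.Invariant π') :
      π' = π := by
    refine measure_ext_of_forall_lipschitz fun f ⟨C, hC⟩ ⟨K, hK⟩ ↦ ?_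
    have hf := lipVia_of_lipschitzWith hG1 hK
    have hfb (x : E) : ‖f x‖ ≤ |f 0| + C := by
      have h1 := hC x 0
      rw [Real.dist_eq] at h1
      have h2 := abs_sub_abs_le_abs_sub (f x) (f 0)
      rw [Real.norm_eq_abs]; linarith
    have hfc (n : ℕ) : Continuous ((markovOp κ)^[n] f) := (hκ.iterate hr K.2 hf n).continuous hG
    have h1 (n : ℕ) : ∫ y, f y ∂π' = ∫ y, (markovOp κ)^[n] f y ∂π' := by
      induction n with
      | zero => rfl
      | succ n ih =>
        rw [ih, Function.iterate_succ_apply', ← integral_bind_eq, hinv'.def]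
        exact Integrable.of_bound (hfc n).aestronglyMeasurable _
          (Eventually.of_forall (hTb' f _ hfb n))
    -- The iterates of `f` converge to the constant `∫ f dπ` at every point: they do at `0`, and
    -- contraction removes the difference between `y` and `0`. Integrating against an invariant `π'`
    -- identifies it.
    have h2 : Tendsto (fun n ↦ ∫ y, (markovOp κ)^[n] f y ∂π') atTop
        (𝓝 (∫ _, (∫ z, f z ∂π) ∂π')) := by
      refine tendsto_integral_of_dominated_convergence (fun _ ↦ |f 0| + C)
        (fun n ↦ (hfc n).aestronglyMeasurable) (integrable_const _)
        (fun n ↦ Eventually.of_forall (hTb' f _ hfb n)) (Eventually.of_forall fun y ↦ ?_)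
      have h3 := hlim f K K.2 hf _ hfb
      simp only [hμi f K K.2 hf] at h3
      have h4 : Tendsto (fun n ↦ K * r ^ n * ‖G y - G 0‖) atTop (𝓝 0) := by
        simpa using ((tendsto_pow_atTop_nhds_zero_of_lt_one hr hr1).const_mul (K : ℝ)).mul_const
          ‖G y - G 0‖
      have h5 : Tendsto (fun n ↦ (markovOp κ)^[n] f y - (markovOp κ)^[n] f 0) atTop (𝓝 0) :=
        squeeze_zero_norm (fun n ↦ (hκ.iterate hr K.2 hf n) y 0) h4
      simpa using h5.add h3
    simp only [← h1, integral_const, probReal_univ, one_smul] at h2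
    exact tendsto_nhds_unique tendsto_const_nhds h2
  refine ⟨π, hπp, hinv, hunique, ?_⟩
  have hmom : Integrable (fun y ↦ ‖G y - G 0‖) π := by
    have hm : Continuous fun y ↦ ‖G y - G 0‖ := by fun_prop
    -- Truncation at level `n` keeps the Lipschitz bound and makes the function bounded, so the
    -- moment bound `R` passes to `π`; letting `n` grow is Fatou's lemma.
    have hmin (n : ℕ) : LipVia G 1 (fun y ↦ min ‖G y - G 0‖ n) := fun y z ↦
      (abs_min_sub_min_le_max _ _ _ _).trans (by simpa using lipVia_norm_sub G 0 y z)
    have hb (n : ℕ) (y : E) : ‖min ‖G y - G 0‖ (n : ℝ)‖ ≤ n := by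
      rw [Real.norm_of_nonneg (by positivity)]; exact min_le_right _ _
    have hbound (n : ℕ) : ∫ y, min ‖G y - G 0‖ (n : ℝ) ∂π ≤ R := by
      refine le_of_tendsto' (hlim _ 1 zero_le_one (hmin n) n (hb n)) fun k ↦ ?_
      refine le_trans (integral_mono ((hchain k).2 _ 1 zero_le_one (hmin n)).1 (hint k)
        fun y ↦ min_le_left _ _) (hR' k)
    have hle := Lp.eLpNorm_le_of_ae_tendsto (u := atTop) (p := 1) (μ := π)
      (f := fun (n : ℕ) y ↦ min ‖G y - G 0‖ n) (g := fun y ↦ ‖G y - G 0‖) (C := ENNReal.ofReal R)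
      (Eventually.of_forall fun n ↦ ?_) (fun n ↦ ((hmin n).continuous hG).aestronglyMeasurable)
      (Eventually.of_forall fun y ↦ ?_)
    · exact memLp_one_iff_integrable.1
        ⟨hm.aestronglyMeasurable, hle.trans_lt ENNReal.ofReal_lt_top⟩
    · rw [eLpNorm_one_eq_lintegral_enorm, ← ofReal_integral_norm_eq_lintegral_enorm
        (Integrable.of_bound ((hmin n).continuous hG).aestronglyMeasurable n
          (Eventually.of_forall (hb n)))]
      refine ENNReal.ofReal_le_ofReal (le_trans (le_of_eq ?_) (hbound n))
      exact integral_congr_ae (Eventually.of_forall fun y ↦ Real.norm_of_nonneg (by positivity))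
    · refine tendsto_const_nhds.congr' ?_
      filter_upwards [eventually_ge_atTop ⌈‖G y - G 0‖⌉₊] with n hn
      exact (min_eq_left (Nat.ceil_le.1 hn)).symm
  exact fun x ↦ (lipVia_norm_sub G x).integrable hG 0 hmom

/-- Geometric convergence to the invariant measure of a contractive Markov kernel. -/
theorem IsContractiveVia.abs_iterate_sub_integral_le
    (hκ : IsContractiveVia G r κ) (hG : Continuous G) (hr : 0 ≤ r) {π : Measure E}
    [IsProbabilityMeasure π] (hinv : κ.Invariant π)
    (hπ : ∀ x, Integrable (fun y ↦ ‖G y - G x‖) π) {f : E → ℝ} {K : ℝ}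
    (hK : 0 ≤ K) (hf : LipVia G K f) (x : E) (n : ℕ) :
    |(markovOp κ)^[n] f x - ∫ y, f y ∂π| ≤ K * r ^ n * ∫ y, ‖G y - G x‖ ∂π := by
  -- By invariance the constant sequence `π` is itself a chain, so `f` and its `n`-th iterate have
  -- the same `π`-integral.
  have h1 := ((hκ.integral_chain hG (μ := fun _ ↦ π) hπ (fun _ ↦ hinv.symm) n).2 f K hK hf).2
  have hi : Integrable ((markovOp κ)^[n] f) π := (hκ.iterate hr hK hf n).integrable hG x (hπ x)
  have h2 : (markovOp κ)^[n] f x - ∫ y, f y ∂π =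
      ∫ y, ((markovOp κ)^[n] f x - (markovOp κ)^[n] f y) ∂π := by
    rw [integral_sub (integrable_const _) hi, h1]
    simp
  rw [h2, ← integral_const_mul]
  refine abs_integral_le_integral_abs.trans (integral_mono ((integrable_const _).sub hi).abs
    ((hπ x).const_mul _) fun y ↦ ?_)
  have := hκ.iterate hr hK hf n x y
  rwa [norm_sub_rev] at this

end Contraction

/-! ### Moments of Poisson variables -/

section PoissonMoments

open scoped Nat in
-- The term at `0` vanishes and `n * r ^ n / n!` equals `r` times the preceding weight, so an index
-- shift reduces the sum to the total mass.
lemma hasSum_poisson_mul_id (r : ℝ≥0) :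
    HasSum (fun n : ℕ ↦ Real.exp (-r) * r ^ n / n ! * (n : ℝ)) r := by
  rw [← hasSum_nat_add_iff' 1]
  have h := (hasSum_one_poissonMeasure r).mul_left (r : ℝ)
  simp only [Finset.range_one, Finset.sum_singleton, Nat.cast_zero, mul_zero, sub_zero]
  rw [mul_one] at h
  refine h.congr_fun fun n ↦ ?_
  rw [Nat.factorial_succ]
  push_cast
  have : ((n ! : ℕ) : ℝ) ≠ 0 := by positivity
  field_simp
  ring

open scoped Nat in
lemma hasSum_poisson_mul_sq (r : ℝ≥0) :
    HasSum (fun n : ℕ ↦ Real.exp (-r) * r ^ n / n ! * (n : ℝ) ^ 2) (r ^ 2 + r) := by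
  rw [← hasSum_nat_add_iff' 1]
  have h := ((hasSum_poisson_mul_id r).add (hasSum_one_poissonMeasure r)).mul_left (r : ℝ)
  simp only [Finset.range_one, Finset.sum_singleton, Nat.cast_zero]
  have h2 : (r : ℝ) * (r + 1) = r ^ 2 + r - Real.exp (-r) * r ^ 0 / 0 ! * 0 ^ 2 := by ring
  rw [h2] at h
  refine h.congr_fun fun n ↦ ?_
  rw [Nat.factorial_succ]
  push_cast
  have : ((n ! : ℕ) : ℝ) ≠ 0 := by positivity
  field_simp
  ring

lemma integrable_sq_poissonMeasure (r : ℝ≥0) :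
    Integrable (fun n : ℕ ↦ (n : ℝ) ^ 2) (poissonMeasure r) := by
  rw [integrable_poissonMeasure_iff]
  simpa using (hasSum_poisson_mul_sq r).summable

lemma memLp_natCast_poissonMeasure (r : ℝ≥0) :
    MemLp (fun n : ℕ ↦ (n : ℝ)) 2 (poissonMeasure r) :=
  (memLp_two_iff_integrable_sq Measurable.of_discrete.aestronglyMeasurable).2
    (integrable_sq_poissonMeasure r)

lemma integral_natCast_poissonMeasure (r : ℝ≥0) :
    ∫ n : ℕ, (n : ℝ) ∂poissonMeasure r = r := by
  rw [integral_poissonMeasure]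
  exact (hasSum_poisson_mul_id r).tsum_eq

lemma integral_sub_sq_poissonMeasure (r : ℝ≥0) :
    ∫ n : ℕ, ((n : ℝ) - r) ^ 2 ∂poissonMeasure r = r := by
  rw [integral_poissonMeasure]
  have h := ((hasSum_poisson_mul_sq r).sub ((hasSum_poisson_mul_id r).mul_left (2 * r : ℝ))).add
    ((hasSum_one_poissonMeasure r).mul_left ((r : ℝ) ^ 2))
  have h2 : (r : ℝ) ^ 2 + r - 2 * r * r + r ^ 2 * 1 = r := by ring
  rw [h2] at h
  refine (h.congr_fun fun n ↦ ?_).tsum_eq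
  simp only [smul_eq_mul]
  ring

variable {Ω : Type*} [MeasurableSpace Ω] {P : Measure Ω} {Y : Ω → ℝ≥0∞} {r : ℝ≥0}

lemma ae_lt_top_of_hasLaw_poisson
    (h : HasLaw Y ((poissonMeasure r).map (fun k : ℕ ↦ (k : ℝ≥0∞))) P) :
    ∀ᵐ ω ∂P, Y ω < ∞ := by
  have h1 : ∀ᵐ y ∂(P.map Y), y < ∞ := by
    rw [h.map_eq, ae_map_iff Measurable.of_discrete.aemeasurable measurableSet_Iio]
    exact Eventually.of_forall fun n ↦ ENNReal.natCast_lt_top n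
  exact ae_of_ae_map h.aemeasurable h1

lemma map_toReal_of_hasLaw_poisson
    (h : HasLaw Y ((poissonMeasure r).map (fun k : ℕ ↦ (k : ℝ≥0∞))) P) :
    P.map (fun ω ↦ (Y ω).toReal) = (poissonMeasure r).map (fun k : ℕ ↦ (k : ℝ)) := by
  have h1 : P.map (fun ω ↦ (Y ω).toReal) = (P.map Y).map ENNReal.toReal :=
    (AEMeasurable.map_map_of_aemeasurable ENNReal.measurable_toReal.aemeasurable
      h.aemeasurable).symm
  rw [h1, h.map_eq, Measure.map_map ENNReal.measurable_toReal Measurable.of_discrete]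
  rfl

lemma memLp_toReal_of_hasLaw_poisson
    (h : HasLaw Y ((poissonMeasure r).map (fun k : ℕ ↦ (k : ℝ≥0∞))) P) :
    MemLp (fun ω ↦ (Y ω).toReal) 2 P := by
  have h1 : MemLp id 2 (P.map (fun ω ↦ (Y ω).toReal)) := by
    rw [map_toReal_of_hasLaw_poisson h,
      memLp_map_measure_iff aestronglyMeasurable_id Measurable.of_discrete.aemeasurable]
    exact memLp_natCast_poissonMeasure r
  exact (memLp_map_measure_iff aestronglyMeasurable_id h.aemeasurable.ennreal_toReal).1 h1

lemma integral_toReal_of_hasLaw_poisson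
    (h : HasLaw Y ((poissonMeasure r).map (fun k : ℕ ↦ (k : ℝ≥0∞))) P) :
    ∫ ω, (Y ω).toReal ∂P = r := by
  have h1 := integral_map (f := id) h.aemeasurable.ennreal_toReal aestronglyMeasurable_id
  simp only [id] at h1
  rw [← h1, map_toReal_of_hasLaw_poisson h,
    integral_map (f := fun y : ℝ ↦ y) Measurable.of_discrete.aemeasurable aestronglyMeasurable_id]
  exact integral_natCast_poissonMeasure r

lemma integral_toReal_sub_sq_of_hasLaw_poisson
    (h : HasLaw Y ((poissonMeasure r).map (fun k : ℕ ↦ (k : ℝ≥0∞))) P) :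
    ∫ ω, ((Y ω).toReal - r) ^ 2 ∂P = r := by
  have hm : Measurable fun y : ℝ ↦ (y - r) ^ 2 := by fun_prop
  have h1 := integral_map (f := fun y : ℝ ↦ (y - r) ^ 2) h.aemeasurable.ennreal_toReal
    hm.aestronglyMeasurable
  rw [← h1, map_toReal_of_hasLaw_poisson h,
    integral_map Measurable.of_discrete.aemeasurable hm.aestronglyMeasurable]
  exact integral_sub_sq_poissonMeasure r

lemma lintegral_of_hasLaw_poisson
    (h : HasLaw Y ((poissonMeasure r).map (fun k : ℕ ↦ (k : ℝ≥0∞))) P) [IsFiniteMeasure P] :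
    ∫⁻ ω, Y ω ∂P = r := by
  have h1 := ofReal_integral_eq_lintegral_ofReal
    ((memLp_toReal_of_hasLaw_poisson h).integrable one_le_two)
    (Eventually.of_forall fun _ ↦ ENNReal.toReal_nonneg)
  rw [integral_toReal_of_hasLaw_poisson h, ENNReal.ofReal_coe_nnreal] at h1
  rw [h1]
  refine lintegral_congr_ae ?_
  filter_upwards [ae_lt_top_of_hasLaw_poisson h] with ω hω
  exact (ENNReal.ofReal_toReal hω.ne).symm

end PoissonMoments

/-! ### Restriction of a measure to a set as an s-finite kernel -/

section FiniteRestrict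

variable {X : Type*} [MeasurableSpace X]

lemma measurable_measure_restrict {B : Set X} (hB : MeasurableSet B) :
    Measurable fun n : Measure X ↦ n.restrict B := by
  refine Measure.measurable_of_measurable_coe _ fun A hA ↦ ?_
  simp only [Measure.restrict_apply hA]
  exact Measure.measurable_coe (hA.inter hB)

/-- The kernel which restricts a measure `n` to `B` if `n B < ∞`, and is zero otherwise. -/
noncomputable def finiteRestrict {B : Set X} (hB : MeasurableSet B) : Kernel (Measure X) X :=
  Kernel.piecewise (s := {n | n B < ∞}) (measurableSet_lt (Measure.measurable_coe hB)
    measurable_const) ⟨fun n ↦ n.restrict B, measurable_measure_restrict hB⟩ 0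

lemma finiteRestrict_apply {B : Set X} (hB : MeasurableSet B) {n : Measure X} (hn : n B < ∞) :
    finiteRestrict hB n = n.restrict B := by
  rw [finiteRestrict, Kernel.piecewise_apply, if_pos (by exact hn)]
  rfl

lemma finiteRestrict_congr {B : Set X} (hB : MeasurableSet B) {n n' : Measure X}
    (h : n.restrict B = n'.restrict B) : finiteRestrict hB n = finiteRestrict hB n' := by
  have h1 : n B = n' B := by
    rw [← Measure.restrict_apply_self, h, Measure.restrict_apply_self]
  simp only [finiteRestrict, Kernel.piecewise_apply]
  change (if n B < ∞ then n.restrict B else 0) = (if n' B < ∞ then n'.restrict B else 0)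
  rw [h1, h]

/-- Slice by the integer part of `n B`: each slice is a finite kernel, and for a given `n` with `n B
< ∞` exactly one slice contributes. S-finiteness makes integrals against the restricted measure
measurable in the measure. -/
instance {B : Set X} (hB : MeasurableSet B) : IsSFiniteKernel (finiteRestrict hB) := by
  let s : ℕ → Set (Measure X) := fun k ↦ {n | (k : ℝ≥0∞) ≤ n B ∧ n B < k + 1}
  have hs (k : ℕ) : MeasurableSet (s k) :=
    (measurableSet_le measurable_const (Measure.measurable_coe hB)).inter
      (measurableSet_lt (Measure.measurable_coe hB) measurable_const)
  let κ : ℕ → Kernel (Measure X) X := fun k ↦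
    Kernel.piecewise (hs k) ⟨fun n ↦ n.restrict B, measurable_measure_restrict hB⟩ 0
  have hκ (k : ℕ) (n : Measure X) : κ k n = if n ∈ s k then n.restrict B else 0 := by
    simp only [κ, Kernel.piecewise_apply]
    rfl
  refine ⟨κ, fun k ↦ ⟨⟨k + 1, by finiteness, fun n ↦ ?_⟩⟩, ?_⟩
  · rw [hκ]
    split_ifs with h
    · rw [Measure.restrict_apply_univ]
      exact h.2.le
    · simp
  · ext n A hA
    rw [Kernel.sum_apply' _ _ hA]
    by_cases hn : n B < ∞
    · rw [finiteRestrict_apply hB hn, tsum_eq_single ⌊(n B).toReal⌋₊]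
      · rw [hκ, if_pos]
        have h1 := Nat.floor_le (ENNReal.toReal_nonneg (a := n B))
        have h2 := Nat.lt_floor_add_one (n B).toReal
        constructor
        · rw [← ENNReal.ofReal_toReal hn.ne, ← ENNReal.ofReal_natCast]
          exact ENNReal.ofReal_le_ofReal (by simpa using h1)
        · have h3 : ((⌊(n B).toReal⌋₊ : ℕ) : ℝ≥0∞) + 1 =
              ENNReal.ofReal ((⌊(n B).toReal⌋₊ : ℝ) + 1) := by
            rw [ENNReal.ofReal_add (by positivity) zero_le_one]; simp
          rw [h3]
          exact (ENNReal.lt_ofReal_iff_toReal_lt hn.ne).2 h2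
      · intro k hk
        rw [hκ, if_neg]
        · simp
        rintro ⟨h1, h2⟩
        apply hk
        refine ((Nat.floor_eq_iff ENNReal.toReal_nonneg).2 ⟨?_, ?_⟩).symm
        · simpa using ENNReal.toReal_mono hn.ne h1
        · have := (ENNReal.toReal_lt_toReal hn.ne (by finiteness)).2 h2
          rwa [ENNReal.toReal_add (by simp) (by simp), ENNReal.toReal_natCast,
            ENNReal.toReal_one] at this
    · have h0 (k : ℕ) : κ k n A = 0 := by
        rw [hκ, if_neg]
        · simp
        rintro ⟨h1, h2⟩
        exact hn (h2.trans (by finiteness))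
      simp only [h0, tsum_zero]
      rw [finiteRestrict, Kernel.piecewise_apply, if_neg (by exact hn)]
      simp

end FiniteRestrict

/-- Convergence in measure implies convergence in distribution, and limit laws are unique. This
carries equality of laws from approximations to jump integrals. -/
lemma map_eq_of_tendstoInMeasure {Ω E : Type*} [MeasurableSpace Ω] {P : Measure Ω}
    [IsProbabilityMeasure P] [MetricSpace E] [MeasurableSpace E] [BorelSpace E]
    {X X' : ℕ → Ω → E} {Z Z' : Ω → E} (hX : ∀ k, AEMeasurable (X k) P)
    (hX' : ∀ k, AEMeasurable (X' k) P) (h : ∀ k, P.map (X k) = P.map (X' k))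
    (hZ : TendstoInMeasure P X atTop Z) (hZ' : TendstoInMeasure P X' atTop Z') :
    P.map Z = P.map Z' := by
  have h1 := hZ.tendstoInDistribution hX
  have h2 := hZ'.tendstoInDistribution hX'
  refine tendstoInDistribution_unique X h1 ⟨hX, h2.aemeasurable_limit, ?_⟩
  refine h2.tendsto.congr fun k ↦ ?_
  exact Subtype.ext (h k).symm

/-- The squared norm of a linear combination of orthogonal random variables. -/
lemma integral_norm_sum_smul_sq {Ω E : Type*} [MeasurableSpace Ω] {P : Measure Ω}
    [NormedAddCommGroup E] [InnerProductSpace ℝ E] (s : Finset E) {X : E → Ω → ℝ}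
    (hX : ∀ c ∈ s, MemLp (X c) 2 P)
    (horth : ∀ c ∈ s, ∀ c' ∈ s, c ≠ c' → ∫ ω, X c ω * X c' ω ∂P = 0) :
    ∫ ω, ‖∑ c ∈ s, X c ω • c‖ ^ 2 ∂P = ∑ c ∈ s, (∫ ω, X c ω ^ 2 ∂P) * ‖c‖ ^ 2 := by
  have h1 (ω : Ω) : ‖∑ c ∈ s, X c ω • c‖ ^ 2 =
      ∑ c ∈ s, ∑ c' ∈ s, X c ω * X c' ω * inner ℝ c c' := by
    rw [← real_inner_self_eq_norm_sq, sum_inner]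
    refine Finset.sum_congr rfl fun c _ ↦ ?_
    rw [inner_sum]
    refine Finset.sum_congr rfl fun c' _ ↦ ?_
    rw [real_inner_smul_left, real_inner_smul_right]
    ring
  have hint (c : E) (hc : c ∈ s) (c' : E) (hc' : c' ∈ s) :
      Integrable (fun ω ↦ X c ω * X c' ω * inner ℝ c c') P :=
    ((hX c hc).integrable_mul (hX c' hc')).mul_const _
  simp only [h1]
  rw [integral_finsetSum _ fun c hc ↦ integrable_finsetSum _ fun c' hc' ↦ hint c hc c' hc']
  refine Finset.sum_congr rfl fun c hc ↦ ?_
  rw [integral_finsetSum _ fun c' hc' ↦ hint c hc c' hc', Finset.sum_eq_single_of_mem c hc]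
  · rw [integral_mul_const, real_inner_self_eq_norm_sq]
    simp only [sq]
  · intro c' hc' hne
    rw [integral_mul_const, horth c hc c' hc' hne.symm, zero_mul]

/-! ### Mean values of integrals against a Poisson random measure -/

section PoissonRandomMeasure

variable {X : Type*} [MeasurableSpace X] {Λ : Measure X} {B : Set X}
  {Ω : Type*} [MeasurableSpace Ω] {P : Measure Ω} {N : Ω → Measure X}

namespace IsPoissonRandomMeasure

lemma ae_lt_top (hN : IsPoissonRandomMeasure P N Λ) (hB : MeasurableSet B) (hΛB : Λ B ≠ ∞) :
    ∀ᵐ ω ∂P, N ω B < ∞ := ae_lt_top_of_hasLaw_poisson (hN.hasLaw B hB hΛB)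

lemma iIndepFun_of_fintype (hN : IsPoissonRandomMeasure P N Λ) {ι : Type*} [Fintype ι]
    (A : ι → Set X) (hA : ∀ i, MeasurableSet (A i))
    (hd : Pairwise (fun i j ↦ Disjoint (A i) (A j))) : iIndepFun (fun i ω ↦ N ω (A i)) P := by
  let e := Fintype.equivFin ι
  have h := hN.indep (Fintype.card ι) (fun k ↦ A (e.symm k)) (fun k ↦ hA _)
    (fun i j hij ↦ hd (e.symm.injective.ne hij))
  simpa using! h.precomp e.injective

/-- Campbell's formula: averaging the restriction of `N` to `B` gives the restriction of `Λ`, as a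
Poisson variable has its parameter as mean. -/
lemma lintegral_setLIntegral [IsFiniteMeasure P] (hN : IsPoissonRandomMeasure P N Λ)
    (hB : MeasurableSet B) (hΛB : Λ B ≠ ∞) {f : X → ℝ≥0∞} (hf : Measurable f) :
    ∫⁻ ω, ∫⁻ x in B, f x ∂(N ω) ∂P = ∫⁻ x in B, f x ∂Λ := by
  have h1 : P.bind (fun ω ↦ (N ω).restrict B) = Λ.restrict B := by
    ext A hA
    have hm : Measurable fun ω ↦ (N ω).restrict B :=
      (measurable_measure_restrict hB).comp hN.measurable
    rw [Measure.bind_apply hA hm.aemeasurable, Measure.restrict_apply hA]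
    simp only [Measure.restrict_apply hA]
    have hfin : Λ (A ∩ B) ≠ ∞ := measure_ne_top_of_subset Set.inter_subset_right hΛB
    rw [lintegral_of_hasLaw_poisson (hN.hasLaw _ (hA.inter hB) hfin), ENNReal.coe_toNNReal hfin]
  have hm : Measurable fun ω ↦ (N ω).restrict B :=
    (measurable_measure_restrict hB).comp hN.measurable
  rw [← h1, Measure.lintegral_bind hm.aemeasurable hf.aemeasurable]

lemma ae_integrableOn [IsFiniteMeasure P] (hN : IsPoissonRandomMeasure P N Λ)
    (hB : MeasurableSet B) (hΛB : Λ B ≠ ∞)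
    {E : Type*} [NormedAddCommGroup E] [SecondCountableTopology E] [MeasurableSpace E]
    [BorelSpace E] {f : X → E} (hf : Measurable f) (hfi : IntegrableOn f B Λ) :
    ∀ᵐ ω ∂P, IntegrableOn f B (N ω) := by
  have h1 := hN.lintegral_setLIntegral hB hΛB hf.enorm
  have hm : Measurable fun ω ↦ ∫⁻ x in B, ‖f x‖ₑ ∂(N ω) :=
    (Measure.measurable_lintegral hf.enorm).comp
      ((measurable_measure_restrict hB).comp hN.measurable)
  have h2 := MeasureTheory.ae_lt_top hm (by rw [h1]; exact hfi.2.ne)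
  filter_upwards [h2] with ω hω
  exact ⟨hf.aestronglyMeasurable, hω⟩

end IsPoissonRandomMeasure

end PoissonRandomMeasure

/-! ### Compensated integrals over sets of finite intensity -/

section Compensated

variable {X : Type*} [MeasurableSpace X] {Λ : Measure X} {B : Set X}
  {E : Type*} [NormedAddCommGroup E]

/-- The integral of `f` over `B` against the compensated measure `n - Λ`; it is set to
`-∫ x in B, f x ∂Λ` when `n B = ∞`. -/
noncomputable def compensated [NormedSpace ℝ E] (Λ : Measure X) (hB : MeasurableSet B) (f : X → E)
    (n : Measure X) : E :=
  ∫ x, f x ∂(finiteRestrict hB n) - ∫ x in B, f x ∂Λ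

lemma compensated_of_lt_top [NormedSpace ℝ E] (hB : MeasurableSet B) (f : X → E) {n : Measure X}
    (hn : n B < ∞) : compensated Λ hB f n = ∫ x in B, f x ∂n - ∫ x in B, f x ∂Λ := by
  rw [compensated, finiteRestrict_apply hB hn]

lemma compensated_congr [NormedSpace ℝ E] (hB : MeasurableSet B) (f : X → E) {n n' : Measure X}
    (h : n.restrict B = n'.restrict B) : compensated Λ hB f n = compensated Λ hB f n' := by
  rw [compensated, compensated, finiteRestrict_congr hB h]

variable [NormedSpace ℝ E] [SecondCountableTopology E] [MeasurableSpace E] [BorelSpace E]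

/-- The random measure is the parameter of the s-finite kernel `finiteRestrict`, hence joint
measurability. It is what later permits a random `y`. -/
lemma measurable_compensated_uncurry [SFinite Λ] {Y : Type*} [MeasurableSpace Y]
    (hB : MeasurableSet B)
    {f : Y → X → E} (hf : Measurable (Function.uncurry f)) :
    Measurable fun p : Y × Measure X ↦ compensated Λ hB (f p.1) p.2 := by
  have h1 : StronglyMeasurable fun p : (Y × Measure X) × X ↦ f p.1.1 p.2 := by
    have : Measurable fun p : (Y × Measure X) × X ↦ f p.1.1 p.2 := by
      exact hf.comp (measurable_fst.fst.prodMk measurable_snd)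
    exact this.stronglyMeasurable
  let κ : Kernel (Y × Measure X) X := (finiteRestrict hB).comap Prod.snd measurable_snd
  have h2 := (StronglyMeasurable.integral_kernel_prod_right' (κ := κ) h1).measurable
  have h3 : Measurable fun y ↦ ∫ x in B, f y x ∂Λ :=
    (hf.stronglyMeasurable.integral_prod_right' (ν := Λ.restrict B)).measurable
  exact h2.sub (h3.comp measurable_fst)

lemma measurable_compensated (hB : MeasurableSet B) {f : X → E} (hf : Measurable f) :
    Measurable (compensated Λ hB f) := by
  have h1 : StronglyMeasurable fun p : Measure X × X ↦ f p.2 :=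
    (hf.comp measurable_snd).stronglyMeasurable
  exact ((StronglyMeasurable.integral_kernel_prod_right' (κ := finiteRestrict hB)
    h1).measurable).sub_const _

end Compensated

section Fibers

variable {X : Type*} [MeasurableSpace X] {Λ : Measure X} {B : Set X}

lemma IsPoissonRandomMeasure.ae_compensated_eq {Ω E : Type*} [MeasurableSpace Ω] {P : Measure Ω}
    {N : Ω → Measure X} [NormedAddCommGroup E] [NormedSpace ℝ E]
    (hN : IsPoissonRandomMeasure P N Λ) (hB : MeasurableSet B)
    (hΛB : Λ B ≠ ∞) (f : X → E) : ∀ᵐ ω ∂P, compensated Λ hB f (N ω) =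
      ∫ x in B, f x ∂(N ω) - ∫ x in B, f x ∂Λ := by
  filter_upwards [hN.ae_lt_top hB hΛB] with ω hω using compensated_of_lt_top hB f hω

lemma setIntegral_simpleFunc_comp {E : Type*} [NormedAddCommGroup E] [NormedSpace ℝ E]
    [CompleteSpace E] [MeasurableSpace E] {n : Measure X} (hn : n B ≠ ∞)
    (h : SimpleFunc E E) {f : X → E} (hf : Measurable f) :
    ∫ x in B, h (f x) ∂n = ∑ c ∈ h.range, n.real (f ⁻¹' (h ⁻¹' {c}) ∩ B) • c := by
  have : IsFiniteMeasure (n.restrict B) := ⟨by simpa using hn.lt_top⟩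
  have h1 : ∫ x in B, h (f x) ∂n = ∫ y, h y ∂((n.restrict B).map f) :=
    (integral_map hf.aemeasurable h.aestronglyMeasurable).symm
  have h2 : Integrable h ((n.restrict B).map f) := h.integrable_of_isFiniteMeasure
  rw [h1, SimpleFunc.integral_eq_sum h h2]
  refine Finset.sum_congr rfl fun c _ ↦ ?_
  have hm : MeasurableSet (h ⁻¹' {c}) := h.measurableSet_fiber c
  rw [measureReal_def, measureReal_def, Measure.map_apply hf hm, Measure.restrict_apply (hf hm)]

lemma measurableSet_fiber_inter {E : Type*} [MeasurableSpace E] (hB : MeasurableSet B)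
    (h : SimpleFunc E E)
    {f : X → E}
    (hf : Measurable f) (c : E) : MeasurableSet (f ⁻¹' (h ⁻¹' {c}) ∩ B) :=
  (hf (h.measurableSet_fiber c)).inter hB

lemma disjoint_fiber_inter {X E : Type*} [MeasurableSpace E] {B : Set X}
    (h : SimpleFunc E E) (f : X → E)
    {c c' : E} (hc : c ≠ c') :
    Disjoint (f ⁻¹' (h ⁻¹' {c}) ∩ B) (f ⁻¹' (h ⁻¹' {c'}) ∩ B) := by
  rw [Set.disjoint_left]
  rintro x ⟨h1, -⟩ ⟨h2, -⟩
  exact hc (h1.symm.trans h2)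

end Fibers

namespace IsPoissonRandomMeasure

variable {X : Type*} [MeasurableSpace X] {Λ : Measure X} {B : Set X}
  {Ω : Type*} [MeasurableSpace Ω] {P : Measure Ω} [IsProbabilityMeasure P] {N : Ω → Measure X}
  {E : Type*} [NormedAddCommGroup E] [InnerProductSpace ℝ E] [CompleteSpace E]
  [SecondCountableTopology E] [MeasurableSpace E] [BorelSpace E]

lemma ae_compensated_sub
    (hN : IsPoissonRandomMeasure P N Λ) (hB : MeasurableSet B)
    (hΛB : Λ B ≠ ∞) {f g : X → E} (hf : Measurable f) (hg : Measurable g)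
    (hfi : IntegrableOn f B Λ) (hgi : IntegrableOn g B Λ) :
    ∀ᵐ ω ∂P, compensated Λ hB (fun x ↦ f x - g x) (N ω) =
      compensated Λ hB f (N ω) - compensated Λ hB g (N ω) := by
  filter_upwards [hN.ae_compensated_eq hB hΛB f, hN.ae_compensated_eq hB hΛB g,
    hN.ae_compensated_eq hB hΛB (fun x ↦ f x - g x), hN.ae_integrableOn hB hΛB hf hfi,
    hN.ae_integrableOn hB hΛB hg hgi] with ω h1 h2 h3 h4 h5
  rw [h1, h2, h3, integral_sub h4 h5, integral_sub hfi hgi]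
  abel

/-- The integrals against `N` and `Λ` are bounded separately; by Campbell's formula each contributes
the same amount, hence the factor `2`. The bound is crude but suffices for the passage from simple
to integrable integrands. -/
lemma eLpNorm_one_compensated_le
    (hN : IsPoissonRandomMeasure P N Λ) (hB : MeasurableSet B)
    (hΛB : Λ B ≠ ∞) {f : X → E} (hf : Measurable f) :
    eLpNorm (fun ω ↦ compensated Λ hB f (N ω)) 1 P ≤ 2 * eLpNorm f 1 (Λ.restrict B) := by
  rw [eLpNorm_one_eq_lintegral_enorm, eLpNorm_one_eq_lintegral_enorm, two_mul]
  calc ∫⁻ ω, ‖compensated Λ hB f (N ω)‖ₑ ∂P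
      ≤ ∫⁻ ω, (∫⁻ x in B, ‖f x‖ₑ ∂(N ω)) + ∫⁻ x in B, ‖f x‖ₑ ∂Λ ∂P := by
        refine lintegral_mono_ae ?_
        filter_upwards [hN.ae_compensated_eq hB hΛB f] with ω hω
        rw [hω]
        exact enorm_sub_le.trans (add_le_add (enorm_integral_le_lintegral_enorm _)
          (enorm_integral_le_lintegral_enorm _))
    _ = _ := by
        rw [lintegral_add_right _ measurable_const, hN.lintegral_setLIntegral hB hΛB hf.enorm]
        simp

lemma ae_compensated_simpleFunc
    (hN : IsPoissonRandomMeasure P N Λ) (hB : MeasurableSet B)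
    (hΛB : Λ B ≠ ∞) (h : SimpleFunc E E) {f : X → E} (hf : Measurable f) :
    ∀ᵐ ω ∂P, compensated Λ hB (fun x ↦ h (f x)) (N ω) = ∑ c ∈ h.range,
      ((N ω (f ⁻¹' (h ⁻¹' {c}) ∩ B)).toReal - (Λ (f ⁻¹' (h ⁻¹' {c}) ∩ B)).toNNReal) • c := by
  filter_upwards [hN.ae_compensated_eq hB hΛB fun x ↦ h (f x), hN.ae_lt_top hB hΛB] with ω h1 h2
  rw [h1, setIntegral_simpleFunc_comp h2.ne h hf, setIntegral_simpleFunc_comp hΛB h hf,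
    ← Finset.sum_sub_distrib]
  exact Finset.sum_congr rfl fun c _ ↦ (sub_smul _ _ _).symm

lemma memLp_count (hN : IsPoissonRandomMeasure P N Λ) {A : Set X} (hA : MeasurableSet A)
    (hΛA : Λ A ≠ ∞) : MemLp (fun ω ↦ (N ω A).toReal - (Λ A).toNNReal) 2 P :=
  (memLp_toReal_of_hasLaw_poisson (hN.hasLaw A hA hΛA)).sub (memLp_const _)

lemma integral_count (hN : IsPoissonRandomMeasure P N Λ) {A : Set X} (hA : MeasurableSet A)
    (hΛA : Λ A ≠ ∞) : ∫ ω, ((N ω A).toReal - (Λ A).toNNReal) ∂P = 0 := by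
  have h := hN.hasLaw A hA hΛA
  rw [integral_sub ((memLp_toReal_of_hasLaw_poisson h).integrable one_le_two)
    (integrable_const _), integral_toReal_of_hasLaw_poisson h]
  simp

lemma integral_count_mul_count (hN : IsPoissonRandomMeasure P N Λ) {A A' : Set X}
    (hA : MeasurableSet A) (hΛA : Λ A ≠ ∞) (hA' : MeasurableSet A') (hΛA' : Λ A' ≠ ∞)
    (hd : Disjoint A A') :
    ∫ ω, ((N ω A).toReal - (Λ A).toNNReal) * ((N ω A').toReal - (Λ A').toNNReal) ∂P = 0 := by
  have h1 := hN.iIndepFun_of_fintype (fun i : Bool ↦ cond i A A') (by rintro (_ | _) <;> simpa)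
    (by rintro (_ | _) (_ | _) hij <;> simp_all [disjoint_comm])
  have h2 : IndepFun (fun ω ↦ N ω A) (fun ω ↦ N ω A') P :=
    h1.indepFun (i := true) (j := false) (by simp)
  have hm (r : ℝ) : Measurable fun y : ℝ≥0∞ ↦ y.toReal - r := by fun_prop
  have h3 := h2.comp (hm (Λ A).toNNReal) (hm (Λ A').toNNReal)
  have h4 := h3.integral_fun_mul_eq_mul_integral
    ((hN.memLp_count hA hΛA).aestronglyMeasurable) ((hN.memLp_count hA' hΛA').aestronglyMeasurable)
  refine h4.trans ?_
  have h5 := hN.integral_count hA hΛA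
  have h6 : ∫ ω, ((fun y : ℝ≥0∞ ↦ y.toReal - (Λ A).toNNReal) ∘ fun ω ↦ N ω A) ω ∂P = 0 := h5
  rw [h6, zero_mul]

/-- The isometry for simple integrands: the integral is a combination of centred counts on disjoint
fibres, which are orthogonal by independence, and the variance of a Poisson count is its mean. -/
lemma integral_norm_sq_compensated_simpleFunc (hN : IsPoissonRandomMeasure P N Λ)
    (hB : MeasurableSet B) (hΛB : Λ B ≠ ∞) (h : SimpleFunc E E) {f : X → E} (hf : Measurable f) :
    ∫ ω, ‖compensated Λ hB (fun x ↦ h (f x)) (N ω)‖ ^ 2 ∂P = ∫ x in B, ‖h (f x)‖ ^ 2 ∂Λ := by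
  have hfin (c : E) : Λ (f ⁻¹' (h ⁻¹' {c}) ∩ B) ≠ ∞ :=
    measure_ne_top_of_subset Set.inter_subset_right hΛB
  have hmeas := measurableSet_fiber_inter hB h hf
  have h1 : ∫ ω, ‖compensated Λ hB (fun x ↦ h (f x)) (N ω)‖ ^ 2 ∂P = ∑ c ∈ h.range,
      (Λ (f ⁻¹' (h ⁻¹' {c}) ∩ B)).toReal * ‖c‖ ^ 2 := by
    rw [integral_congr_ae ((hN.ae_compensated_simpleFunc hB hΛB h hf).mono fun ω hω ↦
      congrArg (fun y ↦ ‖y‖ ^ 2) hω)]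
    rw [integral_norm_sum_smul_sq (X := fun c ω ↦ (N ω (f ⁻¹' (h ⁻¹' {c}) ∩ B)).toReal -
      (Λ (f ⁻¹' (h ⁻¹' {c}) ∩ B)).toNNReal) h.range
      (fun c _ ↦ hN.memLp_count (hmeas c) (hfin c))
      (fun c _ c' _ hne ↦ hN.integral_count_mul_count (hmeas c) (hfin c) (hmeas c') (hfin c')
        (disjoint_fiber_inter h f hne))]
    refine Finset.sum_congr rfl fun c _ ↦ ?_
    rw [integral_toReal_sub_sq_of_hasLaw_poisson (hN.hasLaw _ (hmeas c) (hfin c))]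
    rfl
  rw [h1]
  have : IsFiniteMeasure (Λ.restrict B) := ⟨by simpa using hΛB.lt_top⟩
  have hm : Measurable fun y ↦ ‖h y‖ ^ 2 := h.measurable.norm.pow_const 2
  have h2 : ∫ x in B, ‖h (f x)‖ ^ 2 ∂Λ = ∫ y, (h.map fun c ↦ ‖c‖ ^ 2) y ∂((Λ.restrict B).map f) :=
    (integral_map hf.aemeasurable hm.aestronglyMeasurable).symm
  rw [h2, ← SimpleFunc.integral_eq_integral _ (SimpleFunc.integrable_of_isFiniteMeasure _),
    SimpleFunc.map_integral _ _ h.integrable_of_isFiniteMeasure (by simp)]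
  refine Finset.sum_congr rfl fun c _ ↦ ?_
  have hm : MeasurableSet (h ⁻¹' {c}) := h.measurableSet_fiber c
  rw [measureReal_def, Measure.map_apply hf hm, Measure.restrict_apply (hf hm), smul_eq_mul]

lemma integral_compensated_simpleFunc (hN : IsPoissonRandomMeasure P N Λ)
    (hB : MeasurableSet B) (hΛB : Λ B ≠ ∞) (h : SimpleFunc E E) {f : X → E} (hf : Measurable f) :
    ∫ ω, compensated Λ hB (fun x ↦ h (f x)) (N ω) ∂P = 0 := by
  have hfin (c : E) : Λ (f ⁻¹' (h ⁻¹' {c}) ∩ B) ≠ ∞ :=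
    measure_ne_top_of_subset Set.inter_subset_right hΛB
  have hmeas := measurableSet_fiber_inter hB h hf
  rw [integral_congr_ae (hN.ae_compensated_simpleFunc hB hΛB h hf), integral_finsetSum]
  · refine Finset.sum_eq_zero fun c _ ↦ ?_
    rw [integral_smul_const, hN.integral_count (hmeas c) (hfin c), zero_smul]
  · exact fun c _ ↦ ((hN.memLp_count (hmeas c) (hfin c)).integrable one_le_two).smul_const c

/-- The fibre counts are independent Poisson variables. The law is expressed through `(Λ.restrict
B).map f` alone, so that two integrands with the same image measure can be compared. -/
lemma map_compensated_simpleFunc (hN : IsPoissonRandomMeasure P N Λ)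
    (hB : MeasurableSet B) (hΛB : Λ B ≠ ∞) (h : SimpleFunc E E) {f : X → E} (hf : Measurable f) :
    P.map (fun ω ↦ compensated Λ hB (fun x ↦ h (f x)) (N ω)) =
      (Measure.pi fun c : h.range ↦ (poissonMeasure
        ((Λ.restrict B).map f (h ⁻¹' {c.1})).toNNReal).map (fun k : ℕ ↦ (k : ℝ≥0∞))).map
        (fun y ↦ ∑ c : h.range,
          ((y c).toReal - (((Λ.restrict B).map f (h ⁻¹' {c.1})).toNNReal : ℝ)) • c.1) := by
  have hfin (c : E) : Λ (f ⁻¹' (h ⁻¹' {c}) ∩ B) ≠ ∞ :=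
    measure_ne_top_of_subset Set.inter_subset_right hΛB
  have hmeas := measurableSet_fiber_inter hB h hf
  have hval (c : E) : (Λ.restrict B).map f (h ⁻¹' {c}) = Λ (f ⁻¹' (h ⁻¹' {c}) ∩ B) := by
    have hm : MeasurableSet (h ⁻¹' {c}) := h.measurableSet_fiber c
    rw [Measure.map_apply hf hm, Measure.restrict_apply (hf hm)]
  simp only [hval]
  have hind := hN.iIndepFun_of_fintype (fun c : h.range ↦ f ⁻¹' (h ⁻¹' {c.1}) ∩ B)
    (fun c ↦ hmeas c) (fun c c' hne ↦ disjoint_fiber_inter h f (fun h ↦ hne (Subtype.ext h)))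
  have hNm (c : E) : AEMeasurable (fun ω ↦ N ω (f ⁻¹' (h ⁻¹' {c}) ∩ B)) P :=
    (hN.hasLaw _ (hmeas c) (hfin c)).aemeasurable
  have hlaw := (iIndepFun_iff_map_fun_eq_pi_map (fun c : h.range ↦ hNm c)).1 hind
  have hlaw' (c : h.range) := (hN.hasLaw _ (hmeas c) (hfin c)).map_eq
  simp only [hlaw'] at hlaw
  rw [← hlaw, AEMeasurable.map_map_of_aemeasurable]
  · refine Measure.map_congr ?_
    filter_upwards [hN.ae_compensated_simpleFunc hB hΛB h hf] with ω hω
    rw [hω]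
    exact (Finset.sum_coe_sort h.range fun c ↦ ((N ω (f ⁻¹' (h ⁻¹' {c}) ∩ B)).toReal -
      (Λ (f ⁻¹' (h ⁻¹' {c}) ∩ B)).toNNReal) • c).symm
  · exact Measurable.aemeasurable (by fun_prop)
  · exact aemeasurable_pi_lambda _ fun c ↦ hNm c

end IsPoissonRandomMeasure

/-! ### Approximation by simple functions, mean square bounds and laws -/

section ApproxId

variable {X : Type*} [MeasurableSpace X] {μ : Measure X}
  {E : Type*} [NormedAddCommGroup E] [SecondCountableTopology E] [MeasurableSpace E] [BorelSpace E]

/-- Simple functions which converge pointwise to the identity. -/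
noncomputable def approxId (E : Type*) [NormedAddCommGroup E] [SecondCountableTopology E]
    [MeasurableSpace E] [BorelSpace E] (k : ℕ) : SimpleFunc E E :=
  SimpleFunc.approxOn id measurable_id Set.univ 0 (Set.mem_univ _) k

lemma measurable_approxId_comp {f : X → E} (hf : Measurable f) (k : ℕ) :
    Measurable fun x ↦ approxId E k (f x) := (SimpleFunc.measurable _).comp hf

/-- The simple functions act on the values of `f`, not on `X`, so a single sequence serves all
integrands. Comparing the laws of two integrals depends on this. -/
lemma tendsto_eLpNorm_approxId_comp_sub {f : X → E} (hf : Measurable f) {p : ℝ≥0∞} (hp : p ≠ ∞)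
    (hfp : MemLp f p μ) :
    Tendsto (fun k ↦ eLpNorm (fun x ↦ approxId E k (f x) - f x) p μ) atTop (𝓝 0) := by
  have h1 : eLpNorm (fun y : E ↦ id y - 0) p (μ.map f) < ∞ := by
    simp only [id, sub_zero]
    rw [eLpNorm_map_measure (by fun_prop) hf.aemeasurable]
    exact hfp.2
  have h2 := SimpleFunc.tendsto_approxOn_Lp_eLpNorm (f := (id : E → E)) measurable_id
    (Set.mem_univ (0 : E)) hp (μ := μ.map f) (Eventually.of_forall fun y ↦ by simp) h1
  refine h2.congr fun k ↦ ?_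
  rw [eLpNorm_map_measure _ hf.aemeasurable]
  · rfl
  · exact ((SimpleFunc.measurable _).sub measurable_id).aestronglyMeasurable

end ApproxId

namespace IsPoissonRandomMeasure

variable {X : Type*} [MeasurableSpace X] {Λ : Measure X} {B B' : Set X}
  {Ω : Type*} [MeasurableSpace Ω] {P : Measure Ω} [IsProbabilityMeasure P] {N : Ω → Measure X}
  {E : Type*} [NormedAddCommGroup E] [InnerProductSpace ℝ E] [CompleteSpace E]
  [SecondCountableTopology E] [MeasurableSpace E] [BorelSpace E]

lemma aestronglyMeasurable_compensated (hN : IsPoissonRandomMeasure P N Λ)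
    (hB : MeasurableSet B) {f : X → E} (hf : Measurable f) :
    AEStronglyMeasurable (fun ω ↦ compensated Λ hB f (N ω)) P :=
  ((measurable_compensated hB hf).comp hN.measurable).aestronglyMeasurable

lemma tendsto_eLpNorm_one_compensated (hN : IsPoissonRandomMeasure P N Λ) (hB : MeasurableSet B)
    (hΛB : Λ B ≠ ∞) {f : X → E} (hf : Measurable f) (hfi : IntegrableOn f B Λ) :
    Tendsto (fun k ↦ eLpNorm ((fun ω ↦ compensated Λ hB (fun x ↦ approxId E k (f x)) (N ω)) -
      fun ω ↦ compensated Λ hB f (N ω)) 1 P) atTop (𝓝 0) := by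
  have : IsFiniteMeasure (Λ.restrict B) := ⟨by simpa using hΛB.lt_top⟩
  have h1 := tendsto_eLpNorm_approxId_comp_sub hf ENNReal.one_ne_top
    (memLp_one_iff_integrable.2 hfi)
  have h2 := ENNReal.Tendsto.const_mul h1 (Or.inr (ENNReal.ofNat_ne_top (n := 2)))
  rw [mul_zero] at h2
  refine tendsto_of_tendsto_of_tendsto_of_le_of_le tendsto_const_nhds h2 (fun _ ↦ zero_le)
    fun k ↦ ?_
  have hk : Measurable fun x ↦ approxId E k (f x) := measurable_approxId_comp hf k
  have hki : IntegrableOn (fun x ↦ approxId E k (f x)) B Λ :=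
    ((approxId E k).comp f hf).integrable_of_isFiniteMeasure
  refine le_trans (le_of_eq (eLpNorm_congr_ae ?_))
    (hN.eLpNorm_one_compensated_le hB hΛB (hk.sub hf))
  filter_upwards [hN.ae_compensated_sub hB hΛB hk hf hki hfi] with ω hω using hω.symm

lemma tendstoInMeasure_compensated_approxId (hN : IsPoissonRandomMeasure P N Λ)
    (hB : MeasurableSet B) (hΛB : Λ B ≠ ∞) {f : X → E} (hf : Measurable f)
    (hfi : IntegrableOn f B Λ) :
    TendstoInMeasure P (fun k ω ↦ compensated Λ hB (fun x ↦ approxId E k (f x)) (N ω)) atTop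
      (fun ω ↦ compensated Λ hB f (N ω)) :=
  tendstoInMeasure_of_tendsto_eLpNorm one_ne_zero
    (fun k ↦ hN.aestronglyMeasurable_compensated hB (measurable_approxId_comp hf k))
    (hN.aestronglyMeasurable_compensated hB hf)
    (hN.tendsto_eLpNorm_one_compensated hB hΛB hf hfi)

lemma eLpNorm_two_compensated_simpleFunc (hN : IsPoissonRandomMeasure P N Λ)
    (hB : MeasurableSet B) (hΛB : Λ B ≠ ∞) (h : SimpleFunc E E) {f : X → E} (hf : Measurable f) :
    eLpNorm (fun ω ↦ compensated Λ hB (fun x ↦ h (f x)) (N ω)) 2 P =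
      eLpNorm (fun x ↦ h (f x)) 2 (Λ.restrict B) := by
  have : IsFiniteMeasure (Λ.restrict B) := ⟨by simpa using hΛB.lt_top⟩
  have hm : MemLp (fun ω ↦ compensated Λ hB (fun x ↦ h (f x)) (N ω)) 2 P := by
    refine MemLp.ae_eq (EventuallyEq.symm (hN.ae_compensated_simpleFunc hB hΛB h hf)) ?_
    refine memLp_finsetSum _ fun c _ ↦ ?_
    exact (ContinuousLinearMap.toSpanSingleton ℝ c).comp_memLp'
      (hN.memLp_count (measurableSet_fiber_inter hB h hf c)
        (measure_ne_top_of_subset Set.inter_subset_right hΛB))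
  have hm' : MemLp (fun x ↦ h (f x)) 2 (Λ.restrict B) :=
    (h.comp f hf).memLp_of_isFiniteMeasure 2 _
  rw [hm.eLpNorm_eq_integral_rpow_norm two_ne_zero ENNReal.ofNat_ne_top,
    hm'.eLpNorm_eq_integral_rpow_norm two_ne_zero ENNReal.ofNat_ne_top]
  simp only [ENNReal.toReal_ofNat, Real.rpow_two]
  rw [hN.integral_norm_sq_compensated_simpleFunc hB hΛB h hf]

/-- Simple integrands satisfy an isometry, and an eventual `L²` bound survives convergence in
measure. Only the inequality is needed afterwards. -/
lemma eLpNorm_two_compensated_le (hN : IsPoissonRandomMeasure P N Λ)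
    (hB : MeasurableSet B) (hΛB : Λ B ≠ ∞) {f : X → E} (hf : Measurable f)
    (hf2 : MemLp f 2 (Λ.restrict B)) :
    eLpNorm (fun ω ↦ compensated Λ hB f (N ω)) 2 P ≤ eLpNorm f 2 (Λ.restrict B) := by
  have : IsFiniteMeasure (Λ.restrict B) := ⟨by simpa using hΛB.lt_top⟩
  refine ENNReal.le_of_forall_pos_le_add fun ε hε _ ↦ ?_
  have h1 := tendsto_eLpNorm_approxId_comp_sub hf ENNReal.ofNat_ne_top hf2
  have h2 := h1.eventually (eventually_le_nhds (ENNReal.coe_pos.2 hε))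
  refine eLpNorm_le_of_tendstoInMeasure (u := atTop) ?_
    (hN.tendstoInMeasure_compensated_approxId hB hΛB hf (hf2.integrable one_le_two))
    (fun k ↦ hN.aestronglyMeasurable_compensated hB (measurable_approxId_comp hf k))
  filter_upwards [h2] with k hk
  rw [hN.eLpNorm_two_compensated_simpleFunc hB hΛB _ hf]
  have hkm : Measurable fun x ↦ approxId E k (f x) := measurable_approxId_comp hf k
  calc eLpNorm (fun x ↦ approxId E k (f x)) 2 (Λ.restrict B)
      = eLpNorm (f + fun x ↦ approxId E k (f x) - f x) 2 (Λ.restrict B) := by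
        congr 1; ext x; simp
    _ ≤ _ := (eLpNorm_add_le hf.aestronglyMeasurable (hkm.sub hf).aestronglyMeasurable
        one_le_two).trans (add_le_add le_rfl hk)

lemma memLp_two_compensated (hN : IsPoissonRandomMeasure P N Λ)
    (hB : MeasurableSet B) (hΛB : Λ B ≠ ∞) {f : X → E} (hf : Measurable f)
    (hf2 : MemLp f 2 (Λ.restrict B)) : MemLp (fun ω ↦ compensated Λ hB f (N ω)) 2 P :=
  ⟨hN.aestronglyMeasurable_compensated hB hf,
    (hN.eLpNorm_two_compensated_le hB hΛB hf hf2).trans_lt hf2.2⟩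

lemma integral_compensated (hN : IsPoissonRandomMeasure P N Λ)
    (hB : MeasurableSet B) (hΛB : Λ B ≠ ∞) {f : X → E} (hf : Measurable f)
    (hf2 : MemLp f 2 (Λ.restrict B)) : ∫ ω, compensated Λ hB f (N ω) ∂P = 0 := by
  have : IsFiniteMeasure (Λ.restrict B) := ⟨by simpa using hΛB.lt_top⟩
  have h1 := hN.tendsto_eLpNorm_one_compensated hB hΛB hf (hf2.integrable one_le_two)
  have h2 := tendsto_integral_of_L1' (fun ω ↦ compensated Λ hB f (N ω))
    ((hN.memLp_two_compensated hB hΛB hf hf2).integrable one_le_two).aestronglyMeasurable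
    (F := fun k ω ↦ compensated Λ hB (fun x ↦ approxId E k (f x)) (N ω))
    (Eventually.of_forall fun k ↦ (hN.memLp_two_compensated hB hΛB
      (measurable_approxId_comp hf k)
      (((approxId E k).comp f hf).memLp_of_isFiniteMeasure 2 _)).integrable one_le_two) h1
  simp only [hN.integral_compensated_simpleFunc hB hΛB _ hf] at h2
  exact tendsto_nhds_unique h2 tendsto_const_nhds

/-- The law of a compensated integral depends only on the image of the intensity measure under
the integrand. -/
lemma map_compensated_congr (hN : IsPoissonRandomMeasure P N Λ)
    (hB : MeasurableSet B) (hΛB : Λ B ≠ ∞) (hB' : MeasurableSet B') (hΛB' : Λ B' ≠ ∞)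
    {f f' : X → E} (hf : Measurable f) (hf' : Measurable f')
    (hfi : IntegrableOn f B Λ) (hfi' : IntegrableOn f' B' Λ)
    (h : (Λ.restrict B).map f = (Λ.restrict B').map f') :
    P.map (fun ω ↦ compensated Λ hB f (N ω)) = P.map (fun ω ↦ compensated Λ hB' f' (N ω)) := by
  refine map_eq_of_tendstoInMeasure
    (fun k ↦ (hN.aestronglyMeasurable_compensated hB
      (measurable_approxId_comp hf k)).aemeasurable)
    (fun k ↦ (hN.aestronglyMeasurable_compensated hB'
      (measurable_approxId_comp hf' k)).aemeasurable) (fun k ↦ ?_)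
    (hN.tendstoInMeasure_compensated_approxId hB hΛB hf hfi)
    (hN.tendstoInMeasure_compensated_approxId hB' hΛB' hf' hfi')
  rw [hN.map_compensated_simpleFunc hB hΛB _ hf, hN.map_compensated_simpleFunc hB' hΛB' _ hf', h]

end IsPoissonRandomMeasure

/-! ### The product intensity -/

section TimeMeasure

lemma measurableEmbedding_nnreal_coe : MeasurableEmbedding ((↑) : ℝ≥0 → ℝ) :=
  MeasurableEmbedding.subtype_coe measurableSet_Ici

lemma timeMeasure_Ioc (s t : ℝ≥0) : timeMeasure (Set.Ioc s t) = ENNReal.ofReal (t - s) := by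
  rw [timeMeasure, measurableEmbedding_nnreal_coe.comap_apply]
  have : ((↑) : ℝ≥0 → ℝ) '' Set.Ioc s t = Set.Ioc (s : ℝ) t := by
    ext x
    constructor
    · rintro ⟨y, ⟨h1, h2⟩, rfl⟩
      exact ⟨NNReal.coe_lt_coe.2 h1, NNReal.coe_le_coe.2 h2⟩
    · rintro ⟨h1, h2⟩
      have hx : 0 ≤ x := s.2.trans h1.le
      exact ⟨⟨x, hx⟩, ⟨NNReal.coe_lt_coe.1 h1, NNReal.coe_le_coe.1 h2⟩, rfl⟩
  rw [this, Real.volume_Ioc]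

instance : SigmaFinite timeMeasure := by
  refine SigmaFinite.of_map timeMeasure
    measurableEmbedding_nnreal_coe.measurable.aemeasurable ?_
  rw [timeMeasure, measurableEmbedding_nnreal_coe.map_comap]
  infer_instance

variable {S : Type*} [MeasurableSpace S] {ν : Measure S} {s t : ℝ≥0} {A : Set S}

lemma prod_timeMeasure_ne_top [SFinite ν] (hνA : ν A ≠ ∞) :
    (timeMeasure.prod ν) (Set.Ioc s t ×ˢ A) ≠ ∞ := by
  rw [Measure.prod_prod, timeMeasure_Ioc]
  exact ENNReal.mul_ne_top ENNReal.ofReal_ne_top hνA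

lemma map_snd_restrict_prod [SFinite ν] :
    ((timeMeasure.prod ν).restrict (Set.Ioc s t ×ˢ A)).map Prod.snd =
      ENNReal.ofReal (t - s) • ν.restrict A := by
  rw [← Measure.prod_restrict, Measure.map_snd_prod, Measure.restrict_apply_univ, timeMeasure_Ioc]

/-- Time enters only through `t - s`: this is the source of the homogeneity of the jump part. -/
lemma map_restrict_prod [SFinite ν] {E : Type*} [MeasurableSpace E]
    {h : S → E} (hh : Measurable h) :
    ((timeMeasure.prod ν).restrict (Set.Ioc s t ×ˢ A)).map (fun p ↦ h p.2) =
      ENNReal.ofReal (t - s) • (ν.restrict A).map h := by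
  rw [← Measure.map_smul, ← map_snd_restrict_prod, Measure.map_map hh measurable_snd]
  rfl

variable {E : Type*} [NormedAddCommGroup E] [MeasurableSpace E] [BorelSpace E]
  [SecondCountableTopology E]

lemma memLp_comp_snd [SFinite ν] {h : S → E} (hh : Measurable h)
    {p : ℝ≥0∞} (hp : MemLp h p (ν.restrict A)) :
    MemLp (fun q : ℝ≥0 × S ↦ h q.2) p ((timeMeasure.prod ν).restrict (Set.Ioc s t ×ˢ A)) := by
  have h1 : MemLp h p (((timeMeasure.prod ν).restrict (Set.Ioc s t ×ˢ A)).map Prod.snd) := by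
    rw [map_snd_restrict_prod]
    exact hp.smul_measure ENNReal.ofReal_ne_top
  exact (memLp_map_measure_iff hh.aestronglyMeasurable measurable_snd.aemeasurable).1 h1

lemma eLpNorm_two_sq {α F : Type*} [MeasurableSpace α] [NormedAddCommGroup F] (f : α → F)
    (μ : Measure α) : eLpNorm f 2 μ ^ 2 = ∫⁻ x, ‖f x‖ₑ ^ 2 ∂μ := by
  have := eLpNorm_nnreal_pow_eq_lintegral (f := f) (μ := μ) (p := 2) two_ne_zero
  norm_num at this
  exact this

lemma eLpNorm_two_le_iff_sq {α F : Type*} [MeasurableSpace α] [NormedAddCommGroup F] {f : α → F}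
    {μ : Measure α} {c : ℝ≥0∞} : ∫⁻ x, ‖f x‖ₑ ^ 2 ∂μ ≤ c ^ 2 ↔ eLpNorm f 2 μ ≤ c := by
  rw [← eLpNorm_two_sq, ENNReal.pow_le_pow_left_iff two_ne_zero]

/-- Continuity from above of the finite measure with density `f`. -/
lemma tendsto_setLIntegral_compl [SFinite ν] {f : S → ℝ≥0∞} (hf : Measurable f)
    (hfi : ∫⁻ z, f z ∂ν ≠ ∞) {A : ℕ → Set S} (hA : Monotone A) (hAm : ∀ k, MeasurableSet (A k))
    (hAu : (⋃ k, A k) = Set.univ) :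
    Tendsto (fun k ↦ ∫⁻ z in (A k)ᶜ, f z ∂ν) atTop (𝓝 0) := by
  have : IsFiniteMeasure (ν.withDensity f) := isFiniteMeasure_withDensity hfi
  have h1 := tendsto_measure_iInter_atTop (μ := ν.withDensity f) (s := fun k ↦ (A k)ᶜ)
    (fun k ↦ (hAm k).compl.nullMeasurableSet) (fun i j hij ↦ Set.compl_subset_compl.2 (hA hij))
    ⟨0, measure_ne_top _ _⟩
  rw [← Set.compl_iUnion, hAu, Set.compl_univ, measure_empty] at h1
  refine h1.congr fun k ↦ ?_
  exact withDensity_apply _ (hAm k).compl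

end TimeMeasure

/-! ### Jump integrals over mark sets of finite measure -/

section JumpIntegralOn

variable {S : Type*} [MeasurableSpace S] {ν : Measure S} [SigmaFinite ν] {s t : ℝ≥0} {A A' : Set S}
  {Ω : Type*} [MeasurableSpace Ω] {P : Measure Ω} [IsProbabilityMeasure P]
  {N : Ω → Measure (ℝ≥0 × S)}
  {E : Type*} [NormedAddCommGroup E] [InnerProductSpace ℝ E] [CompleteSpace E]
  [SecondCountableTopology E] [MeasurableSpace E] [BorelSpace E] {h h' : S → E}

/-- The integral of `h` over `(s, t] × A` against the compensated measure. -/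
noncomputable def jumpIntegralOn (ν : Measure S) (s t : ℝ≥0) (hA : MeasurableSet A) (h : S → E)
    (n : Measure (ℝ≥0 × S)) : E :=
  compensated (timeMeasure.prod ν) (measurableSet_Ioc.prod hA : MeasurableSet (Set.Ioc s t ×ˢ A))
    (fun p ↦ h p.2) n

lemma ae_jumpIntegralOn_sub (hN : IsPoissonRandomMeasure P N (timeMeasure.prod ν))
    (hA : MeasurableSet A) (hνA : ν A ≠ ∞) (hh : Measurable h) (hh' : Measurable h')
    (h2 : MemLp h 2 ν) (h2' : MemLp h' 2 ν) :
    ∀ᵐ ω ∂P, jumpIntegralOn ν s t hA (fun z ↦ h z - h' z) (N ω) =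
      jumpIntegralOn ν s t hA h (N ω) - jumpIntegralOn ν s t hA h' (N ω) := by
  have : IsFiniteMeasure (ν.restrict A) := ⟨by simpa using hνA.lt_top⟩
  have h1 := memLp_comp_snd (s := s) (t := t) hh
    (memLp_one_iff_integrable.2 ((h2.restrict A).integrable one_le_two))
  have h1' := memLp_comp_snd (s := s) (t := t) hh'
    (memLp_one_iff_integrable.2 ((h2'.restrict A).integrable one_le_two))
  exact hN.ae_compensated_sub _ (prod_timeMeasure_ne_top hνA) (hh.comp measurable_snd)
    (hh'.comp measurable_snd) (memLp_one_iff_integrable.1 h1) (memLp_one_iff_integrable.1 h1')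

lemma measurable_jumpIntegralOn (hA : MeasurableSet A) (hh : Measurable h) :
    Measurable (jumpIntegralOn ν s t hA h) :=
  measurable_compensated _ (hh.comp measurable_snd)

lemma aestronglyMeasurable_jumpIntegralOn
    (hN : IsPoissonRandomMeasure P N (timeMeasure.prod ν)) (hA : MeasurableSet A)
    (hh : Measurable h) : AEStronglyMeasurable (fun ω ↦ jumpIntegralOn ν s t hA h (N ω)) P :=
  ((measurable_jumpIntegralOn hA hh).comp hN.measurable).aestronglyMeasurable

lemma memLp_jumpIntegralOn (hN : IsPoissonRandomMeasure P N (timeMeasure.prod ν))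
    (hA : MeasurableSet A) (hνA : ν A ≠ ∞) (hh : Measurable h) (h2 : MemLp h 2 ν) :
    MemLp (fun ω ↦ jumpIntegralOn ν s t hA h (N ω)) 2 P :=
  hN.memLp_two_compensated _ (prod_timeMeasure_ne_top hνA) (hh.comp measurable_snd)
    (memLp_comp_snd hh (h2.restrict A))

lemma integral_jumpIntegralOn (hN : IsPoissonRandomMeasure P N (timeMeasure.prod ν))
    (hA : MeasurableSet A) (hνA : ν A ≠ ∞) (hh : Measurable h) (h2 : MemLp h 2 ν) :
    ∫ ω, jumpIntegralOn ν s t hA h (N ω) ∂P = 0 :=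
  hN.integral_compensated _ (prod_timeMeasure_ne_top hνA) (hh.comp measurable_snd)
    (memLp_comp_snd hh (h2.restrict A))

lemma lintegral_sq_jumpIntegralOn_le (hN : IsPoissonRandomMeasure P N (timeMeasure.prod ν))
    (hA : MeasurableSet A) (hνA : ν A ≠ ∞) (hh : Measurable h) (h2 : MemLp h 2 ν) :
    ∫⁻ ω, ‖jumpIntegralOn ν s t hA h (N ω)‖ₑ ^ 2 ∂P ≤
      ENNReal.ofReal (t - s) * ∫⁻ z in A, ‖h z‖ₑ ^ 2 ∂ν := by
  have h1 := hN.eLpNorm_two_compensated_le (measurableSet_Ioc.prod hA)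
    (prod_timeMeasure_ne_top (s := s) (t := t) hνA) (hh.comp measurable_snd)
    (memLp_comp_snd hh (h2.restrict A))
  rw [← eLpNorm_two_le_iff_sq, eLpNorm_two_sq] at h1
  refine h1.trans (le_of_eq ?_)
  have h3 : Measurable fun z ↦ ‖h z‖ₑ ^ 2 := hh.enorm.pow_const 2
  have h4 := lintegral_map (μ := (timeMeasure.prod ν).restrict (Set.Ioc s t ×ˢ A)) h3
    measurable_snd
  rw [map_snd_restrict_prod, lintegral_smul_measure] at h4
  exact h4.symm

lemma map_jumpIntegralOn_congr (hN : IsPoissonRandomMeasure P N (timeMeasure.prod ν))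
    {s' t' : ℝ≥0} (hst : (t : ℝ) - s = t' - s')
    (hA : MeasurableSet A) (hνA : ν A ≠ ∞) (hh : Measurable h) (h2 : MemLp h 2 ν) :
    P.map (fun ω ↦ jumpIntegralOn ν s t hA h (N ω)) =
      P.map (fun ω ↦ jumpIntegralOn ν s' t' hA h (N ω)) := by
  have : IsFiniteMeasure (ν.restrict A) := ⟨by simpa using hνA.lt_top⟩
  have h1 := memLp_one_iff_integrable.2 ((h2.restrict A).integrable one_le_two)
  refine hN.map_compensated_congr _ (prod_timeMeasure_ne_top hνA) _
    (prod_timeMeasure_ne_top hνA) (hh.comp measurable_snd) (hh.comp measurable_snd)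
    (memLp_one_iff_integrable.1 (memLp_comp_snd hh h1))
    (memLp_one_iff_integrable.1 (memLp_comp_snd hh h1)) ?_
  rw [map_restrict_prod hh, map_restrict_prod hh, hst]

/-- Integrating over `A` is integrating the indicator over a larger set. -/
lemma ae_jumpIntegralOn_indicator (hN : IsPoissonRandomMeasure P N (timeMeasure.prod ν))
    (hA : MeasurableSet A) (hνA : ν A ≠ ∞) (hA' : MeasurableSet A') (hνA' : ν A' ≠ ∞)
    (hAA' : A ⊆ A') : ∀ᵐ ω ∂P,
    jumpIntegralOn ν s t hA' (A.indicator h) (N ω) = jumpIntegralOn ν s t hA h (N ω) := by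
  have hB : MeasurableSet (Set.Ioc s t ×ˢ A) := measurableSet_Ioc.prod hA
  have hB' : MeasurableSet (Set.Ioc s t ×ˢ A') := measurableSet_Ioc.prod hA'
  have key (n : Measure (ℝ≥0 × S)) : ∫ p in Set.Ioc s t ×ˢ A', A.indicator h p.2 ∂n =
      ∫ p in Set.Ioc s t ×ˢ A, h p.2 ∂n := by
    have h1 : Set.Ioc s t ×ˢ A = (Set.Ioc s t ×ˢ A') ∩ Prod.snd ⁻¹' A := by
      ext p
      simp only [Set.mem_prod, Set.mem_inter_iff, Set.mem_preimage]
      exact ⟨fun h ↦ ⟨⟨h.1, hAA' h.2⟩, h.2⟩, fun h ↦ ⟨h.1.1, h.2⟩⟩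
    rw [h1, ← setIntegral_indicator (measurable_snd hA)]
    rfl
  filter_upwards [hN.ae_compensated_eq hB (prod_timeMeasure_ne_top hνA) fun p ↦ h p.2,
    hN.ae_compensated_eq hB' (prod_timeMeasure_ne_top hνA') fun p ↦ A.indicator h p.2]
    with ω h1 h2
  rw [jumpIntegralOn, jumpIntegralOn, h1, h2, key, key]

/-- Over `A ∪ A'` the two integrals become those of indicator multiples of `h`. Their difference
lives on the symmetric difference of `A` and `A'`, which the two complements cover. -/
lemma lintegral_sq_jumpIntegralOn_sub_le
    (hN : IsPoissonRandomMeasure P N (timeMeasure.prod ν))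
    (hA : MeasurableSet A) (hνA : ν A ≠ ∞) (hA' : MeasurableSet A') (hνA' : ν A' ≠ ∞)
    (hh : Measurable h) (h2 : MemLp h 2 ν) :
    ∫⁻ ω, ‖jumpIntegralOn ν s t hA h (N ω) - jumpIntegralOn ν s t hA' h (N ω)‖ₑ ^ 2 ∂P ≤
      ENNReal.ofReal (t - s) *
        (∫⁻ z in Aᶜ, ‖h z‖ₑ ^ 2 ∂ν + ∫⁻ z in A'ᶜ, ‖h z‖ₑ ^ 2 ∂ν) := by
  have hU : MeasurableSet (A ∪ A') := hA.union hA'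
  have hνU : ν (A ∪ A') ≠ ∞ := (measure_union_lt_top hνA.lt_top hνA'.lt_top).ne
  have h1 : ∀ᵐ ω ∂P, jumpIntegralOn ν s t hU
      (fun z ↦ A.indicator h z - A'.indicator h z) (N ω) =
      jumpIntegralOn ν s t hA h (N ω) - jumpIntegralOn ν s t hA' h (N ω) := by
    filter_upwards [ae_jumpIntegralOn_sub (s := s) (t := t) hN hU hνU (hh.indicator hA)
      (hh.indicator hA') (h2.indicator hA) (h2.indicator hA'),
      ae_jumpIntegralOn_indicator (s := s) (t := t) (h := h) hN hA hνA hU hνU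
        Set.subset_union_left,
      ae_jumpIntegralOn_indicator (s := s) (t := t) (h := h) hN hA' hνA' hU hνU
        Set.subset_union_right] with ω e1 e2 e3
    rw [e1, e2, e3]
  calc ∫⁻ ω, ‖jumpIntegralOn ν s t hA h (N ω) - jumpIntegralOn ν s t hA' h (N ω)‖ₑ ^ 2 ∂P
      = ∫⁻ ω, ‖jumpIntegralOn ν s t hU
          (fun z ↦ A.indicator h z - A'.indicator h z) (N ω)‖ₑ ^ 2 ∂P :=
        lintegral_congr_ae (h1.mono fun ω hω ↦ by simp only [hω])
    _ ≤ ENNReal.ofReal (t - s) *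
          ∫⁻ z in A ∪ A', ‖A.indicator h z - A'.indicator h z‖ₑ ^ 2 ∂ν :=
        lintegral_sq_jumpIntegralOn_le hN hU hνU ((hh.indicator hA).sub (hh.indicator hA'))
          ((h2.indicator hA).sub (h2.indicator hA'))
    _ ≤ _ := by
        gcongr
        have h3 : Measurable fun z ↦ ‖h z‖ₑ ^ 2 := hh.enorm.pow_const 2
        rw [← lintegral_indicator hA.compl, ← lintegral_indicator hA'.compl,
          ← lintegral_add_left (h3.indicator hA.compl)]
        refine (setLIntegral_le_lintegral _ _).trans (lintegral_mono fun z ↦ ?_)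
        by_cases hz : z ∈ A <;> by_cases hz' : z ∈ A' <;> simp [hz, hz']

end JumpIntegralOn

/-! ### The jump integral over all marks, measurable in the parameter -/

section JumpIntegral

variable {S : Type*} [MeasurableSpace S] {ν : Measure S} [SigmaFinite ν] {s t : ℝ≥0}
  {Y : Type*} [MeasurableSpace Y]
  {E : Type*} [NormedAddCommGroup E] [InnerProductSpace ℝ E] [CompleteSpace E]
  [SecondCountableTopology E] [MeasurableSpace E] [BorelSpace E] {γ : Y → S → E}

lemma lintegral_enorm_sq_ne_top {h : S → E} (h2 : MemLp h 2 ν) : ∫⁻ z, ‖h z‖ₑ ^ 2 ∂ν ≠ ∞ := by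
  rw [← eLpNorm_two_sq]
  exact ENNReal.pow_ne_top h2.2.ne

lemma tendsto_tail {h : S → E} (hh : Measurable h) (h2 : MemLp h 2 ν) {A : ℕ → Set S}
    (hA : Monotone A) (hAm : ∀ k, MeasurableSet (A k)) (hAu : (⋃ k, A k) = Set.univ) :
    Tendsto (fun k ↦ ∫⁻ z in (A k)ᶜ, ‖h z‖ₑ ^ 2 ∂ν) atTop (𝓝 0) :=
  tendsto_setLIntegral_compl (hh.enorm.pow_const 2) (lintegral_enorm_sq_ne_top h2) hA hAm hAu

lemma tendsto_tail_spanningSets {h : S → E} (hh : Measurable h) (h2 : MemLp h 2 ν) :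
    Tendsto (fun k ↦ ∫⁻ z in (spanningSets ν k)ᶜ, ‖h z‖ₑ ^ 2 ∂ν) atTop (𝓝 0) :=
  tendsto_tail hh h2 (monotone_spanningSets ν) (measurableSet_spanningSets ν)
    (iUnion_spanningSets ν)

lemma exists_tail_le (hγ : Measurable (Function.uncurry γ)) (hγ2 : ∀ y, MemLp (γ y) 2 ν)
    (i : ℕ) (y : Y) :
    ∃ k, ∫⁻ z in (spanningSets ν k)ᶜ, ‖γ y z‖ₑ ^ 2 ∂ν ≤ ((2⁻¹ : ℝ≥0∞) ^ i) ^ 2 := by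
  have h1 := tendsto_tail_spanningSets (hγ.comp measurable_prodMk_left) (hγ2 y)
  have h2 : (0 : ℝ≥0∞) < ((2⁻¹ : ℝ≥0∞) ^ i) ^ 2 :=
    ENNReal.pow_pos (ENNReal.pow_pos (by simp) _) _
  exact (h1.eventually (eventually_le_nhds h2)).exists

open Classical in
/-- An index such that the part of `γ y` outside the corresponding spanning set has squared
`L²` norm at most `4⁻ⁱ`. -/
noncomputable def tailIndex (hγ : Measurable (Function.uncurry γ)) (hγ2 : ∀ y, MemLp (γ y) 2 ν)
    (i : ℕ) (y : Y) : ℕ := Nat.find (exists_tail_le hγ hγ2 i y)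

lemma tail_tailIndex_le (hγ : Measurable (Function.uncurry γ)) (hγ2 : ∀ y, MemLp (γ y) 2 ν)
    (i : ℕ) (y : Y) : ∫⁻ z in (spanningSets ν (tailIndex hγ hγ2 i y))ᶜ, ‖γ y z‖ₑ ^ 2 ∂ν ≤
      ((2⁻¹ : ℝ≥0∞) ^ i) ^ 2 := by
  classical
  exact Nat.find_spec (exists_tail_le hγ hγ2 i y)

lemma measurable_tailIndex (hγ : Measurable (Function.uncurry γ)) (hγ2 : ∀ y, MemLp (γ y) 2 ν)
    (i : ℕ) : Measurable (tailIndex hγ hγ2 i) := by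
  classical
  refine measurable_find _ fun k ↦ measurableSet_le ?_ measurable_const
  exact Measurable.lintegral_prod_right' (ν := ν.restrict (spanningSets ν k)ᶜ)
    (hγ.enorm.pow_const 2)

/-- The compensated integral of `γ y` over `(s, t] × S`, as a jointly measurable function of `y`
and of the random measure. -/
noncomputable def jumpIntegral (hγ : Measurable (Function.uncurry γ))
    (hγ2 : ∀ y, MemLp (γ y) 2 ν) (s t : ℝ≥0) (y : Y) (n : Measure (ℝ≥0 × S)) : E :=
  limUnder atTop fun i ↦ jumpIntegralOn ν s t
    (measurableSet_spanningSets ν (tailIndex hγ hγ2 i y)) (γ y) n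

lemma measurable_jumpIntegralOn_uncurry (hγ : Measurable (Function.uncurry γ)) {A : Set S}
    (hA : MeasurableSet A) :
    Measurable fun p : Y × Measure (ℝ≥0 × S) ↦ jumpIntegralOn ν s t hA (γ p.1) p.2 := by
  refine measurable_compensated_uncurry (f := fun (y : Y) (p : ℝ≥0 × S) ↦ γ y p.2) _ ?_
  exact hγ.comp (measurable_fst.prodMk measurable_snd.snd)

variable (hγ : Measurable (Function.uncurry γ)) (hγ2 : ∀ y, MemLp (γ y) 2 ν)

lemma measurable_jumpIntegral :
    Measurable fun p : Y × Measure (ℝ≥0 × S) ↦ jumpIntegral hγ hγ2 s t p.1 p.2 := by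
  have h1 (i : ℕ) : Measurable fun p : Y × Measure (ℝ≥0 × S) ↦ jumpIntegralOn ν s t
      (measurableSet_spanningSets ν (tailIndex hγ hγ2 i p.1)) (γ p.1) p.2 := by
    -- The truncation set varies with `y`, but only through a measurable index with countably many
    -- values.
    let F : ℕ × (Y × Measure (ℝ≥0 × S)) → E := fun q ↦ jumpIntegralOn ν s t
      (measurableSet_spanningSets ν q.1) (γ q.2.1) q.2.2
    have hF : Measurable F := measurable_from_prod_countable_right fun k ↦
      measurable_jumpIntegralOn_uncurry hγ (measurableSet_spanningSets ν k)
    have h3 : Measurable fun p : Y × Measure (ℝ≥0 × S) ↦ (tailIndex hγ hγ2 i p.1, p) :=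
      ((measurable_tailIndex hγ hγ2 i).comp measurable_fst).prodMk measurable_id
    have h4 : Measurable fun p : Y × Measure (ℝ≥0 × S) ↦ F (tailIndex hγ hγ2 i p.1, p) :=
      hF.comp h3
    exact h4
  have h3 := StronglyMeasurable.limUnder (l := atTop) fun i ↦ (h1 i).stronglyMeasurable
  exact h3.measurable

/-- True for all measures and not just almost surely, because each truncated integral is defined
pathwise. Adaptedness of the chain and independence of the past both rest on it. -/
lemma jumpIntegral_congr (y : Y) {n n' : Measure (ℝ≥0 × S)}
    (h : n.restrict (Set.Ioc s t ×ˢ Set.univ) = n'.restrict (Set.Ioc s t ×ˢ Set.univ)) :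
    jumpIntegral hγ hγ2 s t y n = jumpIntegral hγ hγ2 s t y n' := by
  have h1 (i : ℕ) : jumpIntegralOn ν s t (measurableSet_spanningSets ν (tailIndex hγ hγ2 i y))
      (γ y) n = jumpIntegralOn ν s t
        (measurableSet_spanningSets ν (tailIndex hγ hγ2 i y)) (γ y) n' := by
    refine compensated_congr _ _ ?_
    have hsub : Set.Ioc s t ×ˢ spanningSets ν (tailIndex hγ hγ2 i y) ⊆
        Set.Ioc s t ×ˢ Set.univ := Set.prod_mono_right (Set.subset_univ _)
    rw [← Measure.restrict_restrict_of_subset hsub, h, Measure.restrict_restrict_of_subset hsub]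
  simp only [jumpIntegral, h1]

variable {Ω : Type*} [MeasurableSpace Ω] {P : Measure Ω} [IsProbabilityMeasure P]
  {N : Ω → Measure (ℝ≥0 × S)}

/-- `tailIndex` is chosen, separately for each `y`, so that the truncations are Cauchy in `L²` with
summable bounds of order `2⁻ⁱ`. This upgrades `L²` convergence to almost sure convergence. -/
lemma ae_tendsto_jumpIntegral (hN : IsPoissonRandomMeasure P N (timeMeasure.prod ν)) (y : Y) :
    ∀ᵐ ω ∂P, Tendsto (fun i ↦ jumpIntegralOn ν s t
      (measurableSet_spanningSets ν (tailIndex hγ hγ2 i y)) (γ y) (N ω)) atTop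
      (𝓝 (jumpIntegral hγ hγ2 s t y (N ω))) := by
  have hγy : Measurable (γ y) := hγ.comp measurable_prodMk_left
  -- The squared distance beyond index `k` is at most `2 (t - s) 4⁻ᵏ`. The summand `1` makes `2 (t -
  -- s) < C ^ 2` strict, even when `t - s` is zero.
  let C : ℝ≥0∞ := 2 * ENNReal.ofReal (t - s) + 1
  have hC : C ≠ ∞ := by finiteness
  have hC2 : 2 * ENNReal.ofReal (t - s) < C ^ 2 := by
    calc 2 * ENNReal.ofReal (t - s) < C := ENNReal.lt_add_right (by finiteness) one_ne_zero
      _ ≤ C ^ 2 := le_self_pow₀ (le_add_self) two_ne_zero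
  have h1 := Lp.ae_tendsto_of_cauchy_eLpNorm (p := 2) (μ := P) (f := fun i ω ↦ jumpIntegralOn ν s t
    (measurableSet_spanningSets ν (tailIndex hγ hγ2 i y)) (γ y) (N ω))
    (fun i ↦ aestronglyMeasurable_jumpIntegralOn hN _ hγy) one_le_two
    (B := fun i ↦ C * (2⁻¹ : ℝ≥0∞) ^ i) ?_ ?_
  · filter_upwards [h1] with ω ⟨l, hl⟩
    rw [jumpIntegral, hl.limUnder_eq]
    exact hl
  · rw [ENNReal.tsum_mul_left, ENNReal.tsum_geometric]
    refine ENNReal.mul_ne_top hC (ENNReal.inv_ne_top.2 ?_)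
    rw [ENNReal.one_sub_inv_two]
    simp
  · intro k i j hi hj
    refine lt_of_not_ge fun hle ↦ absurd (pow_le_pow_left₀ zero_le hle 2) (not_le.2 ?_)
    rw [eLpNorm_two_sq]
    have h2 := lintegral_sq_jumpIntegralOn_sub_le (s := s) (t := t) hN
      (measurableSet_spanningSets ν (tailIndex hγ hγ2 i y))
      (measure_spanningSets_lt_top ν _).ne
      (measurableSet_spanningSets ν (tailIndex hγ hγ2 j y))
      (measure_spanningSets_lt_top ν _).ne hγy (hγ2 y)
    have h3 (i : ℕ) (hi : k ≤ i) :
        ∫⁻ z in (spanningSets ν (tailIndex hγ hγ2 i y))ᶜ, ‖γ y z‖ₑ ^ 2 ∂ν ≤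
          ((2⁻¹ : ℝ≥0∞) ^ k) ^ 2 := by
      refine (tail_tailIndex_le hγ hγ2 i y).trans (pow_le_pow_left₀ zero_le ?_ 2)
      exact pow_le_pow_right_of_le_one' (by simp) hi
    have hpos : ((2⁻¹ : ℝ≥0∞) ^ k) ^ 2 ≠ 0 :=
      pow_ne_zero _ (pow_ne_zero _ (by simp))
    have hfin : ((2⁻¹ : ℝ≥0∞) ^ k) ^ 2 ≠ ∞ :=
      ENNReal.pow_ne_top (ENNReal.pow_ne_top (by simp))
    calc _ ≤ _ := h2
      _ ≤ ENNReal.ofReal (t - s) * (((2⁻¹ : ℝ≥0∞) ^ k) ^ 2 + ((2⁻¹ : ℝ≥0∞) ^ k) ^ 2) := by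
          gcongr
          · exact h3 i hi
          · exact h3 j hj
      _ = 2 * ENNReal.ofReal (t - s) * ((2⁻¹ : ℝ≥0∞) ^ k) ^ 2 := by ring
      _ < C ^ 2 * ((2⁻¹ : ℝ≥0∞) ^ k) ^ 2 := (ENNReal.mul_lt_mul_iff_left hpos hfin).2 hC2
      _ = (C * (2⁻¹ : ℝ≥0∞) ^ k) ^ 2 := by ring

lemma aestronglyMeasurable_jumpIntegral
    (hN : IsPoissonRandomMeasure P N (timeMeasure.prod ν)) (y : Y) :
    AEStronglyMeasurable (fun ω ↦ jumpIntegral hγ hγ2 s t y (N ω)) P := by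
  have h1 := (measurable_jumpIntegral (s := s) (t := t) hγ hγ2).comp
    (measurable_const.prodMk hN.measurable : Measurable fun ω ↦ (y, N ω))
  exact h1.aestronglyMeasurable

/-- Fatou's lemma along the defining sequence, whose own tails vanish. Since `A` is arbitrary, the
limit does not depend on the exhausting sequence. -/
lemma lintegral_sq_jumpIntegralOn_sub_jumpIntegral_le
    (hN : IsPoissonRandomMeasure P N (timeMeasure.prod ν)) (y : Y) {A : Set S}
    (hA : MeasurableSet A) (hνA : ν A ≠ ∞) :
    ∫⁻ ω, ‖jumpIntegralOn ν s t hA (γ y) (N ω) - jumpIntegral hγ hγ2 s t y (N ω)‖ₑ ^ 2 ∂P ≤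
      ENNReal.ofReal (t - s) * ∫⁻ z in Aᶜ, ‖γ y z‖ₑ ^ 2 ∂ν := by
  have hγy : Measurable (γ y) := hγ.comp measurable_prodMk_left
  let T : ℕ → Ω → E := fun i ω ↦ jumpIntegralOn ν s t
    (measurableSet_spanningSets ν (tailIndex hγ hγ2 i y)) (γ y) (N ω)
  calc ∫⁻ ω, ‖jumpIntegralOn ν s t hA (γ y) (N ω) - jumpIntegral hγ hγ2 s t y (N ω)‖ₑ ^ 2 ∂P
      = ∫⁻ ω, liminf (fun i ↦ ‖jumpIntegralOn ν s t hA (γ y) (N ω) - T i ω‖ₑ ^ 2) atTop ∂P := by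
        refine lintegral_congr_ae ?_
        filter_upwards [ae_tendsto_jumpIntegral (s := s) (t := t) hγ hγ2 hN y] with ω hω
        have h1 : Tendsto (fun i ↦ ‖jumpIntegralOn ν s t hA (γ y) (N ω) - T i ω‖ₑ ^ 2) atTop
            (𝓝 (‖jumpIntegralOn ν s t hA (γ y) (N ω) -
              jumpIntegral hγ hγ2 s t y (N ω)‖ₑ ^ 2)) :=
          ((ENNReal.continuous_pow 2).tendsto _).comp (tendsto_const_nhds.sub hω).enorm
        exact h1.liminf_eq.symm
    _ ≤ liminf (fun i ↦ ∫⁻ ω, ‖jumpIntegralOn ν s t hA (γ y) (N ω) - T i ω‖ₑ ^ 2 ∂P) atTop := by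
        refine lintegral_liminf_le' fun i ↦ AEMeasurable.pow_const ?_ 2
        exact ((aestronglyMeasurable_jumpIntegralOn hN hA hγy).sub
          (aestronglyMeasurable_jumpIntegralOn hN _ hγy)).enorm
    _ ≤ liminf (fun i ↦ ENNReal.ofReal (t - s) *
          (∫⁻ z in Aᶜ, ‖γ y z‖ₑ ^ 2 ∂ν + ((2⁻¹ : ℝ≥0∞) ^ i) ^ 2)) atTop := by
        refine liminf_le_liminf (Eventually.of_forall fun i ↦ ?_)
        refine (lintegral_sq_jumpIntegralOn_sub_le hN hA hνA _
          (measure_spanningSets_lt_top ν _).ne hγy (hγ2 y)).trans ?_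
        gcongr
        exact tail_tailIndex_le hγ hγ2 i y
    _ = _ := by
        refine Tendsto.liminf_eq (ENNReal.Tendsto.const_mul ?_ (Or.inr ENNReal.ofReal_ne_top))
        have h1 : Tendsto (fun i : ℕ ↦ ((2⁻¹ : ℝ≥0∞) ^ i) ^ 2) atTop (𝓝 0) := by
          have h2 : Tendsto (fun i : ℕ ↦ (2⁻¹ : ℝ≥0∞) ^ i) atTop (𝓝 0) :=
            ENNReal.tendsto_pow_atTop_nhds_zero_of_lt_one (by simp)
          simpa using! ((ENNReal.continuous_pow 2).tendsto 0).comp h2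
        simpa using tendsto_const_nhds.add h1

lemma tendsto_eLpNorm_jumpIntegralOn (hN : IsPoissonRandomMeasure P N (timeMeasure.prod ν))
    (y : Y) {A : ℕ → Set S} (hA : Monotone A) (hAm : ∀ k, MeasurableSet (A k))
    (hAf : ∀ k, ν (A k) < ∞) (hAu : (⋃ k, A k) = Set.univ) :
    Tendsto (fun k ↦ eLpNorm ((fun ω ↦ jumpIntegralOn ν s t (hAm k) (γ y) (N ω)) -
      fun ω ↦ jumpIntegral hγ hγ2 s t y (N ω)) 2 P) atTop (𝓝 0) := by
  have hγy : Measurable (γ y) := hγ.comp measurable_prodMk_left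
  have h1 := ENNReal.Tendsto.const_mul (a := ENNReal.ofReal (t - s))
    (tendsto_tail hγy (hγ2 y) hA hAm hAu) (Or.inr ENNReal.ofReal_ne_top)
  rw [mul_zero] at h1
  have h2 : Tendsto (fun k ↦ eLpNorm ((fun ω ↦ jumpIntegralOn ν s t (hAm k) (γ y) (N ω)) -
      fun ω ↦ jumpIntegral hγ hγ2 s t y (N ω)) 2 P ^ 2) atTop (𝓝 0) := by
    refine tendsto_of_tendsto_of_tendsto_of_le_of_le tendsto_const_nhds h1 (fun _ ↦ zero_le)
      fun k ↦ ?_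
    change eLpNorm _ 2 P ^ 2 ≤ _
    rw [eLpNorm_two_sq]
    exact lintegral_sq_jumpIntegralOn_sub_jumpIntegral_le hγ hγ2 hN y (hAm k) (hAf k).ne
  have h3 := (ENNReal.continuous_rpow_const (y := 2⁻¹)).tendsto 0 |>.comp h2
  rw [ENNReal.zero_rpow_of_pos (by norm_num)] at h3
  refine h3.congr fun k ↦ ?_
  rw [Function.comp_apply, ← ENNReal.rpow_natCast, ← ENNReal.rpow_mul]
  norm_num

lemma tendstoInMeasure_jumpIntegralOn (hN : IsPoissonRandomMeasure P N (timeMeasure.prod ν))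
    (y : Y) {A : ℕ → Set S} (hA : Monotone A) (hAm : ∀ k, MeasurableSet (A k))
    (hAf : ∀ k, ν (A k) < ∞) (hAu : (⋃ k, A k) = Set.univ) :
    TendstoInMeasure P (fun k ω ↦ jumpIntegralOn ν s t (hAm k) (γ y) (N ω)) atTop
      (fun ω ↦ jumpIntegral hγ hγ2 s t y (N ω)) :=
  tendstoInMeasure_of_tendsto_eLpNorm two_ne_zero
    (fun _ ↦ aestronglyMeasurable_jumpIntegralOn hN _ (hγ.comp measurable_prodMk_left))
    (aestronglyMeasurable_jumpIntegral hγ hγ2 hN y)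
    (tendsto_eLpNorm_jumpIntegralOn hγ hγ2 hN y hA hAm hAf hAu)

lemma memLp_jumpIntegral (hN : IsPoissonRandomMeasure P N (timeMeasure.prod ν)) (y : Y) :
    MemLp (fun ω ↦ jumpIntegral hγ hγ2 s t y (N ω)) 2 P := by
  have hγy : Measurable (γ y) := hγ.comp measurable_prodMk_left
  have h1 := lintegral_sq_jumpIntegralOn_sub_jumpIntegral_le (s := s) (t := t) hγ hγ2 hN y
    (measurableSet_spanningSets ν 0) (measure_spanningSets_lt_top ν 0).ne
  rw [← eLpNorm_two_sq] at h1
  have h2 : MemLp (fun ω ↦ jumpIntegralOn ν s t (measurableSet_spanningSets ν 0) (γ y) (N ω) -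
      jumpIntegral hγ hγ2 s t y (N ω)) 2 P := by
    refine ⟨(aestronglyMeasurable_jumpIntegralOn hN _ hγy).sub
      (aestronglyMeasurable_jumpIntegral hγ hγ2 hN y), ?_⟩
    have h3 := h1.trans_lt (ENNReal.mul_lt_top ENNReal.ofReal_lt_top
      ((setLIntegral_le_lintegral _ _).trans_lt (lintegral_enorm_sq_ne_top (hγ2 y)).lt_top))
    by_contra h4
    rw [not_lt, top_le_iff] at h4
    rw [h4] at h3
    simp at h3
  have h5 := (memLp_jumpIntegralOn (s := s) (t := t) hN (measurableSet_spanningSets ν 0)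
    (measure_spanningSets_lt_top ν 0).ne hγy (hγ2 y)).sub h2
  refine h5.ae_eq (Eventually.of_forall fun ω ↦ ?_)
  simp

lemma integral_jumpIntegral (hN : IsPoissonRandomMeasure P N (timeMeasure.prod ν)) (y : Y) :
    ∫ ω, jumpIntegral hγ hγ2 s t y (N ω) ∂P = 0 := by
  have hγy : Measurable (γ y) := hγ.comp measurable_prodMk_left
  have h1 := tendsto_eLpNorm_jumpIntegralOn (s := s) (t := t) hγ hγ2 hN y
    (monotone_spanningSets ν) (measurableSet_spanningSets ν) (measure_spanningSets_lt_top ν)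
    (iUnion_spanningSets ν)
  have h2 : Tendsto (fun k ↦ eLpNorm ((fun ω ↦ jumpIntegralOn ν s t
      (measurableSet_spanningSets ν k) (γ y) (N ω)) -
      fun ω ↦ jumpIntegral hγ hγ2 s t y (N ω)) 1 P) atTop (𝓝 0) :=
    tendsto_of_tendsto_of_tendsto_of_le_of_le tendsto_const_nhds h1 (fun _ ↦ zero_le) fun k ↦
      eLpNorm_le_eLpNorm_of_exponent_le one_le_two
        ((aestronglyMeasurable_jumpIntegralOn hN _ hγy).sub
          (aestronglyMeasurable_jumpIntegral hγ hγ2 hN y))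
  have h3 := tendsto_integral_of_L1' (fun ω ↦ jumpIntegral hγ hγ2 s t y (N ω))
    (aestronglyMeasurable_jumpIntegral hγ hγ2 hN y)
    (Eventually.of_forall fun k ↦ (memLp_jumpIntegralOn hN (measurableSet_spanningSets ν k)
      (measure_spanningSets_lt_top ν k).ne hγy (hγ2 y)).integrable one_le_two) h2
  simp only [integral_jumpIntegralOn hN (measurableSet_spanningSets ν _)
    (measure_spanningSets_lt_top ν _).ne hγy (hγ2 y)] at h3
  exact tendsto_nhds_unique h3 tendsto_const_nhds

/-- Truncate both integrals to the same spanning set, where linearity and the `L²` bound hold, then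
pass to the limit in measure. This is how the jump term of the dissipativity condition enters. -/
lemma lintegral_sq_jumpIntegral_sub_le (hN : IsPoissonRandomMeasure P N (timeMeasure.prod ν))
    (y y' : Y) :
    ∫⁻ ω, ‖jumpIntegral hγ hγ2 s t y (N ω) - jumpIntegral hγ hγ2 s t y' (N ω)‖ₑ ^ 2 ∂P ≤
      ENNReal.ofReal (t - s) * ∫⁻ z, ‖γ y z - γ y' z‖ₑ ^ 2 ∂ν := by
  have hγy (y : Y) : Measurable (γ y) := hγ.comp measurable_prodMk_left
  have hT (k : ℕ) (y : Y) := aestronglyMeasurable_jumpIntegralOn (s := s) (t := t) hN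
    (measurableSet_spanningSets ν k) (hγy y)
  have hT' (y : Y) := tendsto_eLpNorm_jumpIntegralOn (s := s) (t := t) hγ hγ2 hN y
    (monotone_spanningSets ν) (measurableSet_spanningSets ν) (measure_spanningSets_lt_top ν)
    (iUnion_spanningSets ν)
  let D : ℕ → Ω → E := fun k ω ↦ jumpIntegralOn ν s t (measurableSet_spanningSets ν k)
    (γ y) (N ω) - jumpIntegralOn ν s t (measurableSet_spanningSets ν k) (γ y') (N ω)
  have hDm (k : ℕ) : AEStronglyMeasurable (D k) P := (hT k y).sub (hT k y')
  have hD : TendstoInMeasure P D atTop (fun ω ↦ jumpIntegral hγ hγ2 s t y (N ω) -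
      jumpIntegral hγ hγ2 s t y' (N ω)) := by
    refine tendstoInMeasure_of_tendsto_eLpNorm two_ne_zero hDm
      ((aestronglyMeasurable_jumpIntegral hγ hγ2 hN y).sub
        (aestronglyMeasurable_jumpIntegral hγ hγ2 hN y')) ?_
    have h1 := (hT' y).add (hT' y')
    rw [add_zero] at h1
    refine tendsto_of_tendsto_of_tendsto_of_le_of_le tendsto_const_nhds h1 (fun _ ↦ zero_le)
      fun k ↦ ?_
    refine le_trans (le_of_eq (congrArg (fun f ↦ eLpNorm f 2 P) ?_)) (eLpNorm_sub_le
      ((hT k y).sub (aestronglyMeasurable_jumpIntegral hγ hγ2 hN y))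
      ((hT k y').sub (aestronglyMeasurable_jumpIntegral hγ hγ2 hN y')) one_le_two)
    ext ω
    simp only [D, Pi.sub_apply]
    abel
  have hbound (k : ℕ) : ∫⁻ ω, ‖D k ω‖ₑ ^ 2 ∂P ≤
      ENNReal.ofReal (t - s) * ∫⁻ z, ‖γ y z - γ y' z‖ₑ ^ 2 ∂ν := by
    have h1 := ae_jumpIntegralOn_sub (s := s) (t := t) hN (measurableSet_spanningSets ν k)
      (measure_spanningSets_lt_top ν k).ne (hγy y) (hγy y') (hγ2 y) (hγ2 y')
    calc ∫⁻ ω, ‖D k ω‖ₑ ^ 2 ∂P = ∫⁻ ω, ‖jumpIntegralOn ν s t (measurableSet_spanningSets ν k)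
          (fun z ↦ γ y z - γ y' z) (N ω)‖ₑ ^ 2 ∂P :=
          lintegral_congr_ae (h1.mono fun ω hω ↦ by simp only [hω, D])
      _ ≤ ENNReal.ofReal (t - s) *
          ∫⁻ z in spanningSets ν k, ‖γ y z - γ y' z‖ₑ ^ 2 ∂ν :=
          lintegral_sq_jumpIntegralOn_le hN _ (measure_spanningSets_lt_top ν k).ne
            ((hγy y).sub (hγy y')) ((hγ2 y).sub (hγ2 y'))
      _ ≤ _ := by gcongr; exact Measure.restrict_le_self
  have hsq (c : ℝ≥0∞) : (c ^ (2⁻¹ : ℝ)) ^ 2 = c := by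
    rw [← ENNReal.rpow_natCast, ← ENNReal.rpow_mul]; norm_num
  rw [← hsq (ENNReal.ofReal (t - s) * _), eLpNorm_two_le_iff_sq]
  refine eLpNorm_le_of_tendstoInMeasure (Eventually.of_forall fun k ↦ ?_) hD hDm
  rw [← eLpNorm_two_le_iff_sq, hsq]
  exact hbound k

lemma map_jumpIntegral_congr (hN : IsPoissonRandomMeasure P N (timeMeasure.prod ν))
    {s' t' : ℝ≥0} (hst : (t : ℝ) - s = t' - s') (y : Y) :
    P.map (fun ω ↦ jumpIntegral hγ hγ2 s t y (N ω)) =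
      P.map (fun ω ↦ jumpIntegral hγ hγ2 s' t' y (N ω)) := by
  have hγy : Measurable (γ y) := hγ.comp measurable_prodMk_left
  have h1 (s t : ℝ≥0) := tendstoInMeasure_jumpIntegralOn (s := s) (t := t) hγ hγ2 hN y
    (monotone_spanningSets ν) (measurableSet_spanningSets ν) (measure_spanningSets_lt_top ν)
    (iUnion_spanningSets ν)
  exact map_eq_of_tendstoInMeasure
    (fun k ↦ (aestronglyMeasurable_jumpIntegralOn hN _ hγy).aemeasurable)
    (fun k ↦ (aestronglyMeasurable_jumpIntegralOn hN _ hγy).aemeasurable)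
    (fun k ↦ map_jumpIntegralOn_congr hN hst _ (measure_spanningSets_lt_top ν k).ne hγy (hγ2 y))
    (h1 s t) (h1 s' t')

end JumpIntegral

/-- Convergence in measure of `f k (y, ξ)` for every `y` implies convergence in measure of
`f k (X, ξ)` when `X` and `ξ` are independent. -/
lemma tendstoInMeasure_of_indepFun {Ω Y Ξ E : Type*} [MeasurableSpace Ω] [MeasurableSpace Y]
    [MeasurableSpace Ξ] [PseudoEMetricSpace E] [MeasurableSpace E] [OpensMeasurableSpace E]
    [SecondCountableTopology E] {P : Measure Ω} [IsProbabilityMeasure P] {X : Ω → Y} {ξ : Ω → Ξ}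
    (hX : AEMeasurable X P) (hξ : AEMeasurable ξ P) (hind : IndepFun X ξ P)
    {f : ℕ → Y → Ξ → E} {g : Y → Ξ → E} (hf : ∀ k, Measurable (Function.uncurry (f k)))
    (hg : Measurable (Function.uncurry g))
    (h : ∀ y, TendstoInMeasure P (fun k ω ↦ f k y (ξ ω)) atTop (fun ω ↦ g y (ξ ω))) :
    TendstoInMeasure P (fun k ω ↦ f k (X ω) (ξ ω)) atTop (fun ω ↦ g (X ω) (ξ ω)) := by
  intro ε hε
  have hprod := (indepFun_iff_map_prod_eq_prod_map_map hX hξ).1 hind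
  have := Measure.isProbabilityMeasure_map hX
  have := Measure.isProbabilityMeasure_map hξ
  let s : ℕ → Set (Y × Ξ) := fun k ↦ {p | ε ≤ edist (f k p.1 p.2) (g p.1 p.2)}
  have hs (k : ℕ) : MeasurableSet (s k) := measurableSet_le measurable_const ((hf k).edist hg)
  -- By independence, the probability of an `ε`-deviation is the average over the law of `X` of the
  -- probabilities with `y` frozen. These are at most `1`, so pointwise convergence in `y` suffices.
  have h1 (k : ℕ) : P {ω | ε ≤ edist (f k (X ω) (ξ ω)) (g (X ω) (ξ ω))} =
      ∫⁻ y, P {ω | ε ≤ edist (f k y (ξ ω)) (g y (ξ ω))} ∂(P.map X) := by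
    have h2 : P {ω | ε ≤ edist (f k (X ω) (ξ ω)) (g (X ω) (ξ ω))} =
        P.map (fun ω ↦ (X ω, ξ ω)) (s k) :=
      (Measure.map_apply_of_aemeasurable (hX.prodMk hξ) (hs k)).symm
    rw [h2, hprod, Measure.prod_apply (hs k)]
    refine lintegral_congr fun y ↦ ?_
    rw [Measure.map_apply_of_aemeasurable hξ (measurable_prodMk_left (hs k))]
    rfl
  simp only [h1]
  have h3 := tendsto_lintegral_of_dominated_convergence (μ := P.map X)
    (F := fun k y ↦ P {ω | ε ≤ edist (f k y (ξ ω)) (g y (ξ ω))}) (f := fun _ ↦ 0)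
    (fun _ ↦ 1) ?_ ?_ ?_ ?_
  · simpa using h3
  · intro k
    have h4 : (fun y ↦ P {ω | ε ≤ edist (f k y (ξ ω)) (g y (ξ ω))}) =
        fun y ↦ (P.map ξ) (Prod.mk y ⁻¹' s k) := by
      ext y
      rw [Measure.map_apply_of_aemeasurable hξ (measurable_prodMk_left (hs k))]
      rfl
    rw [h4]
    exact measurable_measure_prodMk_left (hs k)
  · exact fun k ↦ Eventually.of_forall fun y ↦ prob_le_one
  · simp
  · exact Eventually.of_forall fun y ↦ h y ε hε

/-! ### Jump integrals of integrands known at the initial time -/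

section RandomIntegrand

variable {S : Type*} [MeasurableSpace S] {ν : Measure S} [SigmaFinite ν] {s t : ℝ≥0}
  {Ω : Type*} [MeasurableSpace Ω] {P : Measure Ω} [IsProbabilityMeasure P]
  {N : Ω → Measure (ℝ≥0 × S)} {d : ℕ}

lemma jumpIntegralOn_eq_truncatedIntegral (hst : s ≤ t) {A : Set S} (hA : MeasurableSet A)
    {h : S → EuclideanSpace ℝ (Fin d)} (hh : Measurable h) {n : Measure (ℝ≥0 × S)}
    (hn : n (Set.Ioc s t ×ˢ A) < ∞) :
    jumpIntegralOn ν s t hA h n = truncatedIntegral ν s t A h n := by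
  rw [jumpIntegralOn, compensated_of_lt_top _ _ hn, truncatedIntegral]
  congr 1
  have h1 := integral_map (μ := (timeMeasure.prod ν).restrict (Set.Ioc s t ×ˢ A)) (f := h)
    measurable_snd.aemeasurable hh.aestronglyMeasurable
  rw [map_snd_restrict_prod, integral_smul_measure, ENNReal.toReal_ofReal
    (sub_nonneg.2 (NNReal.coe_le_coe.2 hst))] at h1
  exact h1.symm

lemma isCompensatedIntegral_jumpIntegral {Y : Type*} [MeasurableSpace Y]
    {γ : Y → S → EuclideanSpace ℝ (Fin d)} (hγ : Measurable (Function.uncurry γ))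
    (hγ2 : ∀ y, MemLp (γ y) 2 ν) (hN : IsPoissonRandomMeasure P N (timeMeasure.prod ν))
    (hst : s ≤ t) {Z : Ω → Y} (hZ : Measurable Z)
    (hind : IndepFun Z (fun ω ↦ (N ω).restrict (Set.Ioi s ×ˢ Set.univ)) P) :
    IsCompensatedIntegral P ν N s t (fun ω ↦ γ (Z ω))
      (fun ω ↦ jumpIntegral hγ hγ2 s t (Z ω) (N ω)) := by
  intro A hA hAm hAf hAu
  have hres : MeasurableSet (Set.Ioi s ×ˢ (Set.univ : Set S)) := measurableSet_Ioi.prod .univ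
  -- `Z` may depend on the noise before `s`, so `N` is replaced by its part after `s`, which is
  -- independent of `Z`; integrals over `(s, t]` do not see the change.
  let ξ : Ω → Measure (ℝ≥0 × S) := fun ω ↦ (N ω).restrict (Set.Ioi s ×ˢ Set.univ)
  have hξ : Measurable ξ := (measurable_measure_restrict hres).comp hN.measurable
  have e1 (B : Set S) (hB : MeasurableSet B) (y : Y) (ω : Ω) :
      jumpIntegralOn ν s t hB (γ y) (ξ ω) = jumpIntegralOn ν s t hB (γ y) (N ω) := by
    refine compensated_congr _ _ (Measure.restrict_restrict_of_subset ?_)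
    exact Set.prod_mono (fun r hr ↦ hr.1) (Set.subset_univ _)
  have e2 (y : Y) (ω : Ω) :
      jumpIntegral hγ hγ2 s t y (ξ ω) = jumpIntegral hγ hγ2 s t y (N ω) := by
    refine jumpIntegral_congr hγ hγ2 y (Measure.restrict_restrict_of_subset ?_)
    exact Set.prod_mono (fun r hr ↦ hr.1) (Set.subset_univ _)
  have h1 := tendstoInMeasure_of_indepFun hZ.aemeasurable hξ.aemeasurable hind
    (f := fun k y n ↦ jumpIntegralOn ν s t (hAm k) (γ y) n)
    (g := fun y n ↦ jumpIntegral hγ hγ2 s t y n)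
    (fun k ↦ measurable_jumpIntegralOn_uncurry hγ (hAm k)) (measurable_jumpIntegral hγ hγ2)
    (fun y ↦ by
      simp only [e1, e2]
      exact tendstoInMeasure_jumpIntegralOn hγ hγ2 hN y hA hAm hAf hAu)
  simp only [e1, e2] at h1
  refine h1.congr_left fun k ↦ ?_
  filter_upwards [hN.ae_lt_top (measurableSet_Ioc.prod (hAm k))
    (prod_timeMeasure_ne_top (hAf k).ne)] with ω hω
  exact jumpIntegralOn_eq_truncatedIntegral hst (hAm k) (hγ.comp measurable_prodMk_left) hω

end RandomIntegrand

/-- The vector `A w` in Euclidean space. -/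
noncomputable def mulVecEuclidean {d m : ℕ} (A : Matrix (Fin d) (Fin m) ℝ)
    (w : EuclideanSpace ℝ (Fin m)) : EuclideanSpace ℝ (Fin d) :=
  WithLp.toLp 2 (A.mulVec w.ofLp)

lemma mulVecEuclidean_apply {d m : ℕ} (A : Matrix (Fin d) (Fin m) ℝ)
    (w : EuclideanSpace ℝ (Fin m)) (i : Fin d) : mulVecEuclidean A w i = ∑ j, A i j * w j := rfl

lemma mulVecEuclidean_sub {d m : ℕ} (A A' : Matrix (Fin d) (Fin m) ℝ)
    (w : EuclideanSpace ℝ (Fin m)) :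
    mulVecEuclidean (A - A') w = mulVecEuclidean A w - mulVecEuclidean A' w := by
  rw [mulVecEuclidean, Matrix.sub_mulVec]
  rfl

lemma measurable_mulVecEuclidean {d m : ℕ} {X : Type*} [MeasurableSpace X]
    {A : X → Matrix (Fin d) (Fin m) ℝ} (hA : ∀ i j, Measurable fun x ↦ A x i j)
    {w : X → EuclideanSpace ℝ (Fin m)} (hw : Measurable w) :
    Measurable fun x ↦ mulVecEuclidean (A x) (w x) := by
  refine (WithLp.measurable_toLp 2 _).comp (measurable_pi_lambda _ fun i ↦ ?_)
  have h1 : Measurable fun x ↦ ∑ j, A x i j * w x j :=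
    Finset.measurable_fun_sum _ fun j _ ↦ (hA i j).mul
      ((measurable_pi_apply j).comp ((WithLp.measurable_ofLp 2 _).comp hw))
  exact h1

/-! ### Gaussian increments of the Wiener process -/

namespace IsJumpDiffusionNoise

variable {Ω S : Type*} [mΩ : MeasurableSpace Ω] [MeasurableSpace S] {m : ℕ}
  {P : Measure Ω} [IsProbabilityMeasure P] {ℱ : Filtration ℝ≥0 mΩ} {ν : Measure S}
  {W : ℝ≥0 → Ω → EuclideanSpace ℝ (Fin m)} {N : Ω → Measure (ℝ≥0 × S)} {s t : ℝ≥0}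

lemma measurable_W (h : IsJumpDiffusionNoise P ℱ ν W N) (t : ℝ≥0) : Measurable (W t) :=
  (h.adapted_W t).mono (ℱ.le t) le_rfl

lemma measurable_increment_apply (h : IsJumpDiffusionNoise P ℱ ν W N) (s t : ℝ≥0) (i : Fin m) :
    Measurable fun ω ↦ (W t ω - W s ω) i :=
  (measurable_pi_apply i).comp ((WithLp.measurable_ofLp 2 _).comp
    ((h.measurable_W t).sub (h.measurable_W s)))

lemma hasLaw_increment_apply (h : IsJumpDiffusionNoise P ℱ ν W N) (hst : s ≤ t) (i : Fin m) :
    HasLaw (fun ω ↦ (W t ω - W s ω) i) (gaussianReal 0 (t - s)) P := by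
  have h1 := (h.brownian i).hasLaw_sub t s
  have h2 : nndist (t : ℝ) (s : ℝ) = t - s := by
    ext
    rw [coe_nndist, Real.dist_eq, abs_of_nonneg (sub_nonneg.2 (NNReal.coe_le_coe.2 hst)),
      NNReal.coe_sub hst]
  rw [← h2]
  exact h1

lemma iIndepFun_increment (h : IsJumpDiffusionNoise P ℱ ν W N) (s t : ℝ≥0) :
    iIndepFun (fun (i : Fin m) ω ↦ (W t ω - W s ω) i) P :=
  h.brownian_indep.comp (fun _ f ↦ f t - f s)
    fun _ ↦ (measurable_pi_apply t).sub (measurable_pi_apply s)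

lemma map_increment (h : IsJumpDiffusionNoise P ℱ ν W N) (hst : s ≤ t) :
    P.map (fun ω ↦ W t ω - W s ω) =
      (Measure.pi fun _ : Fin m ↦ gaussianReal 0 (t - s)).map (WithLp.toLp 2) := by
  have h1 := (iIndepFun_iff_map_fun_eq_pi_map
    fun i ↦ (h.measurable_increment_apply s t i).aemeasurable).1 (h.iIndepFun_increment s t)
  simp only [(h.hasLaw_increment_apply hst _).map_eq] at h1
  rw [← h1, Measure.map_map (WithLp.measurable_toLp 2 _)
    (measurable_pi_lambda _ fun i ↦ h.measurable_increment_apply s t i)]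
  rfl

lemma memLp_increment_apply (h : IsJumpDiffusionNoise P ℱ ν W N) (hst : s ≤ t) (i : Fin m) :
    MemLp (fun ω ↦ (W t ω - W s ω) i) 2 P := by
  have h1 := memLp_id_gaussianReal' (μ := 0) (v := t - s) 2 (by simp)
  rw [← (h.hasLaw_increment_apply hst i).map_eq] at h1
  exact (memLp_map_measure_iff h1.1 (h.measurable_increment_apply s t i).aemeasurable).1 h1

lemma integral_increment_apply (h : IsJumpDiffusionNoise P ℱ ν W N) (hst : s ≤ t) (i : Fin m) :
    ∫ ω, (W t ω - W s ω) i ∂P = 0 := by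
  rw [(h.hasLaw_increment_apply hst i).integral_eq, integral_id_gaussianReal]

lemma integral_increment_mul (h : IsJumpDiffusionNoise P ℱ ν W N) (hst : s ≤ t) (i j : Fin m) :
    ∫ ω, (W t ω - W s ω) i * (W t ω - W s ω) j ∂P = if i = j then (t : ℝ) - s else 0 := by
  have hm (i : Fin m) : AEStronglyMeasurable (fun ω ↦ (W t ω - W s ω) i) P :=
    (h.measurable_increment_apply s t i).aestronglyMeasurable
  split_ifs with hij
  · subst hij
    have h1 := (h.hasLaw_increment_apply hst i).variance_eq
    rw [variance_id_gaussianReal, variance_of_integral_eq_zero (hm i).aemeasurable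
      (h.integral_increment_apply hst i), NNReal.coe_sub hst] at h1
    rw [← h1]
    simp only [sq]
  · rw [((h.iIndepFun_increment s t).indepFun hij).integral_fun_mul_eq_mul_integral (hm i) (hm j),
      h.integral_increment_apply hst i, zero_mul]

variable {d : ℕ}

lemma memLp_mulVec_increment (h : IsJumpDiffusionNoise P ℱ ν W N) (hst : s ≤ t)
    (A : Matrix (Fin d) (Fin m) ℝ) :
    MemLp (fun ω ↦ mulVecEuclidean A (W t ω - W s ω)) 2 P := by
  refine MemLp.of_eval_piLp fun i ↦ ?_
  simp only [mulVecEuclidean_apply]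
  exact memLp_finsetSum _ fun j _ ↦ (h.memLp_increment_apply hst j).const_mul _

lemma integral_mulVec_increment (h : IsJumpDiffusionNoise P ℱ ν W N) (hst : s ≤ t)
    (A : Matrix (Fin d) (Fin m) ℝ) :
    ∫ ω, mulVecEuclidean A (W t ω - W s ω) ∂P = 0 := by
  ext i
  rw [eval_integral_piLp fun i ↦
    ((h.memLp_mulVec_increment hst A).eval_piLp i).integrable one_le_two]
  simp only [mulVecEuclidean_apply]
  rw [integral_finsetSum _ fun j _ ↦
    ((h.memLp_increment_apply hst j).integrable one_le_two).const_mul _]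
  simp only [integral_const_mul, h.integral_increment_apply hst]
  simp

lemma integral_norm_sq_mulVec_increment (h : IsJumpDiffusionNoise P ℱ ν W N) (hst : s ≤ t)
    (A : Matrix (Fin d) (Fin m) ℝ) :
    ∫ ω, ‖mulVecEuclidean A (W t ω - W s ω)‖ ^ 2 ∂P = ((t : ℝ) - s) * hsNormSq A := by
  have h1 (ω : Ω) : ‖mulVecEuclidean A (W t ω - W s ω)‖ ^ 2 = ∑ i, ∑ j, ∑ k,
      A i j * A i k * ((W t ω - W s ω) j * (W t ω - W s ω) k) := by
    rw [EuclideanSpace.norm_sq_eq]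
    refine Finset.sum_congr rfl fun i _ ↦ ?_
    rw [mulVecEuclidean_apply, Real.norm_eq_abs, sq_abs, sq, Finset.sum_mul_sum]
    refine Finset.sum_congr rfl fun j _ ↦ Finset.sum_congr rfl fun k _ ↦ ?_
    ring
  have hint (i : Fin d) (j k : Fin m) : Integrable (fun ω ↦
      A i j * A i k * ((W t ω - W s ω) j * (W t ω - W s ω) k)) P :=
    ((h.memLp_increment_apply hst j).integrable_mul (h.memLp_increment_apply hst k)).const_mul _
  simp only [h1]
  rw [integral_finsetSum _ fun i _ ↦ integrable_finsetSum _ fun j _ ↦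
    integrable_finsetSum _ fun k _ ↦ hint i j k, hsNormSq, Finset.mul_sum]
  refine Finset.sum_congr rfl fun i _ ↦ ?_
  rw [integral_finsetSum _ fun j _ ↦ integrable_finsetSum _ fun k _ ↦ hint i j k, Finset.mul_sum]
  refine Finset.sum_congr rfl fun j _ ↦ ?_
  rw [integral_finsetSum _ fun k _ ↦ hint i j k]
  simp only [integral_const_mul, h.integral_increment_mul hst]
  simp
  ring

end IsJumpDiffusionNoise

/-- Pythagoras' theorem for independent centered random vectors. -/
lemma integral_norm_sq_add_add {Ω E : Type*} [MeasurableSpace Ω] {P : Measure Ω}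
    [IsProbabilityMeasure P] [NormedAddCommGroup E] [InnerProductSpace ℝ E] [CompleteSpace E]
    [SecondCountableTopology E]
    [MeasurableSpace E] [BorelSpace E] (a : E) {U V : Ω → E} (hU : MemLp U 2 P) (hV : MemLp V 2 P)
    (hU0 : ∫ ω, U ω ∂P = 0) (hV0 : ∫ ω, V ω ∂P = 0) (hUV : IndepFun U V P) :
    ∫ ω, ‖a + U ω + V ω‖ ^ 2 ∂P =
      ‖a‖ ^ 2 + ∫ ω, ‖U ω‖ ^ 2 ∂P + ∫ ω, ‖V ω‖ ^ 2 ∂P := by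
  have hUi := hU.integrable one_le_two
  have hVi := hV.integrable one_le_two
  have h1 (ω : Ω) : ‖a + U ω + V ω‖ ^ 2 = ‖a‖ ^ 2 + ‖U ω‖ ^ 2 + ‖V ω‖ ^ 2 +
      2 * (inner ℝ a (U ω) + inner ℝ a (V ω) + inner ℝ (U ω) (V ω)) := by
    rw [norm_add_sq_real, norm_add_sq_real, inner_add_left]
    ring
  have hUV0 : ∫ ω, inner ℝ (U ω) (V ω) ∂P = 0 := by
    have h2 := hUV.integral_bilin hUi hVi (innerSL ℝ)
    rw [hU0, map_zero] at h2
    exact h2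
  have i0 : Integrable (fun _ : Ω ↦ ‖a‖ ^ 2) P := integrable_const _
  have i1 : Integrable (fun ω ↦ ‖U ω‖ ^ 2) P := hU.integrable_norm_pow two_ne_zero
  have i2 : Integrable (fun ω ↦ ‖V ω‖ ^ 2) P := hV.integrable_norm_pow two_ne_zero
  have i3 : Integrable (fun ω ↦ inner ℝ (U ω) (V ω)) P :=
    (hU.norm.integrable_mul hV.norm).mono' (hUi.1.inner hVi.1)
      (Eventually.of_forall fun ω ↦ norm_inner_le_norm _ _)
  have i4 : Integrable (fun ω ↦ inner ℝ a (U ω)) P := hUi.const_inner a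
  have i5 : Integrable (fun ω ↦ inner ℝ a (V ω)) P := hVi.const_inner a
  have i01 : Integrable (fun ω ↦ ‖a‖ ^ 2 + ‖U ω‖ ^ 2) P := i0.add i1
  have i012 : Integrable (fun ω ↦ ‖a‖ ^ 2 + ‖U ω‖ ^ 2 + ‖V ω‖ ^ 2) P := i01.add i2
  have i45 : Integrable (fun ω ↦ inner ℝ a (U ω) + inner ℝ a (V ω)) P := i4.add i5
  have i453 : Integrable (fun ω ↦ inner ℝ a (U ω) + inner ℝ a (V ω) + inner ℝ (U ω) (V ω)) P :=
    i45.add i3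
  simp only [h1]
  rw [integral_add i012 (i453.const_mul 2), integral_add i01 i2, integral_add i0 i1,
    integral_const_mul, integral_add i45 i3, integral_add i4 i5, hUV0,
    integral_inner hUi, integral_inner hVi, hU0, hV0]
  simp

/-- The kernel sending `y` to the law of the random point `F y`. -/
noncomputable def randomMapKernel {Ω Y E : Type*} [MeasurableSpace Ω] [MeasurableSpace Y]
    [MeasurableSpace E] (P : Measure Ω) [SFinite P] {F : Y → Ω → E}
    (hF : Measurable (Function.uncurry F)) : Kernel Y E where
  toFun y := P.map (F y)
  measurable' := by
    refine Measure.measurable_of_measurable_coe _ fun B hB ↦ ?_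
    have h1 (y : Y) : P.map (F y) B = P (Prod.mk y ⁻¹' (Function.uncurry F ⁻¹' B)) :=
      Measure.map_apply (hF.comp measurable_prodMk_left) hB
    simp only [h1]
    exact measurable_measure_prodMk_left (hF hB)

lemma randomMapKernel_apply {Ω Y E : Type*} [MeasurableSpace Ω] [MeasurableSpace Y]
    [MeasurableSpace E] (P : Measure Ω) [SFinite P] {F : Y → Ω → E}
    (hF : Measurable (Function.uncurry F)) (y : Y) :
    randomMapKernel P hF y = P.map (F y) := rfl

instance {Ω Y E : Type*} [MeasurableSpace Ω] [MeasurableSpace Y]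
    [MeasurableSpace E] (P : Measure Ω) [IsProbabilityMeasure P] {F : Y → Ω → E}
    (hF : Measurable (Function.uncurry F)) : IsMarkovKernel (randomMapKernel P hF) where
  isProbabilityMeasure _ :=
    Measure.isProbabilityMeasure_map (hF.comp measurable_prodMk_left).aemeasurable

lemma sq_integral_le_integral_sq {Ω : Type*} [MeasurableSpace Ω] {P : Measure Ω}
    [IsProbabilityMeasure P] {X : Ω → ℝ} (hX : MemLp X 2 P) :
    (∫ ω, X ω ∂P) ^ 2 ≤ ∫ ω, X ω ^ 2 ∂P := by
  have h1 := variance_eq_sub hX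
  have h2 := variance_nonneg X P
  simp only [Pi.pow_apply] at h1
  linarith

/-- A random map which is a mean square contraction, measured through `G`, defines a contractive
kernel. -/
lemma isContractiveVia_randomMapKernel {Ω E : Type*} [MeasurableSpace Ω] {P : Measure Ω}
    [IsProbabilityMeasure P] [NormedAddCommGroup E] [MeasurableSpace E] [BorelSpace E]
    {G : E → E} (hG : Continuous G) {r : ℝ} (hr : 0 ≤ r) {F : E → Ω → E}
    (hF : Measurable (Function.uncurry F)) (hF2 : ∀ x, MemLp (fun ω ↦ G (F x ω)) 2 P)
    (h : ∀ x y, ∫ ω, ‖G (F x ω) - G (F y ω)‖ ^ 2 ∂P ≤ (r * ‖G x - G y‖) ^ 2) :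
    IsContractiveVia G r (randomMapKernel P hF) := by
  intro f K hK hf
  have hfc : Continuous f := hf.continuous hG
  have hFm (x : E) : Measurable (F x) := hF.comp measurable_prodMk_left
  have hint (x : E) : Integrable (fun ω ↦ f (F x ω)) P := by
    have h1 : Integrable (fun ω ↦ |f x| + K * ‖G (F x ω) - G x‖) P :=
      (integrable_const _).add
        ((((hF2 x).sub (memLp_const (G x))).integrable one_le_two).norm.const_mul K)
    refine h1.mono' (hfc.measurable.comp (hFm x)).aestronglyMeasurable
      (Eventually.of_forall fun ω ↦ ?_)
    have h2 := hf (F x ω) x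
    have h3 := abs_sub_abs_le_abs_sub (f (F x ω)) (f x)
    rw [Real.norm_eq_abs]
    linarith
  refine ⟨fun x ↦ ?_, fun x y ↦ ?_⟩
  · rw [randomMapKernel_apply, integrable_map_measure hfc.aestronglyMeasurable
      (hFm x).aemeasurable]
    exact hint x
  · simp only [randomMapKernel_apply]
    rw [integral_map (hFm x).aemeasurable hfc.aestronglyMeasurable,
      integral_map (hFm y).aemeasurable hfc.aestronglyMeasurable,
      ← integral_sub (hint x) (hint y)]
    have h1 : MemLp (fun ω ↦ ‖G (F x ω) - G (F y ω)‖) 2 P := ((hF2 x).sub (hF2 y)).norm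
    -- The same `ω` drives both images, which couples `κ x` and `κ y`; Jensen turns the mean square
    -- bound into a bound on the mean.
    have h2 : ∫ ω, ‖G (F x ω) - G (F y ω)‖ ∂P ≤ r * ‖G x - G y‖ :=
      le_of_sq_le_sq ((sq_integral_le_integral_sq h1).trans (h x y)) (by positivity)
    calc |∫ ω, f (F x ω) - f (F y ω) ∂P|
        ≤ ∫ ω, |f (F x ω) - f (F y ω)| ∂P := abs_integral_le_integral_abs
      _ ≤ ∫ ω, K * ‖G (F x ω) - G (F y ω)‖ ∂P := by
          refine integral_mono ((hint x).sub (hint y)).abs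
            ((h1.integrable one_le_two).const_mul K) fun ω ↦ hf _ _
      _ = K * ∫ ω, ‖G (F x ω) - G (F y ω)‖ ∂P := integral_const_mul _ _
      _ ≤ K * (r * ‖G x - G y‖) := mul_le_mul_of_nonneg_left h2 hK
      _ = K * r * ‖G x - G y‖ := by ring

/-- The algebraic inequality behind the contractivity of the stochastic theta method. -/
lemma theta_contraction {E : Type*} [NormedAddCommGroup E] [InnerProductSpace ℝ E] (D B : E)
    {L θ τ h q : ℝ} (hL : 0 < L) (hθ : 1 / 2 < θ) (hθ' : θ ≤ 1) (hτ : 0 < τ)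
    (hLτ : L * θ ^ 2 * τ ≤ 3 - 2 * θ) (hdiss : 2 * inner ℝ D B + h + q ≤ -L * ‖D‖ ^ 2) :
    ‖D + ((1 - θ) * τ) • B‖ ^ 2 + τ * h + τ * q ≤
      Real.exp (-((θ - 1 / 2) * L * τ)) * ‖D - (θ * τ) • B‖ ^ 2 := by
  have e1 : ‖D + ((1 - θ) * τ) • B‖ ^ 2 =
      ‖D‖ ^ 2 + 2 * ((1 - θ) * τ) * inner ℝ D B + ((1 - θ) * τ) ^ 2 * ‖B‖ ^ 2 := by
    rw [norm_add_sq_real, real_inner_smul_right, norm_smul, mul_pow, Real.norm_eq_abs, sq_abs]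
    ring
  have e2 : ‖D - (θ * τ) • B‖ ^ 2 =
      ‖D‖ ^ 2 - 2 * (θ * τ) * inner ℝ D B + (θ * τ) ^ 2 * ‖B‖ ^ 2 := by
    rw [norm_sub_sq_real, real_inner_smul_right, norm_smul, mul_pow, Real.norm_eq_abs, sq_abs]
    ring
  have e3 : ‖(3 / 2 - θ) • D + ((θ - 1 / 2) * θ * τ) • B‖ ^ 2 = (3 / 2 - θ) ^ 2 * ‖D‖ ^ 2 +
      2 * ((3 / 2 - θ) * ((θ - 1 / 2) * θ * τ)) * inner ℝ D B +
        ((θ - 1 / 2) * θ * τ) ^ 2 * ‖B‖ ^ 2 := by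
    rw [norm_add_sq_real, real_inner_smul_right, real_inner_smul_left, norm_smul, norm_smul,
      mul_pow, mul_pow, Real.norm_eq_abs, Real.norm_eq_abs, sq_abs, sq_abs]
    ring
  have h1 : 1 - (θ - 1 / 2) * L * τ ≤ Real.exp (-((θ - 1 / 2) * L * τ)) := by
    have := Real.add_one_le_exp (-((θ - 1 / 2) * L * τ))
    linarith
  refine le_trans ?_ (mul_le_mul_of_nonneg_right h1 (sq_nonneg _))
  -- The two squared norms differ by `2 τ ⟨D, B⟩ - (2 θ - 1) τ² ‖B‖²`, and `τ` times dissipativity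
  -- absorbs the inner product together with `h` and `q`.
  have h2 : ‖D + ((1 - θ) * τ) • B‖ ^ 2 + τ * h + τ * q ≤
      ‖D - (θ * τ) • B‖ ^ 2 - L * τ * ‖D‖ ^ 2 - (2 * θ - 1) * τ ^ 2 * ‖B‖ ^ 2 := by
    have := mul_le_mul_of_nonneg_left hdiss hτ.le
    rw [e1, e2]
    linarith
  refine h2.trans ?_
  have h3 : 0 ≤ (3 / 2 - θ) * (L * τ * ‖D‖ ^ 2 + (2 * θ - 1) * τ ^ 2 * ‖B‖ ^ 2 -
      (θ - 1 / 2) * L * τ * ‖D - (θ * τ) • B‖ ^ 2) := by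
    -- Completing the square in `D`, after multiplication by the positive number `3 / 2 - θ` to
    -- clear denominators. The remaining `‖B‖ ^ 2` term is nonnegative exactly because of the step
    -- size condition.
    have h4 : (3 / 2 - θ) * (L * τ * ‖D‖ ^ 2 + (2 * θ - 1) * τ ^ 2 * ‖B‖ ^ 2 -
        (θ - 1 / 2) * L * τ * ‖D - (θ * τ) • B‖ ^ 2) =
        L * τ * ‖(3 / 2 - θ) • D + ((θ - 1 / 2) * θ * τ) • B‖ ^ 2 +
          (θ - 1 / 2) * τ ^ 2 * ‖B‖ ^ 2 * ((3 - 2 * θ) - L * θ ^ 2 * τ) := by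
      rw [e2, e3]
      ring
    rw [h4]
    have h5 : 0 ≤ (3 - 2 * θ) - L * θ ^ 2 * τ := by linarith
    have h6 : 0 ≤ θ - 1 / 2 := by linarith
    positivity
  have h7 := nonneg_of_mul_nonneg_right h3 (by linarith : 0 < 3 / 2 - θ)
  linarith

/-! ### Inverting the implicit part of a step -/

section ImplicitMap

variable {S : Type*} [MeasurableSpace S] {d m : ℕ}

lemma hsNormSq_nonneg (A : Matrix (Fin d) (Fin m) ℝ) : 0 ≤ hsNormSq A :=
  Finset.sum_nonneg fun _ _ ↦ Finset.sum_nonneg fun _ _ ↦ sq_nonneg _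

/-- The map `x ↦ x - θ τ b(x)` which has to be inverted in a step of the stochastic theta method. -/
noncomputable def Coefficients.implicitMap (c : Coefficients d m S) (θ τ : ℝ)
    (x : EuclideanSpace ℝ (Fin d)) : EuclideanSpace ℝ (Fin d) := x - (θ * τ) • c.b x

variable {c : Coefficients d m S} {ν : Measure S} {L θ τ : ℝ}

/-- Dropping the nonnegative `σ` and `γ` terms leaves `⟨x - y, b(x) - b(y)⟩ ≤ 0`, so subtracting `θ
τ b` only increases the inner product. The factor `1` matches the form of
`surjective_of_strongly_monotone`. -/
lemma Coefficients.StrictlyDissipative.norm_sq_le_inner (hdiss : c.StrictlyDissipative ν L)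
    (hL : 0 < L) (hθ : 0 ≤ θ) (hτ : 0 ≤ τ) (x y : EuclideanSpace ℝ (Fin d)) :
    1 * ‖x - y‖ ^ 2 ≤ inner ℝ (x - y) (c.implicitMap θ τ x - c.implicitMap θ τ y) := by
  have h1 := hdiss x y
  have h2 := hsNormSq_nonneg (c.σ x - c.σ y)
  have h3 : 0 ≤ ∫ z, ‖c.γ x z - c.γ y z‖ ^ 2 ∂ν := integral_nonneg fun _ ↦ sq_nonneg _
  have h4 : 0 ≤ L * ‖x - y‖ ^ 2 := by positivity
  have h5 : inner ℝ (x - y) (c.b x - c.b y) ≤ 0 := by linarith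
  have h6 : c.implicitMap θ τ x - c.implicitMap θ τ y = (x - y) - (θ * τ) • (c.b x - c.b y) := by
    simp only [Coefficients.implicitMap, smul_sub]
    abel
  rw [h6, inner_sub_right, real_inner_smul_right, real_inner_self_eq_norm_sq]
  nlinarith [mul_nonneg hθ hτ]

lemma Coefficients.continuous_implicitMap (hb : Continuous c.b) :
    Continuous (c.implicitMap θ τ) := by
  unfold Coefficients.implicitMap
  fun_prop

lemma Coefficients.StrictlyDissipative.norm_sub_le (hdiss : c.StrictlyDissipative ν L)
    (hL : 0 < L) (hθ : 0 ≤ θ) (hτ : 0 ≤ τ) (x y : EuclideanSpace ℝ (Fin d)) :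
    ‖x - y‖ ≤ ‖c.implicitMap θ τ x - c.implicitMap θ τ y‖ := by
  simpa using mul_norm_sub_le_of_strongly_monotone (hdiss.norm_sq_le_inner hL hθ hτ) x y

lemma Coefficients.StrictlyDissipative.exists_inverse (hdiss : c.StrictlyDissipative ν L)
    (hb : Continuous c.b) (hL : 0 < L) (hθ : 0 ≤ θ) (hτ : 0 ≤ τ) :
    ∃ g : EuclideanSpace ℝ (Fin d) → EuclideanSpace ℝ (Fin d), Measurable g ∧
      Function.LeftInverse g (c.implicitMap θ τ) ∧ Function.RightInverse g (c.implicitMap θ τ) := by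
  have hle := hdiss.norm_sub_le (c := c) hL hθ hτ
  have hsurj := surjective_of_strongly_monotone one_pos (hdiss.norm_sq_le_inner hL hθ hτ)
    (c.continuous_implicitMap hb)
  obtain ⟨g, hg⟩ := hsurj.hasRightInverse
  refine ⟨g, ?_, fun x ↦ ?_, hg⟩
  · have h1 : LipschitzWith 1 g := LipschitzWith.of_dist_le_mul fun x y ↦ by
      simpa [dist_eq_norm, hg x, hg y] using hle (g x) (g y)
    exact h1.continuous.measurable
  · have h1 := hle (g (c.implicitMap θ τ x)) x
    rw [hg, sub_self, norm_zero] at h1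
    exact sub_eq_zero.1 (norm_le_zero_iff.1 h1)

end ImplicitMap

lemma measurable_jumpIntegral_right {S Y E : Type*} [MeasurableSpace S] {ν : Measure S}
    [SigmaFinite ν] {s t : ℝ≥0} [MeasurableSpace Y] [NormedAddCommGroup E] [InnerProductSpace ℝ E]
    [CompleteSpace E] [SecondCountableTopology E] [MeasurableSpace E] [BorelSpace E]
    {γ : Y → S → E} (hγ : Measurable (Function.uncurry γ)) (hγ2 : ∀ y, MemLp (γ y) 2 ν) (y : Y) :
    Measurable fun n : Measure (ℝ≥0 × S) ↦ jumpIntegral hγ hγ2 s t y n :=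
  Measurable.comp (g := fun p : Y × Measure (ℝ≥0 × S) ↦ jumpIntegral hγ hγ2 s t p.1 p.2)
    (f := fun n : Measure (ℝ≥0 × S) ↦ (y, n)) (measurable_jumpIntegral hγ hγ2)
    measurable_prodMk_left

lemma measurable_mulVecEuclidean_right {d m : ℕ} (A : Matrix (Fin d) (Fin m) ℝ) :
    Measurable (mulVecEuclidean A) :=
  measurable_mulVecEuclidean (A := fun _ ↦ A) (fun _ _ ↦ measurable_const) measurable_id

/-! ### The explicit part of a step -/

section ExplicitPart

variable {Ω S : Type*} [mΩ : MeasurableSpace Ω] [MeasurableSpace S] {d m : ℕ}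
  {P : Measure Ω} [IsProbabilityMeasure P] {ℱ : Filtration ℝ≥0 mΩ} {ν : Measure S} [SigmaFinite ν]
  {W : ℝ≥0 → Ω → EuclideanSpace ℝ (Fin m)} {N : Ω → Measure (ℝ≥0 × S)}
  {c : Coefficients d m S} {L θ : ℝ} {τ s t s' t' : ℝ≥0}

/-- The explicit part `y + (1 - θ) τ b(y) + σ(y) w + ∫_s^t ∫ γ(y, z) Ñ(dr, dz)` of a step of the
stochastic theta method. -/
noncomputable def explicitPart (hc : c.Admissible ν) (θ : ℝ) (τ s t : ℝ≥0)
    (y : EuclideanSpace ℝ (Fin d)) (p : EuclideanSpace ℝ (Fin m) × Measure (ℝ≥0 × S)) :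
    EuclideanSpace ℝ (Fin d) :=
  y + ((1 - θ) * τ) • c.b y + mulVecEuclidean (c.σ y) p.1
    + jumpIntegral hc.measurable_γ hc.memLp_γ s t y p.2

lemma measurable_explicitPart (hc : c.Admissible ν) :
    Measurable fun q : EuclideanSpace ℝ (Fin d) ×
      (EuclideanSpace ℝ (Fin m) × Measure (ℝ≥0 × S)) ↦ explicitPart hc θ τ s t q.1 q.2 := by
  have h1 : Measurable fun q : EuclideanSpace ℝ (Fin d) ×
      (EuclideanSpace ℝ (Fin m) × Measure (ℝ≥0 × S)) ↦ mulVecEuclidean (c.σ q.1) q.2.1 :=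
    measurable_mulVecEuclidean (fun i j ↦ (hc.measurable_σ i j).comp measurable_fst)
      measurable_snd.fst
  have h2 := (measurable_jumpIntegral (s := s) (t := t) hc.measurable_γ hc.memLp_γ).comp
    (measurable_fst.prodMk measurable_snd.snd : Measurable fun q : EuclideanSpace ℝ (Fin d) ×
      (EuclideanSpace ℝ (Fin m) × Measure (ℝ≥0 × S)) ↦ (q.1, q.2.2))
  have h3 : Measurable fun q : EuclideanSpace ℝ (Fin d) ×
      (EuclideanSpace ℝ (Fin m) × Measure (ℝ≥0 × S)) ↦ q.1 + ((1 - θ) * τ) • c.b q.1 :=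
    measurable_fst.add ((hc.measurable_b.comp measurable_fst).const_smul ((1 - θ) * (τ : ℝ)))
  exact (h3.add h1).add h2

/-- A step reads `N` only over `(s, t]`. Below, `I` is the past of `t` for adaptedness and the
future of `s` for independence. -/
lemma explicitPart_congr (hc : c.Admissible ν) (y : EuclideanSpace ℝ (Fin d))
    (w : EuclideanSpace ℝ (Fin m)) {n : Measure (ℝ≥0 × S)} {I : Set ℝ≥0}
    (hI : Set.Ioc s t ⊆ I) :
    explicitPart hc θ τ s t y (w, n.restrict (I ×ˢ Set.univ)) =
      explicitPart hc θ τ s t y (w, n) := by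
  unfold explicitPart
  rw [jumpIntegral_congr hc.measurable_γ hc.memLp_γ y
    (Measure.restrict_restrict_of_subset (Set.prod_mono hI (Set.subset_univ _)))]

namespace IsJumpDiffusionNoise

/-- The increment of `W` over `(s, t]` together with the random measure `N`. -/
def noiseOn (_h : IsJumpDiffusionNoise P ℱ ν W N) (s t : ℝ≥0) (ω : Ω) :
    EuclideanSpace ℝ (Fin m) × Measure (ℝ≥0 × S) := (W t ω - W s ω, N ω)

lemma measurable_noiseOn (h : IsJumpDiffusionNoise P ℱ ν W N) (s t : ℝ≥0) :
    Measurable (h.noiseOn s t) :=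
  ((h.measurable_W t).sub (h.measurable_W s)).prodMk h.poisson.measurable

lemma indepFun_increment (h : IsJumpDiffusionNoise P ℱ ν W N) (s t : ℝ≥0) :
    IndepFun (fun ω ↦ W t ω - W s ω) N P :=
  h.indep.comp (φ := fun f : ℝ≥0 → EuclideanSpace ℝ (Fin m) ↦ f t - f s) (ψ := id)
    ((measurable_pi_apply t).sub (measurable_pi_apply s)) measurable_id

lemma memLp_explicitPart (h : IsJumpDiffusionNoise P ℱ ν W N) (hc : c.Admissible ν) (hst : s ≤ t)
    (y : EuclideanSpace ℝ (Fin d)) :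
    MemLp (fun ω ↦ explicitPart hc θ τ s t y (h.noiseOn s t ω)) 2 P :=
  ((memLp_const (y + ((1 - θ) * (τ : ℝ)) • c.b y)).add (h.memLp_mulVec_increment hst (c.σ y))).add
    (memLp_jumpIntegral hc.measurable_γ hc.memLp_γ h.poisson y)

/-- The Wiener increment and the jump integral are independent, so their joint law is a product, and
each factor depends only on the length of the interval. -/
lemma map_explicitPart_congr (h : IsJumpDiffusionNoise P ℱ ν W N) (hc : c.Admissible ν)
    (hst : s ≤ t) (hst' : s' ≤ t')
    (heq : (t : ℝ) - s = t' - s') (y : EuclideanSpace ℝ (Fin d)) :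
    P.map (fun ω ↦ explicitPart hc θ τ s t y (h.noiseOn s t ω)) =
      P.map (fun ω ↦ explicitPart hc θ τ s' t' y (h.noiseOn s' t' ω)) := by
  let f : EuclideanSpace ℝ (Fin m) × EuclideanSpace ℝ (Fin d) → EuclideanSpace ℝ (Fin d) :=
    fun p ↦ y + ((1 - θ) * τ) • c.b y + mulVecEuclidean (c.σ y) p.1 + p.2
  have hf : Measurable f := (((measurable_mulVecEuclidean_right (c.σ y)).comp
    measurable_fst).const_add (y + ((1 - θ) * (τ : ℝ)) • c.b y)).add measurable_snd
  have h1 (s t : ℝ≥0) : P.map (fun ω ↦ explicitPart hc θ τ s t y (h.noiseOn s t ω)) =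
      ((P.map fun ω ↦ W t ω - W s ω).prod (P.map fun ω ↦
        jumpIntegral hc.measurable_γ hc.memLp_γ s t y (N ω))).map f := by
    have hW : Measurable fun ω ↦ W t ω - W s ω := (h.measurable_W t).sub (h.measurable_W s)
    have hJ := measurable_jumpIntegral_right (s := s) (t := t) hc.measurable_γ hc.memLp_γ y
    have hJN : Measurable fun ω ↦ jumpIntegral hc.measurable_γ hc.memLp_γ s t y (N ω) :=
      hJ.comp h.poisson.measurable
    have hind : IndepFun (fun ω ↦ W t ω - W s ω)
        (fun ω ↦ jumpIntegral hc.measurable_γ hc.memLp_γ s t y (N ω)) P :=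
      (h.indepFun_increment s t).comp measurable_id hJ
    rw [← (indepFun_iff_map_prod_eq_prod_map_map hW.aemeasurable hJN.aemeasurable).1 hind,
      Measure.map_map hf (hW.prodMk hJN)]
    rfl
  have h2 : t - s = t' - s' := by
    apply NNReal.coe_injective
    rw [NNReal.coe_sub hst, NNReal.coe_sub hst', heq]
  rw [h1, h1, h.map_increment hst, h.map_increment hst', h2,
    map_jumpIntegral_congr hc.measurable_γ hc.memLp_γ h.poisson heq y]

lemma integral_norm_sq_jumpIntegral_sub_le (h : IsJumpDiffusionNoise P ℱ ν W N)
    (hc : c.Admissible ν) (hst : s ≤ t) (x y : EuclideanSpace ℝ (Fin d)) :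
    ∫ ω, ‖jumpIntegral hc.measurable_γ hc.memLp_γ s t x (N ω) -
      jumpIntegral hc.measurable_γ hc.memLp_γ s t y (N ω)‖ ^ 2 ∂P ≤
      ((t : ℝ) - s) * ∫ z, ‖c.γ x z - c.γ y z‖ ^ 2 ∂ν := by
  have hst0 : 0 ≤ (t : ℝ) - s := sub_nonneg.2 (NNReal.coe_le_coe.2 hst)
  have h1 := lintegral_sq_jumpIntegral_sub_le (s := s) (t := t) hc.measurable_γ hc.memLp_γ
    h.poisson x y
  have h2 := ((memLp_jumpIntegral (s := s) (t := t) hc.measurable_γ hc.memLp_γ h.poisson x).sub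
    (memLp_jumpIntegral (s := s) (t := t) hc.measurable_γ hc.memLp_γ h.poisson y))
  have h3 := (hc.memLp_γ x).sub (hc.memLp_γ y)
  have e (v : EuclideanSpace ℝ (Fin d)) : ‖v‖ₑ ^ 2 = ENNReal.ofReal (‖v‖ ^ 2) := by
    rw [ENNReal.ofReal_pow (norm_nonneg _), ofReal_norm]
  have h4 := ofReal_integral_eq_lintegral_ofReal (h2.integrable_norm_pow two_ne_zero)
    (Eventually.of_forall fun ω ↦ sq_nonneg _)
  have h5 := ofReal_integral_eq_lintegral_ofReal (h3.integrable_norm_pow two_ne_zero)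
    (Eventually.of_forall fun z ↦ sq_nonneg _)
  simp only [Pi.sub_apply] at h4 h5
  have h6 : ENNReal.ofReal (∫ ω, ‖jumpIntegral hc.measurable_γ hc.memLp_γ s t x (N ω) -
      jumpIntegral hc.measurable_γ hc.memLp_γ s t y (N ω)‖ ^ 2 ∂P) ≤
      ENNReal.ofReal (((t : ℝ) - s) * ∫ z, ‖c.γ x z - c.γ y z‖ ^ 2 ∂ν) := by
    rw [ENNReal.ofReal_mul hst0]
    refine (h4.trans ?_).le.trans (h1.trans (le_of_eq ?_))
    · exact lintegral_congr fun ω ↦ (e _).symm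
    · congr 1
      refine Eq.trans ?_ h5.symm
      exact lintegral_congr fun z ↦ e _
  exact (ENNReal.ofReal_le_ofReal_iff
    (mul_nonneg hst0 (integral_nonneg fun z ↦ sq_nonneg _))).1 h6

/-- With common noise the difference is a constant plus a Gaussian and a jump term, both centred and
mutually independent. Pythagoras reduces the estimate to `theta_contraction`; the exponent is halved
because the rate stands inside the square. -/
lemma integral_norm_sq_explicitPart_sub_le (h : IsJumpDiffusionNoise P ℱ ν W N)
    (hc : c.Admissible ν) (hL : 0 < L)
    (hdiss : c.StrictlyDissipative ν L) (hθ : 1 / 2 < θ) (hθ' : θ ≤ 1) (hτ : 0 < τ)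
    (hLτ : L * θ ^ 2 * τ ≤ 3 - 2 * θ) (hst : s ≤ t) (heq : (t : ℝ) - s = τ)
    (x y : EuclideanSpace ℝ (Fin d)) :
    ∫ ω, ‖explicitPart hc θ τ s t x (h.noiseOn s t ω) -
      explicitPart hc θ τ s t y (h.noiseOn s t ω)‖ ^ 2 ∂P ≤
      (Real.exp (-((θ - 1 / 2) * L * τ / 2)) *
        ‖c.implicitMap θ τ x - c.implicitMap θ τ y‖) ^ 2 := by
  have h1 (ω : Ω) : explicitPart hc θ τ s t x (h.noiseOn s t ω) -
      explicitPart hc θ τ s t y (h.noiseOn s t ω) =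
      ((x - y) + ((1 - θ) * τ) • (c.b x - c.b y)) +
      mulVecEuclidean (c.σ x - c.σ y) (W t ω - W s ω) +
      (jumpIntegral hc.measurable_γ hc.memLp_γ s t x (N ω) -
        jumpIntegral hc.measurable_γ hc.memLp_γ s t y (N ω)) := by
    rw [mulVecEuclidean_sub, smul_sub]
    simp only [explicitPart, noiseOn]
    abel
  have hJ (x : EuclideanSpace ℝ (Fin d)) :=
    memLp_jumpIntegral (s := s) (t := t) hc.measurable_γ hc.memLp_γ h.poisson x
  have hJm := measurable_jumpIntegral_right (s := s) (t := t) hc.measurable_γ hc.memLp_γ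
  have hV0 : ∫ ω, (jumpIntegral hc.measurable_γ hc.memLp_γ s t x (N ω) -
      jumpIntegral hc.measurable_γ hc.memLp_γ s t y (N ω)) ∂P = 0 := by
    rw [integral_sub ((hJ x).integrable one_le_two) ((hJ y).integrable one_le_two),
      integral_jumpIntegral hc.measurable_γ hc.memLp_γ h.poisson,
      integral_jumpIntegral hc.measurable_γ hc.memLp_γ h.poisson, sub_zero]
  have hind : IndepFun (fun ω ↦ mulVecEuclidean (c.σ x - c.σ y) (W t ω - W s ω))
      (fun ω ↦ jumpIntegral hc.measurable_γ hc.memLp_γ s t x (N ω) -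
        jumpIntegral hc.measurable_γ hc.memLp_γ s t y (N ω)) P :=
    (h.indepFun_increment s t).comp (measurable_mulVecEuclidean_right (c.σ x - c.σ y))
      ((hJm x).sub (hJm y))
  simp only [h1]
  have hV : MemLp (fun ω ↦ jumpIntegral hc.measurable_γ hc.memLp_γ s t x (N ω) -
      jumpIntegral hc.measurable_γ hc.memLp_γ s t y (N ω)) 2 P := (hJ x).sub (hJ y)
  rw [integral_norm_sq_add_add _ (h.memLp_mulVec_increment hst _) hV
    (h.integral_mulVec_increment hst _) hV0 hind, h.integral_norm_sq_mulVec_increment hst]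
  have h2 := h.integral_norm_sq_jumpIntegral_sub_le hc hst x y
  have h3 := theta_contraction (x - y) (c.b x - c.b y) hL hθ hθ' (NNReal.coe_pos.2 hτ) hLτ
    (hdiss x y)
  have h4 : c.implicitMap θ τ x - c.implicitMap θ τ y =
      (x - y) - (θ * τ) • (c.b x - c.b y) := by
    simp only [Coefficients.implicitMap, smul_sub]
    abel
  rw [mul_pow, ← Real.exp_nat_mul, h4]
  have h5 : ((2 : ℕ) : ℝ) * (-((θ - 1 / 2) * L * τ / 2)) = -((θ - 1 / 2) * L * τ) := by
    push_cast
    ring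
  rw [h5]
  rw [heq] at h2 ⊢
  exact (add_le_add le_rfl h2).trans h3

end IsJumpDiffusionNoise

end ExplicitPart

/-! ### Conditional laws by freezing the past -/

section Freezing

variable {Ω Y Ξ E : Type*} {m' mΩ : MeasurableSpace Ω} [MeasurableSpace Y] [MeasurableSpace Ξ]
  [MeasurableSpace E] {P : Measure Ω} [IsProbabilityMeasure P] {X : Ω → Y} {V : Ω → Ξ}
  {F : Y → Ξ → E} {κ : Kernel Y E}

/-- If `X` is known under `m'`, `V` is independent of `m'` and `F y V` has law `κ y`, then
`F X V` has conditional law `κ X` given `m'`. -/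
lemma measure_inter_preimage_of_indep (hm : m' ≤ mΩ) (hX : Measurable[m'] X) (hV : Measurable V)
    (hind : Indep m' (MeasurableSpace.comap V inferInstance) P)
    (hF : Measurable (Function.uncurry F)) (hκ : ∀ y, P.map (fun ω ↦ F y (V ω)) = κ y)
    {A : Set Ω} (hA : MeasurableSet[m'] A) {B : Set E} (hB : MeasurableSet B) :
    P (A ∩ (fun ω ↦ F (X ω) (V ω)) ⁻¹' B) = ∫⁻ ω in A, κ (X ω) B ∂P := by
  -- Membership in `A` is carried along with `X`; the event then depends on the pair `(X', V)`,
  -- whose law is a product.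
  let X' : Ω → Y × Prop := fun ω ↦ (X ω, ω ∈ A)
  have hX'm : Measurable[m'] X' := hX.prodMk ((@measurable_mem Ω A m').2 hA)
  have hX' : Measurable X' := hX'm.mono hm le_rfl
  have hXV : IndepFun X' V P := by
    rw [IndepFun_iff_Indep]
    exact indep_of_indep_of_le_left hind hX'm.comap_le
  let s : Set ((Y × Prop) × Ξ) := {q | q.1.2 ∧ F q.1.1 q.2 ∈ B}
  have hs : MeasurableSet s := by
    have h1 : MeasurableSet {q : (Y × Prop) × Ξ | q.1.2} :=
      measurableSet_setOfPred.2 measurable_fst.snd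
    have h2 : MeasurableSet {q : (Y × Prop) × Ξ | F q.1.1 q.2 ∈ B} :=
      hF.comp (measurable_fst.fst.prodMk measurable_snd) hB
    exact h1.inter h2
  have h1 : P (A ∩ (fun ω ↦ F (X ω) (V ω)) ⁻¹' B) = P.map (fun ω ↦ (X' ω, V ω)) s :=
    (Measure.map_apply (hX'.prodMk hV) hs).symm
  have := Measure.isProbabilityMeasure_map (μ := P) hV.aemeasurable
  have := Measure.isProbabilityMeasure_map (μ := P) hX'.aemeasurable
  rw [h1, (indepFun_iff_map_prod_eq_prod_map_map hX'.aemeasurable hV.aemeasurable).1 hXV,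
    Measure.prod_apply hs, lintegral_map (measurable_measure_prodMk_left hs) hX',
    ← lintegral_indicator (hm _ hA)]
  refine lintegral_congr fun ω ↦ ?_
  rw [Measure.map_apply hV (measurable_prodMk_left hs)]
  by_cases hω : ω ∈ A
  · have h2 : Measurable fun ω' ↦ F (X ω) (V ω') := (hF.comp measurable_prodMk_left).comp hV
    rw [Set.indicator_of_mem hω, ← hκ, Measure.map_apply h2 hB]
    congr 1
    ext ω'
    simp [s, X', hω]
  · rw [Set.indicator_of_notMem hω]
    convert measure_empty (μ := P)
    ext ω'
    simp [s, X', hω]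

lemma map_eq_bind_of_indep (hm : m' ≤ mΩ) (hX : Measurable[m'] X) (hV : Measurable V)
    (hind : Indep m' (MeasurableSpace.comap V inferInstance) P)
    (hF : Measurable (Function.uncurry F)) (hκ : ∀ y, P.map (fun ω ↦ F y (V ω)) = κ y) :
    P.map (fun ω ↦ F (X ω) (V ω)) = (P.map X).bind κ := by
  have hXm : Measurable X := hX.mono hm le_rfl
  have hFm : Measurable fun ω ↦ F (X ω) (V ω) := hF.comp (hXm.prodMk hV)
  ext B hB
  have h1 := measure_inter_preimage_of_indep hm hX hV hind hF hκ MeasurableSet.univ hB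
  rw [Set.univ_inter, Measure.restrict_univ] at h1
  rw [Measure.map_apply hFm hB, Measure.bind_apply hB κ.aemeasurable,
    lintegral_map (κ.measurable_coe hB) hXm]
  exact h1

lemma condExp_indicator_of_indep [IsMarkovKernel κ] (hm : m' ≤ mΩ) (hX : Measurable[m'] X)
    (hV : Measurable V) (hind : Indep m' (MeasurableSpace.comap V inferInstance) P)
    (hF : Measurable (Function.uncurry F)) (hκ : ∀ y, P.map (fun ω ↦ F y (V ω)) = κ y)
    {B : Set E} (hB : MeasurableSet B) :
    P[((fun ω ↦ F (X ω) (V ω)) ⁻¹' B).indicator (fun _ ↦ (1 : ℝ)) | m'] =ᵐ[P]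
      fun ω ↦ (κ (X ω)).real B := by
  have hXm : Measurable X := hX.mono hm le_rfl
  have hFB : MeasurableSet ((fun ω ↦ F (X ω) (V ω)) ⁻¹' B) := hF.comp (hXm.prodMk hV) hB
  have hκm : Measurable fun y ↦ (κ y).real B := (κ.measurable_coe hB).ennreal_toReal
  have hint : Integrable (fun ω ↦ (κ (X ω)).real B) P :=
    (integrable_const (1 : ℝ)).mono' (hκm.comp hXm).aestronglyMeasurable
      (Eventually.of_forall fun ω ↦ by
        rw [Real.norm_eq_abs, abs_of_nonneg measureReal_nonneg]
        exact measureReal_le_one)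
  refine (ae_eq_condExp_of_forall_setIntegral_eq hm
    ((integrable_const (1 : ℝ)).indicator hFB) (fun A _ _ ↦ hint.integrableOn) (fun A hA _ ↦ ?_)
    (hκm.comp hX).stronglyMeasurable.aestronglyMeasurable).symm
  rw [setIntegral_indicator hFB, setIntegral_const, smul_eq_mul, mul_one, measureReal_def,
    measure_inter_preimage_of_indep hm hX hV hind hF hκ hA hB,
    integral_eq_lintegral_of_nonneg_ae (Eventually.of_forall fun ω ↦ measureReal_nonneg)
      (hκm.comp hXm).aestronglyMeasurable]
  congr 1
  refine lintegral_congr fun ω ↦ ?_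
  rw [measureReal_def, ENNReal.ofReal_toReal (measure_ne_top _ _)]

end Freezing

/-! ### The chain, its kernel and uniqueness of solutions -/

section Chain

variable {Ω S : Type*} [mΩ : MeasurableSpace Ω] [MeasurableSpace S] {d m : ℕ}
  {P : Measure Ω} [IsProbabilityMeasure P] {ℱ : Filtration ℝ≥0 mΩ} {ν : Measure S} [SigmaFinite ν]
  {W : ℝ≥0 → Ω → EuclideanSpace ℝ (Fin m)} {N : Ω → Measure (ℝ≥0 × S)}
  {c : Coefficients d m S} {L θ : ℝ} {τ : ℝ≥0}
  {g : EuclideanSpace ℝ (Fin d) → EuclideanSpace ℝ (Fin d)}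

namespace IsJumpDiffusionNoise

/-- The chain obtained by solving the implicit equation of the stochastic theta method with the
inverse `g` of `x ↦ x - θ τ b(x)`. -/
noncomputable def chain (h : IsJumpDiffusionNoise P ℱ ν W N) (hc : c.Admissible ν) (θ : ℝ)
    (τ : ℝ≥0) (g : EuclideanSpace ℝ (Fin d) → EuclideanSpace ℝ (Fin d))
    (x : EuclideanSpace ℝ (Fin d)) : ℕ → Ω → EuclideanSpace ℝ (Fin d)
  | 0 => fun _ ↦ x
  | j + 1 => fun ω ↦ g (explicitPart hc θ τ (j * τ) ((j + 1 : ℕ) * τ) (h.chain hc θ τ g x j ω)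
      (h.noiseOn (j * τ) ((j + 1 : ℕ) * τ) ω))

lemma measurable_uncurry_step (h : IsJumpDiffusionNoise P ℱ ν W N) (hc : c.Admissible ν)
    (hg : Measurable g) (s t : ℝ≥0) : Measurable (Function.uncurry
      fun (y : EuclideanSpace ℝ (Fin d)) ω ↦ g (explicitPart hc θ τ s t y (h.noiseOn s t ω))) :=
  hg.comp (Measurable.comp (g := fun q : EuclideanSpace ℝ (Fin d) ×
      (EuclideanSpace ℝ (Fin m) × Measure (ℝ≥0 × S)) ↦ explicitPart hc θ τ s t q.1 q.2)
    (f := fun q : EuclideanSpace ℝ (Fin d) × Ω ↦ (q.1, h.noiseOn s t q.2))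
    (measurable_explicitPart hc)
    (measurable_fst.prodMk ((h.measurable_noiseOn s t).comp measurable_snd)))

/-- The transition kernel of the stochastic theta method. -/
noncomputable def chainKernel (h : IsJumpDiffusionNoise P ℱ ν W N) (hc : c.Admissible ν) (θ : ℝ)
    (τ : ℝ≥0) (hg : Measurable g) :
    Kernel (EuclideanSpace ℝ (Fin d)) (EuclideanSpace ℝ (Fin d)) :=
  randomMapKernel P (h.measurable_uncurry_step (θ := θ) (τ := τ) hc hg 0 τ)

instance (h : IsJumpDiffusionNoise P ℱ ν W N) (hc : c.Admissible ν) (hg : Measurable g) :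
    IsMarkovKernel (h.chainKernel hc θ τ hg) :=
  inferInstanceAs (IsMarkovKernel (randomMapKernel P _))

/-- `implicitMap` undoes `g`, so through `implicitMap` the new state is the explicit part, and the
mean square estimate for the latter applies directly. -/
lemma isContractiveVia_chainKernel (h : IsJumpDiffusionNoise P ℱ ν W N) (hc : c.Admissible ν)
    (hb : Continuous c.b) (hL : 0 < L) (hdiss : c.StrictlyDissipative ν L) (hθ : 1 / 2 < θ)
    (hθ' : θ ≤ 1) (hτ : 0 < τ) (hLτ : L * θ ^ 2 * τ ≤ 3 - 2 * θ) (hg : Measurable g)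
    (hgr : Function.RightInverse g (c.implicitMap θ τ)) :
    IsContractiveVia (c.implicitMap θ τ) (Real.exp (-((θ - 1 / 2) * L * τ / 2)))
      (h.chainKernel hc θ τ hg) := by
  refine isContractiveVia_randomMapKernel (c.continuous_implicitMap hb) (Real.exp_pos _).le
    (h.measurable_uncurry_step hc hg 0 τ) (fun x ↦ ?_) fun x y ↦ ?_
  · simp only [hgr _]
    exact h.memLp_explicitPart hc zero_le x
  · simp only [hgr _]
    exact h.integral_norm_sq_explicitPart_sub_le hc hL hdiss hθ hθ' hτ hLτ zero_le (by simp) x y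

lemma measurable_chain (h : IsJumpDiffusionNoise P ℱ ν W N) (hc : c.Admissible ν)
    (hg : Measurable g) (x : EuclideanSpace ℝ (Fin d)) (j : ℕ) :
    Measurable[ℱ (j * τ)] (h.chain hc θ τ g x j) := by
  induction j with
  | zero => exact measurable_const
  | succ j ih =>
    have hle : (j : ℝ≥0) * τ ≤ (j + 1 : ℕ) * τ := by gcongr; simp
    have h1 : Measurable[ℱ ((j + 1 : ℕ) * τ)] fun ω ↦ (h.chain hc θ τ g x j ω,
        (W ((j + 1 : ℕ) * τ) ω - W (j * τ) ω,
          (N ω).restrict (Set.Iic ((j + 1 : ℕ) * τ) ×ˢ Set.univ))) :=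
      (ih.mono (ℱ.mono hle) le_rfl).prodMk
        (((h.adapted_W _).sub ((h.adapted_W _).mono (ℱ.mono hle) le_rfl)).prodMk
          (h.adapted_N _))
    -- Only the part of `N` up to the end of the step is used; unlike `N` itself, it is known under
    -- the filtration at that time.
    have h2 : h.chain hc θ τ g x (j + 1) = fun ω ↦ g (explicitPart hc θ τ (j * τ)
        ((j + 1 : ℕ) * τ) (h.chain hc θ τ g x j ω) (W ((j + 1 : ℕ) * τ) ω - W (j * τ) ω,
          (N ω).restrict (Set.Iic ((j + 1 : ℕ) * τ) ×ˢ Set.univ))) := by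
      funext ω
      rw [explicitPart_congr hc _ _ Set.Ioc_subset_Iic_self]
      rfl
    rw [h2]
    exact hg.comp (Measurable.comp (g := fun q : EuclideanSpace ℝ (Fin d) ×
      (EuclideanSpace ℝ (Fin m) × Measure (ℝ≥0 × S)) ↦
        explicitPart hc θ τ (j * τ) ((j + 1 : ℕ) * τ) q.1 q.2)
      (f := fun ω ↦ (h.chain hc θ τ g x j ω, (W ((j + 1 : ℕ) * τ) ω - W (j * τ) ω,
        (N ω).restrict (Set.Iic ((j + 1 : ℕ) * τ) ×ˢ Set.univ))))
      (measurable_explicitPart hc) h1)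

/-- The noise after time `s`. -/
noncomputable def future (_h : IsJumpDiffusionNoise P ℱ ν W N) (s : ℝ≥0) (ω : Ω) :
    (ℝ≥0 → EuclideanSpace ℝ (Fin m)) × Measure (ℝ≥0 × S) :=
  ((fun t ↦ W (s + t) ω - W s ω), (N ω).restrict (Set.Ioi s ×ˢ Set.univ))

lemma measurable_future (h : IsJumpDiffusionNoise P ℱ ν W N) (s : ℝ≥0) :
    Measurable (h.future s) :=
  (measurable_pi_lambda _ fun _ ↦ (h.measurable_W _).sub (h.measurable_W _)).prodMk
    ((measurable_measure_restrict (measurableSet_Ioi.prod .univ)).comp h.poisson.measurable)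

/-- A step of the stochastic theta method as a function of the noise after the time `s`. -/
noncomputable def stepFuture (_h : IsJumpDiffusionNoise P ℱ ν W N) (hc : c.Admissible ν) (θ : ℝ)
    (τ : ℝ≥0) (g : EuclideanSpace ℝ (Fin d) → EuclideanSpace ℝ (Fin d)) (s t : ℝ≥0)
    (y : EuclideanSpace ℝ (Fin d))
    (v : (ℝ≥0 → EuclideanSpace ℝ (Fin m)) × Measure (ℝ≥0 × S)) : EuclideanSpace ℝ (Fin d) :=
  g (explicitPart hc θ τ s t y (v.1 (t - s), v.2))

lemma measurable_stepFuture (h : IsJumpDiffusionNoise P ℱ ν W N) (hc : c.Admissible ν)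
    (hg : Measurable g) (s t : ℝ≥0) :
    Measurable (Function.uncurry (h.stepFuture hc θ τ g s t)) :=
  hg.comp (Measurable.comp (g := fun q : EuclideanSpace ℝ (Fin d) ×
      (EuclideanSpace ℝ (Fin m) × Measure (ℝ≥0 × S)) ↦ explicitPart hc θ τ s t q.1 q.2)
    (f := fun q : EuclideanSpace ℝ (Fin d) ×
      ((ℝ≥0 → EuclideanSpace ℝ (Fin m)) × Measure (ℝ≥0 × S)) ↦ (q.1, (q.2.1 (t - s), q.2.2)))
    (measurable_explicitPart hc)
    (measurable_fst.prodMk (((measurable_pi_apply (t - s)).comp measurable_snd.fst).prodMk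
      measurable_snd.snd)))

lemma stepFuture_future (h : IsJumpDiffusionNoise P ℱ ν W N) (hc : c.Admissible ν) {s t : ℝ≥0}
    (hst : s ≤ t) (y : EuclideanSpace ℝ (Fin d)) (ω : Ω) :
    h.stepFuture hc θ τ g s t y (h.future s ω) =
      g (explicitPart hc θ τ s t y (h.noiseOn s t ω)) := by
  simp only [stepFuture, future, noiseOn, add_tsub_cancel_of_le hst]
  rw [explicitPart_congr hc y _ Set.Ioc_subset_Ioi_self]

/-- Every step has length `τ`, so its law for a fixed state is that of the step over `(0, τ]` which
defines the kernel. -/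
lemma map_stepFuture (h : IsJumpDiffusionNoise P ℱ ν W N) (hc : c.Admissible ν)
    (hg : Measurable g) (j : ℕ) (y : EuclideanSpace ℝ (Fin d)) :
    P.map (fun ω ↦ h.stepFuture hc θ τ g (j * τ) ((j + 1 : ℕ) * τ) y (h.future (j * τ) ω)) =
      h.chainKernel hc θ τ hg y := by
  have hle : (j : ℝ≥0) * τ ≤ (j + 1 : ℕ) * τ := by gcongr; simp
  have hm (s t : ℝ≥0) : Measurable fun ω ↦ explicitPart hc θ τ s t y (h.noiseOn s t ω) :=
    Measurable.comp (g := fun q : EuclideanSpace ℝ (Fin d) ×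
        (EuclideanSpace ℝ (Fin m) × Measure (ℝ≥0 × S)) ↦ explicitPart hc θ τ s t q.1 q.2)
      (f := fun ω ↦ (y, h.noiseOn s t ω)) (measurable_explicitPart hc)
      (measurable_const.prodMk (h.measurable_noiseOn s t))
  simp only [h.stepFuture_future hc hle]
  rw [chainKernel, randomMapKernel_apply]
  have h1 (s t : ℝ≥0) := Measure.map_map (μ := P) hg (hm s t)
  have h2 := h.map_explicitPart_congr (θ := θ) (τ := τ) hc hle (zero_le (a := τ))
    (by push_cast; ring) y
  exact (h1 _ _).symm.trans ((congrArg (Measure.map g) h2).trans (h1 _ _))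

lemma indep_future (h : IsJumpDiffusionNoise P ℱ ν W N) (s : ℝ≥0) :
    Indep (ℱ s) (MeasurableSpace.comap (h.future s) inferInstance) P := h.indep_past s

lemma chain_succ (h : IsJumpDiffusionNoise P ℱ ν W N) (hc : c.Admissible ν)
    (x : EuclideanSpace ℝ (Fin d)) (j : ℕ) :
    h.chain hc θ τ g x (j + 1) = fun ω ↦ h.stepFuture hc θ τ g (j * τ) ((j + 1 : ℕ) * τ)
      (h.chain hc θ τ g x j ω) (h.future (j * τ) ω) := by
  have hle : (j : ℝ≥0) * τ ≤ (j + 1 : ℕ) * τ := by gcongr; simp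
  funext ω
  rw [h.stepFuture_future hc hle]
  rfl

lemma map_chain_succ (h : IsJumpDiffusionNoise P ℱ ν W N) (hc : c.Admissible ν)
    (hg : Measurable g) (x : EuclideanSpace ℝ (Fin d)) (j : ℕ) :
    P.map (h.chain hc θ τ g x (j + 1)) =
      (P.map (h.chain hc θ τ g x j)).bind (h.chainKernel hc θ τ hg) := by
  rw [chain_succ]
  exact map_eq_bind_of_indep (ℱ.le _) (h.measurable_chain hc hg x j) (h.measurable_future _)
    (h.indep_future _) (h.measurable_stepFuture hc hg _ _) (h.map_stepFuture hc hg j)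

lemma condExp_chain (h : IsJumpDiffusionNoise P ℱ ν W N) (hc : c.Admissible ν)
    (hg : Measurable g) (x : EuclideanSpace ℝ (Fin d)) (j : ℕ)
    {B : Set (EuclideanSpace ℝ (Fin d))} (hB : MeasurableSet B) :
    P[(h.chain hc θ τ g x (j + 1) ⁻¹' B).indicator (fun _ ↦ (1 : ℝ)) | ℱ (j * τ)] =ᵐ[P]
      fun ω ↦ (h.chainKernel hc θ τ hg (h.chain hc θ τ g x j ω)).real B := by
  rw [chain_succ]
  exact condExp_indicator_of_indep (ℱ.le _) (h.measurable_chain hc hg x j)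
    (h.measurable_future _) (h.indep_future _) (h.measurable_stepFuture hc hg _ _)
    (h.map_stepFuture hc hg j) hB

lemma isSTM_chain (h : IsJumpDiffusionNoise P ℱ ν W N) (hc : c.Admissible ν)
    (hg : Measurable g) (hgr : Function.RightInverse g (c.implicitMap θ τ))
    (x : EuclideanSpace ℝ (Fin d)) :
    IsSTM P ℱ ν W N c θ τ x (h.chain hc θ τ g x) where
  adapted := h.measurable_chain hc hg x
  initial := Eventually.of_forall fun _ ↦ rfl
  step j := by
    have hle : (j : ℝ≥0) * τ ≤ (j + 1 : ℕ) * τ := by gcongr; simp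
    have hZ := h.measurable_chain (θ := θ) (τ := τ) hc hg x j
    refine ⟨fun ω ↦ jumpIntegral hc.measurable_γ hc.memLp_γ (j * τ) ((j + 1 : ℕ) * τ)
      (h.chain hc θ τ g x j ω) (N ω), ?_, Eventually.of_forall fun ω ↦ ?_⟩
    · refine isCompensatedIntegral_jumpIntegral hc.measurable_γ hc.memLp_γ h.poisson hle
        (hZ.mono (ℱ.le _) le_rfl) ?_
      rw [IndepFun_iff_Indep]
      refine indep_of_indep_of_le_left (indep_of_indep_of_le_right (h.indep_future (j * τ)) ?_)
        hZ.comap_le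
      exact (measurable_snd.comp (comap_measurable (h.future (j * τ)))).comap_le
    · have h1 : c.implicitMap θ τ (h.chain hc θ τ g x (j + 1) ω) = explicitPart hc θ τ (j * τ)
          ((j + 1 : ℕ) * τ) (h.chain hc θ τ g x j ω) (h.noiseOn (j * τ) ((j + 1 : ℕ) * τ) ω) :=
        hgr _
      rw [Coefficients.implicitMap, sub_eq_iff_eq_add] at h1
      refine h1.trans ?_
      simp only [explicitPart, noiseOn, mulVecEuclidean]
      abel

end IsJumpDiffusionNoise

/-- Two solutions of the stochastic theta method with the same starting point agree almost
surely. -/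
lemma IsSTM.ae_eq {x : EuclideanSpace ℝ (Fin d)} {Z Z' : ℕ → Ω → EuclideanSpace ℝ (Fin d)}
    (hinj : Function.Injective (c.implicitMap θ τ)) (hZ : IsSTM P ℱ ν W N c θ τ x Z)
    (hZ' : IsSTM P ℱ ν W N c θ τ x Z') : ∀ᵐ ω ∂P, ∀ n, Z n ω = Z' n ω := by
  rw [ae_all_iff]
  intro n
  induction n with
  | zero =>
    filter_upwards [hZ.initial, hZ'.initial] with ω h1 h2
    rw [h1, h2]
  | succ n ih =>
    obtain ⟨J, hJ, hstep⟩ := hZ.step n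
    obtain ⟨J', hJ', hstep'⟩ := hZ'.step n
    have h1 := hJ _ (monotone_spanningSets ν) (measurableSet_spanningSets ν)
      (measure_spanningSets_lt_top ν) (iUnion_spanningSets ν)
    have h2 := hJ' _ (monotone_spanningSets ν) (measurableSet_spanningSets ν)
      (measure_spanningSets_lt_top ν) (iUnion_spanningSets ν)
    -- `J` and `J'` are limits in measure along one and the same exhaustion. As `Z n` and `Z' n`
    -- agree almost surely, so do the approximations and hence the limits; injectivity of
    -- `implicitMap` then gives the next states.
    have h3 := h1.congr_left (f' := fun k ω ↦ truncatedIntegral ν (n * τ) ((n + 1 : ℕ) * τ)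
      (spanningSets ν k) (c.γ (Z' n ω)) (N ω)) fun k ↦ by
        filter_upwards [ih] with ω hω
        rw [hω]
    filter_upwards [ih, hstep, hstep', tendstoInMeasure_ae_unique h3 h2] with ω h4 h5 h6 h7
    apply hinj
    rw [h4, h7] at h5
    have h8 {p q u v w z : EuclideanSpace ℝ (Fin d)} (hp : p = u + v + q + w + z) :
        p - q = u + v + w + z := by
      rw [hp]
      abel
    exact (h8 h5).trans (h8 h6).symm

end Chain

end JumpSTM

theorem theorem2p1 {Ω S : Type*} [mΩ : MeasurableSpace Ω] [MeasurableSpace S] {d m : ℕ}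
    (P : Measure Ω) [IsProbabilityMeasure P] (ℱ : Filtration ℝ≥0 mΩ)
    (ν : Measure S) [SigmaFinite ν]
    (W : ℝ≥0 → Ω → EuclideanSpace ℝ (Fin m)) (N : Ω → Measure (ℝ≥0 × S))
    (hnoise : JumpSTM.IsJumpDiffusionNoise P ℱ ν W N)
    (c : JumpSTM.Coefficients d m S) (hc : c.Admissible ν) (hb : Continuous c.b)
    (L : ℝ) (hL : 0 < L) (hdiss : c.StrictlyDissipative ν L)
    (θ : ℝ) (hθ : 1 / 2 < θ) (hθ' : θ ≤ 1)
    (τ : ℝ≥0) (hτ : 0 < τ) (hτ' : τ < 1) (hLτ : L * θ ^ 2 * τ ≤ 3 - 2 * θ) :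
    -- the scheme is well posed: from every `x` there is a solution, almost surely unique
    (∀ x, ∃ Z, JumpSTM.IsSTM P ℱ ν W N c θ τ x Z) ∧
    (∀ x Z Z', JumpSTM.IsSTM P ℱ ν W N c θ τ x Z → JumpSTM.IsSTM P ℱ ν W N c θ τ x Z' →
      ∀ᵐ ω ∂P, ∀ n, Z n ω = Z' n ω) ∧
    -- it is a Markov chain with a transition kernel
    ∃ κ : Kernel (EuclideanSpace ℝ (Fin d)) (EuclideanSpace ℝ (Fin d)),
      IsMarkovKernel κ ∧ JumpSTM.IsTransitionKernel P ℱ ν W N c θ τ κ ∧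
      -- which has a unique invariant probability measure
      ∃ π : Measure (EuclideanSpace ℝ (Fin d)), IsProbabilityMeasure π ∧ κ.Invariant π ∧
        (∀ π' : Measure (EuclideanSpace ℝ (Fin d)),
          IsProbabilityMeasure π' → κ.Invariant π' → π' = π) ∧
        -- and this measure is exponentially mixing
        ∃ C : EuclideanSpace ℝ (Fin d) → ℝ,
          ∀ (φ : EuclideanSpace ℝ (Fin d) → ℝ) (K : ℝ≥0), LipschitzWith K φ →
            Integrable φ π ∧
            ∀ x Z, JumpSTM.IsSTM P ℱ ν W N c θ τ x Z → ∀ n : ℕ,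
              Integrable (fun ω ↦ φ (Z n ω)) P ∧
              |(∫ ω, φ (Z n ω) ∂P) - ∫ y, φ y ∂π| ≤
                K * C x * Real.exp (-((θ - 1 / 2) * L * (n * τ) / 2)) := by
  have hθ0 : 0 ≤ θ := by linarith
  have hτ0 : 0 < (τ : ℝ) := NNReal.coe_pos.2 hτ
  obtain ⟨g, hg, hgl, hgr⟩ := hdiss.exists_inverse hb hL hθ0 hτ0.le
  have hG := c.continuous_implicitMap (θ := θ) (τ := τ) hb
  have hG1 := hdiss.norm_sub_le (c := c) hL hθ0 hτ0.le
  have hκ := hnoise.isContractiveVia_chainKernel hc hb hL hdiss hθ hθ' hτ hLτ hg hgr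
  have hr0 : 0 ≤ Real.exp (-((θ - 1 / 2) * L * τ / 2)) := (Real.exp_pos _).le
  have hr1 : Real.exp (-((θ - 1 / 2) * L * τ / 2)) < 1 := by
    rw [Real.exp_lt_one_iff, neg_lt_zero]
    have : 0 < θ - 1 / 2 := by linarith
    positivity
  have hsol (x : EuclideanSpace ℝ (Fin d)) :=
    hnoise.isSTM_chain (θ := θ) (τ := τ) hc hg hgr x
  have huniq {x : EuclideanSpace ℝ (Fin d)} {Z Z' : ℕ → Ω → EuclideanSpace ℝ (Fin d)}
      (hZ : JumpSTM.IsSTM P ℱ ν W N c θ τ x Z) (hZ' : JumpSTM.IsSTM P ℱ ν W N c θ τ x Z') :=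
    hZ.ae_eq hgl.injective hZ'
  refine ⟨fun x ↦ ⟨_, hsol x⟩, fun x Z Z' ↦ huniq, hnoise.chainKernel hc θ τ hg, inferInstance,
    fun x Z hZ n B hB ↦ ?_, ?_⟩
  -- By uniqueness an arbitrary solution may be replaced by the constructed chain.
  · have h1 := huniq hZ (hsol x)
    have h2 := hnoise.condExp_chain (θ := θ) (τ := τ) hc hg x n hB
    have h3 : (Z (n + 1) ⁻¹' B).indicator (fun _ ↦ (1 : ℝ)) =ᵐ[P]
        (hnoise.chain hc θ τ g x (n + 1) ⁻¹' B).indicator (fun _ ↦ (1 : ℝ)) := by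
      filter_upwards [h1] with ω hω
      have h4 : ω ∈ Z (n + 1) ⁻¹' B ↔ ω ∈ hnoise.chain hc θ τ g x (n + 1) ⁻¹' B := by
        rw [Set.mem_preimage, Set.mem_preimage, hω]
      by_cases h5 : ω ∈ hnoise.chain hc θ τ g x (n + 1) ⁻¹' B
      · rw [Set.indicator_of_mem h5, Set.indicator_of_mem (h4.2 h5)]
      · rw [Set.indicator_of_notMem h5, Set.indicator_of_notMem (h5 ∘ h4.1)]
    refine (condExp_congr_ae h3).trans (h2.trans ?_)
    filter_upwards [h1] with ω hω
    rw [hω]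
  · obtain ⟨π, hπ, hinv, hπu, hπi⟩ := hκ.exists_invariant hG hG1 hr0 hr1
    -- The constant is the mean distance from `x` to a `π`-distributed point, measured through
    -- `implicitMap`; `hπi` makes it finite.
    refine ⟨π, hπ, hinv, hπu, fun x ↦ ∫ y, ‖c.implicitMap θ τ y - c.implicitMap θ τ x‖ ∂π,
      fun φ K hφ ↦ ?_⟩
    have hφ' := JumpSTM.lipVia_of_lipschitzWith hG1 hφ
    refine ⟨hφ'.integrable hG 0 (hπi 0), fun x Z hZ n ↦ ?_⟩
    have hm (j : ℕ) : Measurable (hnoise.chain hc θ τ g x j) :=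
      (hnoise.measurable_chain hc hg x j).mono (ℱ.le _) le_rfl
    have hZc : (fun ω ↦ φ (Z n ω)) =ᵐ[P] fun ω ↦ φ (hnoise.chain hc θ τ g x n ω) := by
      filter_upwards [huniq hZ (hsol x)] with ω hω
      rw [hω]
    have hμ0 : P.map (hnoise.chain hc θ τ g x 0) = Measure.dirac x := by
      simp only [JumpSTM.IsJumpDiffusionNoise.chain]
      rw [Measure.map_const, measure_univ, one_smul]
    have : IsProbabilityMeasure (P.map (hnoise.chain hc θ τ g x 0)) :=
      Measure.isProbabilityMeasure_map (hm 0).aemeasurable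
    -- Started from the point mass at `x`, this identifies the expectation of `φ` at time `n` with
    -- the `n`-th iterate of the Markov operator at `x`.
    obtain ⟨-, h1⟩ := hκ.integral_chain hG (μ := fun j ↦ P.map (hnoise.chain hc θ τ g x j))
      (fun y ↦ by
        simp only [hμ0]
        exact integrable_dirac (by finiteness))
      (fun j ↦ hnoise.map_chain_succ hc hg x j) n
    obtain ⟨h2, h3⟩ := h1 φ K K.2 hφ'
    have hφm : AEStronglyMeasurable φ (P.map (hnoise.chain hc θ τ g x n)) :=
      hφ.continuous.aestronglyMeasurable
    rw [integrable_map_measure hφm (hm n).aemeasurable] at h2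
    rw [integral_map (hm n).aemeasurable hφm, hμ0, integral_dirac] at h3
    refine ⟨(integrable_congr hZc).2 h2, ?_⟩
    rw [integral_congr_ae hZc, h3]
    refine (hκ.abs_iterate_sub_integral_le hG hr0 hinv hπi K.2 hφ' x n).trans (le_of_eq ?_)
    rw [← Real.exp_nat_mul, show (n : ℝ) * -((θ - 1 / 2) * L * τ / 2) =
      -((θ - 1 / 2) * L * (n * τ) / 2) by ring]
    exact mul_right_comm _ _ _
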